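/- There exist a polygonal cell complex $\mathcal K$ with $210$ vertices, $510$ edges and $300$ faces ($210$ triangles, $60$ quadrilaterals and $30$ pentagons), given by the cyclically ordered tuples of distinct vertices of its faces (an edge being determined by its two end points), a refinement of $\mathcal K$ to a triangulation, and a map $\varphi:\mathcal K\to\mathbb R^3$ that is affine on each triangle of the refinement and on each edge of $\mathcal K$, such that the following hold. (1) $\mathcal K$ is a closed connected surface: every edge is used exactly twice by the faces, the link of every vertex is a single cycle, and $\mathcal K$ is connected. Its Euler characteristic is $0$, the group $H_1(\mathcal K;\mathbb Z)$ has a nonzero element of finite order, and $\mathcal K$ is homeomorphic to the Klein bottle. (2) The map $\varphi$ sends each face injectively onto a polygon that lies in a plane. At each vertex the interior angles of the faces (measured in their images) add up to $2\pi$. The vertex figure of each vertex $v$, that is, the closed spherical polygon formed by the directions in which the images of the faces at $v$ leave $\varphi(v)$, is embedded (without self-intersections). (3) There is a length metric on $\mathcal K$, inducing its topology, that is flat (every point has a ball isometric to a Euclidean disc of the same radius), and for which $\varphi$ is a local isometric embedding: every point of $\mathcal K$ has a neighbourhood $U$ such that $\varphi|_U$ is a topological embedding and the distance of any two points of $U$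 equals the infimum of the lengths of the curves in $\varphi(U)$ that join their images. In other words, $\varphi$ is a piecewise linear isometric immersion of a flat Klein bottle into $\mathbb R^3$. -/

import Mathlib

open Set Topology
open scoped ENNReal unitInterval

/-- Euclidean 3-space. -/
abbrev E3 : Type := EuclideanSpace ℝ (Fin 3)

/-- A two-dimensional polygonal cell complex, given by the list of its faces: the face `f` is the
polygon with the cyclically ordered tuple of distinct vertices `vert f 0, …, vert f (size f - 1)`.
An edge is determined by its two end points. -/
structure PolyhedralComplex (V F : Type) where
  size : F → ℕ
  three_le_size : ∀ f, 3 ≤ size f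
  vert : ∀ f, Fin (size f) → V
  vert_injective : ∀ f, Function.Injective (vert f)

namespace PolyhedralComplex

variable {V F : Type} (K : PolyhedralComplex V F)

/-- The vertex of the face `f` that follows its `i`-th vertex in the cyclic order. -/
def next (f : F) (i : Fin (K.size f)) : V := K.vert f (finRotate (K.size f) i)

/-- The vertex of the face `f` that precedes its `i`-th vertex in the cyclic order. -/
def prev (f : F) (i : Fin (K.size f)) : V := K.vert f ((finRotate (K.size f)).symm i)

/-- The side of a face that starts at its `i`-th vertex, as an unordered pair of vertices. -/
def side (s : Σ f, Fin (K.size f)) : Sym2 V := s(K.vert s.1 s.2, K.next s.1 s.2)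

/-- The edges of the complex: all sides of all faces. -/
def edges [Fintype F] [DecidableEq V] : Finset (Sym2 V) := Finset.univ.image K.side

/-- The Euler characteristic. -/
def eulerChar [Fintype V] [Fintype F] [DecidableEq V] : ℤ :=
  (Fintype.card V : ℤ) - (K.edges.card : ℤ) + (Fintype.card F : ℤ)

/-! ### Geometric realization

The complex is refined to a simplicial complex by adding one vertex `Sum.inr f` inside each face `f`
and joining it to the boundary of the face. The underlying space is the geometric realization of
this simplicial complex, in barycentric coordinates. -/

section Space

variable [DecidableEq V] [DecidableEq F]

/-- The vertex `v`, as a point of the realization. -/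
def vpt (v : V) : V ⊕ F → ℝ := Pi.single (Sum.inl v) 1

/-- The additional vertex inside the face `f`, as a point of the realization. -/
def fpt (f : F) : V ⊕ F → ℝ := Pi.single (Sum.inr f) 1

/-- The closed 2-cell of the face `f`. -/
def cell (f : F) : Set (V ⊕ F → ℝ) :=
  ⋃ i : Fin (K.size f), convexHull ℝ {fpt f, vpt (K.vert f i), vpt (K.next f i)}

/-- The underlying space of the complex. -/
def space : Set (V ⊕ F → ℝ) := ⋃ f, K.cell f

/-- The link of the vertex `v` in the refined complex: the union of the edges that are opposite to
`v` in the triangles at `v`. -/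
def link (v : V) : Set (V ⊕ F → ℝ) :=
  ⋃ (f : F) (i : Fin (K.size f)) (_ : K.vert f i = v),
    segment ℝ (vpt (K.prev f i)) (fpt f) ∪ segment ℝ (fpt f) (vpt (K.next f i))

/-- The complex is a closed connected surface: every edge is used exactly twice by the faces, the
link of every vertex is connected (so that it is a single cycle), and the complex is connected. -/
structure IsClosedSurface [Fintype F] : Prop where
  edge_twice : ∀ e ∈ K.edges, (Finset.univ.filter fun s => K.side s = e).card = 2
  link_connected : ∀ v, IsConnected (K.link v)
  connected : IsConnected K.space

end Space

/-! ### Cellular homology in degree one -/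

section Homology

variable [Fintype V] [Fintype F] [DecidableEq V]

/-- Cellular 1-chains: `c u v` is the coefficient of the edge between `u` and `v`, oriented
from `u` to `v`. -/
def chains₁ : AddSubgroup (V → V → ℤ) where
  carrier := {c | (∀ u v, c u v = -c v u) ∧ ∀ u v, s(u, v) ∉ K.edges → c u v = 0}
  zero_mem' := by simp
  add_mem' := by
    rintro a b ⟨ha, ha'⟩ ⟨hb, hb'⟩
    refine ⟨fun u v => ?_, fun u v h => ?_⟩
    · simp only [Pi.add_apply]
      rw [ha u v, hb u v]
      ring
    · simp [ha' u v h, hb' u v h]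
  neg_mem' := by
    rintro a ⟨ha, ha'⟩
    refine ⟨fun u v => ?_, fun u v h => ?_⟩
    · simp only [Pi.neg_apply]
      rw [ha u v]
    · simp [ha' u v h]

/-- The boundary of a 1-chain: the edge from `u` to `v` has boundary `v - u`. -/
def boundary₁ : (V → V → ℤ) →+ (V → ℤ) where
  toFun c v := ∑ u, c u v
  map_zero' := by ext; simp
  map_add' a b := by ext; simp [Finset.sum_add_distrib]

/-- The boundary of a 2-chain: a face, oriented by the order of its vertices, has as its boundary
the sum of its sides, each oriented from a vertex to the next one. -/
def boundary₂ : (F → ℤ) →+ (V → V → ℤ) where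
  toFun a u v := ∑ f, a f * ∑ i : Fin (K.size f),
    ((if K.vert f i = u ∧ K.next f i = v then 1 else 0) -
      (if K.vert f i = v ∧ K.next f i = u then 1 else 0))
  map_zero' := by ext; simp
  map_add' a b := by ext; simp [add_mul, Finset.sum_add_distrib]

/-- The group of cellular 1-cycles. -/
def cycles₁ : AddSubgroup (V → V → ℤ) := K.chains₁ ⊓ boundary₁.ker

/-- The first homology group with integer coefficients. -/
abbrev H₁ : Type := K.cycles₁ ⧸ K.boundary₂.range.addSubgroupOf K.cycles₁

end Homology

/-! ### Piecewise linear maps to Euclidean 3-space -/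

section Map

variable [Fintype V] [Fintype F]

/-- The piecewise linear map that sends each vertex `v` to `p v` and the additional vertex inside
each face `f` to `c f`, and is affine on each triangle of the refined complex. -/
noncomputable def plMap (p : V → E3) (c : F → E3) (x : V ⊕ F → ℝ) : E3 :=
  ∑ v, x (Sum.inl v) • p v + ∑ f, x (Sum.inr f) • c f

/-- The interior angle of the (planar, embedded) face `f` at its `i`-th vertex: the sum of the
angles of the two triangles of the refined face that meet there. It may exceed `π`. -/
noncomputable def faceAngle (p : V → E3) (c : F → E3) (f : F) (i : Fin (K.size f)) : ℝ :=
  EuclideanGeometry.angle (p (K.prev f i)) (p (K.vert f i)) (c f) +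
    EuclideanGeometry.angle (c f) (p (K.vert f i)) (p (K.next f i))

/-- The sum of the face angles at the vertex `v`. -/
noncomputable def angleSum [DecidableEq V] (p : V → E3) (c : F → E3) (v : V) : ℝ :=
  ∑ f, ∑ i : Fin (K.size f), if K.vert f i = v then K.faceAngle p c f i else 0

/-- Every face is mapped injectively into a plane, so that its image is a planar polygon. -/
def HasPlanarFaces [DecidableEq V] [DecidableEq F] (p : V → E3) (c : F → E3) : Prop :=
  ∀ f, Coplanar ℝ (plMap p c '' K.cell f) ∧ InjOn (plMap p c) (K.cell f)

/-- The vertex figure at `v`: the spherical polygon formed by the directions in which the faces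
leave `p v`, parametrized by the link of `v`. -/
noncomputable def vertexFigure (p : V → E3) (c : F → E3) (v : V) (x : V ⊕ F → ℝ) : E3 :=
  (‖plMap p c x - p v‖)⁻¹ • (plMap p c x - p v)

/-- The vertex figure at `v` is embedded in the unit sphere. -/
def HasEmbeddedVertexFigure [DecidableEq V] [DecidableEq F] (p : V → E3) (c : F → E3) (v : V) :
    Prop :=
  (∀ x ∈ K.link v, plMap p c x ≠ p v) ∧ InjOn (vertexFigure p c v) (K.link v)

end Map

end PolyhedralComplex

/-! ### The Klein bottle -/

/-- The side identifications of the unit square that give the Klein bottle. -/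
inductive KleinRel : I × I → I × I → Prop
  | side (t : I) : KleinRel (0, t) (1, t)
  | flip (t : I) : KleinRel (t, 0) (unitInterval.symm t, 1)

/-- The Klein bottle, as a quotient of the unit square. -/
def KleinBottle : Type := Quot KleinRel

instance : TopologicalSpace KleinBottle := inferInstanceAs (TopologicalSpace (Quot KleinRel))

/-! ### Flat surfaces and local isometric embeddings -/

/-- The intrinsic distance of two points in a subset `S` of a metric space: the infimum of the
lengths of the curves in `S` that join them. -/
noncomputable def intrinsicEDist {X : Type} [MetricSpace X] (S : Set X) (x y : X) : ℝ≥0∞ :=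
  ⨅ (γ : Path x y) (_ : range γ ⊆ S), eVariationOn γ univ

/-- The distance of `M` is a length metric, and `M` is locally isometric to the Euclidean plane. -/
structure IsFlatSurface (M : Type) [MetricSpace M] : Prop where
  length_metric : ∀ x y : M, edist x y = intrinsicEDist univ x y
  locally_euclidean : ∀ x : M, ∃ r : ℝ, 0 < r ∧
    Nonempty (Metric.ball x r ≃ᵢ Metric.ball (0 : EuclideanSpace ℝ (Fin 2)) r)

/-- Every point has a neighbourhood that is topologically embedded by `g`, isometrically for the
intrinsic metric of its image. -/
def IsLocalIsometricEmbedding {M : Type} [MetricSpace M] (g : M → E3) : Prop :=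
  ∀ x, ∃ U ∈ 𝓝 x, IsEmbedding (U.domRestrict g) ∧
    ∀ a ∈ U, ∀ b ∈ U, edist a b = intrinsicEDist (g '' U) (g a) (g b)

/-! The proof develops an explicit complex onto a flat Klein bottle. The flat Klein bottle is the
quotient of the plane by the group generated by the translation by `L` and the glide reflection `z ↦
-conj z + B i`. A nontrivial group element moves every point by at least `min L B`, so the
projection is isometric on small discs.

Explicit integers give every vertex of the refined complex (210 vertices and 300 face centres) a
position in space and one in the plane; group elements attached to its neighbours lift its star to
the plane. `IsDevelopment` collects what has to be known: the edges at a vertex turn once around it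
in the plane; the charts of the vertices of a triangle differ by a group element; edges have the
same length in the plane and in space; the star in space is an embedded cone. All this follows from
finitely many integer equations and inequalities, evaluated by the kernel. Embedded cones are
certified by separating planes (`isEmbeddedCone_of_separation`).

The rest is general. The charts fit together to a developing map to the flat Klein bottle, which is
locally injective and open. As its source is compact and its target connected, it is a homeomorphism
as soon as one fibre is a single point (`injective_of_local`), which is checked at the centre of the
first face. Since three sides determine a triangle, the map to space preserves the distance from
each point to all nearby points. By `isLocalIsometricEmbedding_of_radial` this and local injectivity
suffice: a comparison of curve lengths by continuous induction yields the intrinsic metric. The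
angle sums are those of the plane fans. Finally, half the boundary of the sum of all faces is a
1-cycle of order two in homology; a cochain that is even on each face, with total value not
divisible by four, shows that it does not bound (`exists_torsion`). -/

namespace FlatKlein

/-! ### The flat Klein bottle as a quotient of the plane -/

/-- The element of the glide reflection group that is the `n`-th power of the glide reflection
`z ↦ -conj z + B i`, followed by the translation by `m L`. -/
noncomputable def glide (L B : ℝ) (m n : ℤ) (z : ℂ) : ℂ :=
  (if Even n then z else -(starRingEnd ℂ z)) + ⟨m * L, n * B⟩

section Glide

variable {L B : ℝ}

lemma glide_zero (z : ℂ) : glide L B 0 0 z = z := by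
  simp [glide, Complex.ext_iff]

lemma glide_re (m n : ℤ) (z : ℂ) :
    (glide L B m n z).re = (if Even n then z.re else -z.re) + m * L := by
  unfold glide; split_ifs <;> simp

lemma glide_im (m n : ℤ) (z : ℂ) : (glide L B m n z).im = z.im + n * B := by
  unfold glide; split_ifs <;> simp

lemma glide_glide (m n m' n' : ℤ) (z : ℂ) :
    glide L B m n (glide L B m' n' z) =
      glide L B (m + if Even n then m' else -m') (n + n') z := by
  apply Complex.ext
  · simp only [glide_re, Int.even_add]
    by_cases h : Even n <;> by_cases h' : Even n' <;> simp [h, h'] <;> ring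
  · simp only [glide_im]; push_cast; ring

lemma norm_glide_sub_glide (m n : ℤ) (z w : ℂ) :
    ‖glide L B m n z - glide L B m n w‖ = ‖z - w‖ := by
  unfold glide
  split_ifs
  · simp
  · rw [add_sub_add_right_eq_sub, ← neg_sub', norm_neg, ← map_sub, Complex.norm_conj]

/-- The inverse has translational part `-m` for even `n` but `m` for odd `n`, because the reflection
reverses horizontal translations. -/
lemma exists_glide_eq (m n : ℤ) (z w : ℂ) : ∃ m' n' : ℤ,
    (∀ z, glide L B m' n' (glide L B m n z) = z) ∧
      ‖glide L B m n z - w‖ = ‖z - glide L B m' n' w‖ := by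
  have key : ∀ z, glide L B (if Even n then -m else m) (-n) (glide L B m n z) = z := by
    intro z
    rw [glide_glide]
    by_cases h : Even n <;> simp [h, glide_zero]
  refine ⟨_, _, key, ?_⟩
  rw [← norm_glide_sub_glide (L := L) (B := B) (if Even n then -m else m) (-n), key]

/-- A glide is affine. -/
lemma glide_affine (m n : ℤ) {ι : Type*} (s : Finset ι) (a : ι → ℝ) (z : ι → ℂ)
    (h : ∑ i ∈ s, a i = 1) :
    glide L B m n (∑ i ∈ s, a i • z i) = ∑ i ∈ s, a i • glide L B m n (z i) := by
  apply Complex.ext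
  · simp only [glide_re, Complex.re_sum, Complex.smul_re, smul_eq_mul, mul_add, Finset.sum_add_distrib,
      ← Finset.sum_mul, h, one_mul]
    split_ifs <;> simp
  · simp only [glide_im, Complex.im_sum, Complex.smul_im, smul_eq_mul, mul_add, Finset.sum_add_distrib,
      ← Finset.sum_mul, h, one_mul]

variable (L B) in
/-- Points of the plane are equivalent if they lie in the same orbit of the glide reflection group. -/
def glideSetoid : Setoid ℂ where
  r z w := ∃ m n : ℤ, z = glide L B m n w
  iseqv :=
    { refl := fun z => ⟨0, 0, (glide_zero z).symm⟩
      symm := by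
        rintro z w ⟨m, n, rfl⟩
        obtain ⟨m', n', h, -⟩ := exists_glide_eq (L := L) (B := B) m n 0 0
        exact ⟨m', n', (h w).symm⟩
      trans := by
        rintro x y z ⟨m, n, rfl⟩ ⟨m', n', rfl⟩
        exact ⟨_, _, glide_glide m n m' n' z⟩ }

variable (L B) in
/-- The flat Klein bottle. -/
def FlatBottle : Type := Quotient (glideSetoid L B)

variable (L B) in
/-- The projection of the plane to the flat Klein bottle. -/
def proj (z : ℂ) : FlatBottle L B := Quotient.mk (glideSetoid L B) z

lemma proj_surjective : Function.Surjective (proj L B) := Quotient.mk_surjective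

lemma proj_eq_proj {z w : ℂ} : proj L B z = proj L B w ↔ ∃ m n : ℤ, z = glide L B m n w :=
  ⟨fun h => Quotient.exact h, fun h => Quotient.sound h⟩

lemma proj_glide (m n : ℤ) (z : ℂ) : proj L B (glide L B m n z) = proj L B z :=
  proj_eq_proj.2 ⟨m, n, rfl⟩

/-- The distance of the orbits of two points. -/
noncomputable def orbitDist (L B : ℝ) (z w : ℂ) : ℝ := ⨅ g : ℤ × ℤ, ‖z - glide L B g.1 g.2 w‖

lemma bddBelow_orbit (z w : ℂ) : BddBelow (range fun g : ℤ × ℤ => ‖z - glide L B g.1 g.2 w‖) :=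
  ⟨0, by rintro _ ⟨g, rfl⟩; exact norm_nonneg _⟩

lemma orbitDist_le (z w : ℂ) (m n : ℤ) : orbitDist L B z w ≤ ‖z - glide L B m n w‖ :=
  ciInf_le (bddBelow_orbit z w) (m, n)

lemma orbitDist_comm (z w : ℂ) : orbitDist L B z w = orbitDist L B w z := by
  have key : ∀ z w, orbitDist L B z w ≤ orbitDist L B w z := by
    intro z w
    refine le_ciInf fun g => ?_
    obtain ⟨m, n, -, h⟩ := exists_glide_eq (L := L) (B := B) g.1 g.2 z w
    rw [norm_sub_rev, h]
    exact orbitDist_le _ _ _ _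
  exact le_antisymm (key z w) (key w z)

lemma orbitDist_glide_right (m n : ℤ) (z w : ℂ) :
    orbitDist L B z (glide L B m n w) = orbitDist L B z w := by
  have key : ∀ m n w, orbitDist L B z w ≤ orbitDist L B z (glide L B m n w) := by
    intro m n w
    refine le_ciInf fun g => ?_
    rw [glide_glide]
    exact orbitDist_le _ _ _ _
  refine le_antisymm ?_ (key m n w)
  obtain ⟨m', n', h, -⟩ := exists_glide_eq (L := L) (B := B) m n 0 0
  have := key m' n' (glide L B m n w)
  rwa [h] at this

/-- If `g y` is close to `x` and `k z` is close to `y`, then `g k z` is close to `x`, because `g` is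
an isometry. -/
lemma orbitDist_triangle (x y z : ℂ) :
    orbitDist L B x z ≤ orbitDist L B x y + orbitDist L B y z := by
  have : ∀ g : ℤ × ℤ, orbitDist L B x z - ‖x - glide L B g.1 g.2 y‖ ≤ orbitDist L B y z := by
    intro g
    refine le_ciInf fun k => ?_
    have h1 := orbitDist_le (L := L) (B := B) x z (g.1 + if Even g.2 then k.1 else -k.1) (g.2 + k.2)
    rw [← glide_glide] at h1
    have h2 := norm_sub_le_norm_sub_add_norm_sub x (glide L B g.1 g.2 y)
      (glide L B g.1 g.2 (glide L B k.1 k.2 z))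
    rw [norm_glide_sub_glide] at h2
    linarith
  have h : orbitDist L B x z - orbitDist L B y z ≤ orbitDist L B x y :=
    le_ciInf fun g => by linarith [this g]
  linarith

lemma exists_of_orbitDist_lt {z w : ℂ} {r : ℝ} (h : orbitDist L B z w < r) :
    ∃ m n : ℤ, ‖z - glide L B m n w‖ < r := by
  obtain ⟨g, hg⟩ := exists_lt_of_ciInf_lt h
  exact ⟨g.1, g.2, hg⟩

/-- The injectivity bound: a nontrivial group element moves every point by at least this much. -/
noncomputable def systole (L B : ℝ) : ℝ := min L B

variable [hL : Fact (0 < L)] [hB : Fact (0 < B)]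

lemma systole_pos : 0 < systole L B := lt_min hL.out hB.out

/-- The imaginary part changes by exactly `n B`, whether or not there is a reflection; once `n = 0`,
the element is the translation by `m L`. -/
lemma eq_zero_of_norm_sub_glide_lt {m n : ℤ} {z : ℂ} (h : ‖z - glide L B m n z‖ < systole L B) :
    m = 0 ∧ n = 0 := by
  have hn : n = 0 := by
    by_contra hn
    have h1 : (1 : ℝ) ≤ |(n : ℝ)| := by exact_mod_cast Int.one_le_abs hn
    have h2 := Complex.abs_im_le_norm (z - glide L B m n z)
    rw [Complex.sub_im, glide_im, sub_add_cancel_left, abs_neg, abs_mul, abs_of_pos hB.out] at h2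
    have h3 : B ≤ |(n : ℝ)| * B := le_mul_of_one_le_left hB.out.le h1
    linarith [min_le_right L B, show systole L B = min L B from rfl]
  subst hn
  refine ⟨?_, rfl⟩
  by_contra hm
  have h1 : (1 : ℝ) ≤ |(m : ℝ)| := by exact_mod_cast Int.one_le_abs hm
  have h2 := Complex.abs_re_le_norm (z - glide L B m 0 z)
  rw [Complex.sub_re, glide_re, if_pos (by simp), sub_add_cancel_left, abs_neg, abs_mul,
    abs_of_pos hL.out] at h2
  have h3 : L ≤ |(m : ℝ)| * L := le_mul_of_one_le_left hL.out.le h1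
  linarith [min_le_left L B, show systole L B = min L B from rfl]

/-- If another point of the orbit of `w` were closer to `z` than `w`, it would be less than a
systole away from `w`. -/
lemma orbitDist_eq_norm {z w : ℂ} (h : ‖z - w‖ ≤ systole L B / 2) :
    orbitDist L B z w = ‖z - w‖ := by
  refine le_antisymm ?_ (le_ciInf fun g => ?_)
  · simpa [glide_zero] using orbitDist_le (L := L) (B := B) z w 0 0
  · by_contra! hlt
    have h1 : ‖w - glide L B g.1 g.2 w‖ < systole L B := by
      have := norm_sub_le_norm_sub_add_norm_sub w z (glide L B g.1 g.2 w)
      rw [norm_sub_rev w z] at this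
      linarith
    obtain ⟨hm, hn⟩ := eq_zero_of_norm_sub_glide_lt h1
    rw [hm, hn, glide_zero] at hlt
    exact lt_irrefl _ hlt

noncomputable instance : MetricSpace (FlatBottle L B) where
  dist := Quotient.lift₂ (orbitDist L B) (by
    rintro z w _ _ ⟨m, n, rfl⟩ ⟨m', n', rfl⟩
    rw [orbitDist_glide_right, orbitDist_comm, orbitDist_glide_right, orbitDist_comm])
  dist_self x := by
    induction x using Quotient.inductionOn with | h z =>
    change orbitDist L B z z = 0
    rw [orbitDist_eq_norm (by simpa using (half_pos systole_pos).le), sub_self, norm_zero]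
  dist_comm x y := by
    induction x using Quotient.inductionOn with | h z =>
    induction y using Quotient.inductionOn with | h w =>
    exact orbitDist_comm z w
  dist_triangle x y z := by
    induction x using Quotient.inductionOn with | h x =>
    induction y using Quotient.inductionOn with | h y =>
    induction z using Quotient.inductionOn with | h z =>
    exact orbitDist_triangle x y z
  eq_of_dist_eq_zero {x y} h := by
    induction x using Quotient.inductionOn with | h z =>
    induction y using Quotient.inductionOn with | h w =>
    change orbitDist L B z w = 0 at h
    obtain ⟨m, n, hg⟩ := exists_of_orbitDist_lt (h.trans_lt (half_pos (systole_pos (L := L) (B := B))))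
    rw [← orbitDist_glide_right m n, orbitDist_eq_norm hg.le, norm_eq_zero, sub_eq_zero] at h
    exact Quotient.sound ⟨m, n, h⟩

lemma dist_proj (z w : ℂ) : dist (proj L B z) (proj L B w) = orbitDist L B z w := rfl

lemma dist_proj_le (z w : ℂ) : dist (proj L B z) (proj L B w) ≤ ‖z - w‖ := by
  simpa [glide_zero, dist_proj] using orbitDist_le (L := L) (B := B) z w 0 0

lemma dist_proj_of_le {z w : ℂ} (h : ‖z - w‖ ≤ systole L B / 2) :
    dist (proj L B z) (proj L B w) = ‖z - w‖ := orbitDist_eq_norm h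

lemma lipschitzWith_proj : LipschitzWith 1 (proj L B) :=
  LipschitzWith.of_dist_le_mul fun z w => by simpa [dist_eq_norm] using dist_proj_le z w

lemma continuous_proj : Continuous (proj L B) := lipschitzWith_proj.continuous

lemma exists_proj_of_dist_lt {z : ℂ} {y : FlatBottle L B} {r : ℝ} (h : dist (proj L B z) y < r) :
    ∃ w, proj L B w = y ∧ ‖z - w‖ < r := by
  obtain ⟨w, rfl⟩ := proj_surjective y
  obtain ⟨m, n, hg⟩ := exists_of_orbitDist_lt h
  exact ⟨_, proj_glide m n w, hg⟩

lemma isOpenMap_proj : IsOpenMap (proj L B) := by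
  intro s hs
  rw [Metric.isOpen_iff]
  rintro _ ⟨z, hz, rfl⟩
  obtain ⟨r, hr, hrs⟩ := Metric.isOpen_iff.1 hs z hz
  refine ⟨r, hr, fun y hy => ?_⟩
  rw [Metric.mem_ball, dist_comm] at hy
  obtain ⟨w, rfl, hw⟩ := exists_proj_of_dist_lt hy
  exact ⟨w, hrs (by rwa [Metric.mem_ball, dist_comm, dist_eq_norm]), rfl⟩

instance : ConnectedSpace (FlatBottle L B) := by
  have := (isConnected_range (continuous_proj (L := L) (B := B)))
  rw [proj_surjective.range_eq] at this
  exact connectedSpace_iff_univ.2 this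

/-- The projection is isometric on small balls. -/
noncomputable def ballEquiv (z : ℂ) :
    Metric.ball z (systole L B / 4) ≃ᵢ Metric.ball (proj L B z) (systole L B / 4) := by
  -- Two points of the ball are less than half a systole apart, which is the range in which the
  -- projection preserves distances.
  have hd : ∀ a b : Metric.ball z (systole L B / 4),
      dist (proj L B a) (proj L B b) = dist a b := by
    intro a b
    have : ‖(a : ℂ) - b‖ ≤ systole L B / 2 := by
      have h1 := a.2; have h2 := b.2
      rw [Metric.mem_ball] at h1 h2
      rw [← dist_eq_norm]
      linarith [dist_triangle_right (a : ℂ) b z]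
    rw [dist_proj_of_le this, Subtype.dist_eq, dist_eq_norm]
  let f : Metric.ball z (systole L B / 4) → Metric.ball (proj L B z) (systole L B / 4) :=
    fun a => ⟨proj L B a, by
      have h1 := a.2
      rw [Metric.mem_ball, dist_eq_norm] at h1
      exact (dist_proj_le _ _).trans_lt h1⟩
  have hf : Isometry f := Isometry.of_dist_eq hd
  refine IsometryEquiv.mk (Equiv.ofBijective f ⟨hf.injective, ?_⟩) hf
  rintro ⟨y, hy⟩
  rw [Metric.mem_ball, dist_comm] at hy
  obtain ⟨w, rfl, hw⟩ := exists_proj_of_dist_lt hy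
  exact ⟨⟨w, by rwa [Metric.mem_ball, dist_comm, dist_eq_norm]⟩, rfl⟩

/-- The segment between two points of the plane, as a path on the flat Klein bottle. -/
noncomputable def segmentPath (z w : ℂ) : Path (proj L B z) (proj L B w) where
  toFun t := proj L B (AffineMap.lineMap z w (t : ℝ))
  continuous_toFun := continuous_proj.comp (by fun_prop)
  source' := by simp
  target' := by simp

lemma edist_segmentPath_le (z w : ℂ) (s t : I) :
    edist (segmentPath (L := L) (B := B) z w s) (segmentPath z w t) ≤
      edist z w * edist s t := by
  refine (lipschitzWith_proj.edist_le_mul _ _).trans ?_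
  rw [ENNReal.coe_one, one_mul, edist_dist, edist_dist, edist_dist, dist_lineMap_lineMap,
    mul_comm, ENNReal.ofReal_mul dist_nonneg]
  rfl

end Glide

end FlatKlein

namespace FlatKlein

/-! ### Lengths of curves -/

/-- If near each parameter a curve `f` moves away from its position by no more than a curve `c`, then
the end points of `f` are no farther from each other than the length of `c`. -/
lemma edist_le_eVariationOn_of_radial {X Y : Type*} [PseudoEMetricSpace X] [PseudoEMetricSpace Y]
    {f : I → X} {c : I → Y} (h : ∀ t, ∀ᶠ t' in 𝓝 t, edist (f t) (f t') ≤ edist (c t) (c t'))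
    {a b : I} (hab : a ≤ b) : edist (f a) (f b) ≤ eVariationOn c (Icc a b) := by
  -- Continuous induction: the hypothesis on the left of `sSup S` puts the supremum in `S`, and on
  -- the right it enlarges `S` unless the supremum is `b`.
  let S : Set I := {t | t ∈ Icc a b ∧ edist (f a) (f t) ≤ eVariationOn c (Icc a t)}
  have haS : a ∈ S := ⟨⟨le_rfl, hab⟩, by simp⟩
  have step : ∀ s t, a ≤ s → s ≤ t → edist (f a) (f s) ≤ eVariationOn c (Icc a s) →
      edist (f s) (f t) ≤ edist (c s) (c t) → edist (f a) (f t) ≤ eVariationOn c (Icc a t) := by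
    intro s t has hst h1 h2
    have h3 := eVariationOn.Icc_add_Icc c (s := univ) has hst (mem_univ s)
    simp only [univ_inter] at h3
    rw [← h3]
    refine (edist_triangle _ (f s) _).trans (add_le_add h1 (h2.trans ?_))
    exact eVariationOn.edist_le c (left_mem_Icc.2 hst) (right_mem_Icc.2 hst)
  have hs : sSup S ∈ S := by
    have hmem : sSup S ∈ Icc a b := ⟨le_sSup haS, sSup_le fun t ht => ht.1.2⟩
    refine ⟨hmem, ?_⟩
    rcases hmem.1.eq_or_lt with heq | hlt
    · rw [← heq]; simp
    · obtain ⟨l, hl, hl'⟩ := (mem_nhdsLE_iff_exists_Ioc_subset' hlt).1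
        (mem_nhdsWithin_of_mem_nhds (h (sSup S)))
      obtain ⟨t, htS, ht⟩ := lt_sSup_iff.1 (mem_Iio.1 hl)
      have h1 := hl' ⟨ht, le_sSup htS⟩
      simp only [mem_ofPred_eq] at h1
      rw [edist_comm, edist_comm (c _)] at h1
      exact step t _ htS.1.1 (le_sSup htS) htS.2 h1
  rcases hs.1.2.eq_or_lt with heq | hlt
  · rw [← heq]; exact hs.2
  · obtain ⟨u, hu, hu'⟩ := (mem_nhdsGE_iff_exists_Ico_subset' hlt).1
      (mem_nhdsWithin_of_mem_nhds (h (sSup S)))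
    obtain ⟨t, ht, ht'⟩ := exists_between (lt_min (mem_Ioi.1 hu) hlt)
    have h1 := hu' ⟨ht.le, ht'.trans_le (min_le_left _ _)⟩
    have h2 : t ∈ S := ⟨⟨hs.1.1.trans ht.le, (ht'.trans_le (min_le_right _ _)).le⟩,
      step _ _ hs.1.1 ht.le hs.2 h1⟩
    exact absurd (le_sSup h2) (not_le.2 ht)

/-- The length of a Lipschitz curve is at most its Lipschitz constant. -/
lemma eVariationOn_le_of_lipschitz {X : Type*} [PseudoEMetricSpace X] {f : I → X} {C : NNReal}
    (h : LipschitzWith C f) : eVariationOn f univ ≤ C := by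
  -- The curve factors through the inclusion of `I` in `ℝ`, a monotone function whose variation is
  -- at most one.
  have h1 : LipschitzOnWith (C * 1) (f ∘ projIcc (0 : ℝ) 1 zero_le_one) univ :=
    (h.comp (LipschitzWith.projIcc zero_le_one)).lipschitzOnWith
  have h2 := h1.comp_eVariationOn_le (f := f ∘ projIcc (0 : ℝ) 1 zero_le_one)
    (g := (Subtype.val : I → ℝ)) (s := univ) (mapsTo_univ _ _)
  have h3 : (f ∘ projIcc (0 : ℝ) 1 zero_le_one) ∘ (Subtype.val : I → ℝ) = f := by
    ext t; simp
  have h4 : eVariationOn (Subtype.val : I → ℝ) univ ≤ ENNReal.ofReal (((1 : I) : ℝ) - ((0 : I) : ℝ)) := by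
    have := ((Subtype.mono_coe (· ∈ Icc (0 : ℝ) 1)).monotoneOn univ).eVariationOn_eq
      (mem_univ (0 : I)) (mem_univ 1)
    refine le_trans (eVariationOn.mono _ ?_) this.le
    intro t _; exact ⟨mem_univ _, t.2.1, t.2.2⟩
  rw [h3] at h2
  refine h2.trans ?_
  calc _ ≤ ((C * 1 : NNReal) : ℝ≥0∞) * ENNReal.ofReal (((1 : I) : ℝ) - ((0 : I) : ℝ)) := by gcongr
    _ = C := by simp

section Glide

variable {L B : ℝ} [hL : Fact (0 < L)] [hB : Fact (0 < B)]

lemma lipschitzWith_segmentPath (z w : ℂ) :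
    LipschitzWith (nndist z w) (segmentPath (L := L) (B := B) z w) := fun s t => by
  rw [← edist_nndist]; exact edist_segmentPath_le z w s t

/-- Almost shortest curves are projections of segments between lifts whose distance is within `ε` of
the distance of the orbits. Small balls are Euclidean by `ballEquiv`. -/
theorem isFlatSurface_flatBottle : IsFlatSurface (FlatBottle L B) where
  length_metric x y := by
    refine le_antisymm (le_iInf₂ fun γ _ => ?_) ?_
    · simpa using eVariationOn.edist_le γ (mem_univ 0) (mem_univ 1)
    · obtain ⟨z, rfl⟩ := proj_surjective x
      have key : ∀ w, proj L B w = y → intrinsicEDist univ (proj L B z) y ≤ edist z w := by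
        rintro w rfl
        refine (iInf₂_le (segmentPath z w) (subset_univ _)).trans ?_
        rw [edist_nndist]; exact eVariationOn_le_of_lipschitz (lipschitzWith_segmentPath z w)
      refine ENNReal.le_of_forall_pos_le_add fun ε hε _ => ?_
      obtain ⟨w, hw, hzw⟩ := exists_proj_of_dist_lt
        (lt_add_of_pos_right (dist (proj L B z) y) (NNReal.coe_pos.2 hε))
      refine (key w hw).trans ?_
      rw [edist_dist, edist_dist, dist_eq_norm]
      calc _ ≤ ENNReal.ofReal (dist (proj L B z) y + ε) := ENNReal.ofReal_le_ofReal hzw.le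
        _ = _ := by rw [ENNReal.ofReal_add dist_nonneg ε.coe_nonneg, ENNReal.ofReal_coe_nnreal]
  locally_euclidean x := by
    obtain ⟨z, rfl⟩ := proj_surjective x
    have hpos : 0 < systole L B / 4 := by have := systole_pos (L := L) (B := B); linarith
    refine ⟨systole L B / 4, hpos, ?_⟩
    let e : ℂ ≃ᵢ EuclideanSpace ℝ (Fin 2) :=
      (IsometryEquiv.subRight z).trans Complex.orthonormalBasisOneI.repr.toIsometryEquiv
    have he : e z = 0 := by simp [e]
    have himg : e '' Metric.ball z (systole L B / 4) = Metric.ball 0 (systole L B / 4) := by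
      rw [e.image_ball, he]
    let f : Metric.ball z (systole L B / 4) ≃ᵢ
        Metric.ball (0 : EuclideanSpace ℝ (Fin 2)) (systole L B / 4) :=
      IsometryEquiv.mk ((e.toEquiv.image _).trans (Equiv.setCongr himg))
        (Isometry.of_dist_eq fun a b => e.dist_eq a b)
    exact ⟨(ballEquiv z).symm.trans f⟩

/-- A map from the flat Klein bottle to space that preserves the distances from each point locally,
and is locally injective, is a local isometric embedding. -/
theorem isLocalIsometricEmbedding_of_radial [CompactSpace (FlatBottle L B)]
    {g : FlatBottle L B → E3} (hrad : ∀ x, ∀ᶠ y in 𝓝 x, edist (g x) (g y) = edist x y)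
    (hinj : ∀ x, ∃ U ∈ 𝓝 x, InjOn g U) : IsLocalIsometricEmbedding g := by
  have hcont : Continuous g := by
    rw [continuous_iff_continuousAt]
    intro x
    rw [ContinuousAt, tendsto_iff_edist_tendsto_0]
    have h0 : Filter.Tendsto (fun y => edist x y) (𝓝 x) (𝓝 0) := by
      simpa using (continuous_const.edist continuous_id).tendsto x (f := fun y => edist x y)
    refine h0.congr' ?_
    filter_upwards [hrad x] with y hy
    rw [edist_comm (g y), hy]
  intro x
  obtain ⟨V, hV, hVinj⟩ := hinj x
  obtain ⟨z₀, rfl⟩ := proj_surjective x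
  obtain ⟨ε, hε, hεV⟩ := Metric.nhds_basis_closedBall.mem_iff.1 hV
  have hσ := systole_pos (L := L) (B := B)
  -- The ball lifts to a convex disc, and lifts of two of its points are at most `systole / 4`
  -- apart, so that the projection preserves their distance.
  set r := min ε (systole L B / 8) with hr
  have hrpos : 0 < r := lt_min hε (by linarith)
  have hr8 : r ≤ systole L B / 8 := min_le_right _ _
  have hUinj : InjOn g (Metric.closedBall (proj L B z₀) r) :=
    hVinj.mono ((Metric.closedBall_subset_closedBall (min_le_left _ _)).trans hεV)
  have hemb : IsEmbedding ((Metric.closedBall (proj L B z₀) r).domRestrict g) := by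
    have : CompactSpace (Metric.closedBall (proj L B z₀) r) :=
      isCompact_iff_compactSpace.1 (isCompact_closedBall _ _)
    exact ((hcont.comp continuous_subtype_val).isClosedEmbedding
      (injOn_iff_injective.1 hUinj)).isEmbedding
  refine ⟨_, Metric.closedBall_mem_nhds _ hrpos, hemb, fun a ha b hb => le_antisymm ?_ ?_⟩
  -- A curve in the image lifts through the embedding. By `hrad` the lift leaves each of its points
  -- at the same rate as the curve, so its end points are no farther apart than the length of the
  -- curve.
  · refine le_iInf₂ fun γ hγ => ?_
    have hγ' : ∀ t, γ t ∈ range ((Metric.closedBall (proj L B z₀) r).domRestrict g) := by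
      intro t
      obtain ⟨y, hy, hyt⟩ := hγ ⟨t, rfl⟩
      exact ⟨⟨y, hy⟩, hyt⟩
    let e := hemb.toHomeomorph
    let c : I → FlatBottle L B := fun t => (e.symm ⟨γ t, hγ' t⟩ : Metric.closedBall (proj L B z₀) r)
    have hc : Continuous c := continuous_subtype_val.comp (e.symm.continuous.comp
      (Continuous.subtype_mk γ.continuous _))
    have hgc : ∀ t, g (c t) = γ t := fun t =>
      congrArg Subtype.val (e.apply_symm_apply ⟨γ t, hγ' t⟩)
    have hcm : ∀ t, c t ∈ Metric.closedBall (proj L B z₀) r := fun t => Subtype.coe_prop _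
    have h0 : c 0 = a := hUinj (hcm 0) ha (by rw [hgc, γ.source])
    have h1 : c 1 = b := hUinj (hcm 1) hb (by rw [hgc, γ.target])
    have := edist_le_eVariationOn_of_radial (f := c) (c := γ) (fun t => by
      filter_upwards [hc.continuousAt.eventually (hrad (c t))] with t' ht'
      rw [← hgc, ← hgc, ht']) (zero_le_one : (0 : I) ≤ 1)
    rw [h0, h1] at this
    exact this.trans (eVariationOn.mono _ (subset_univ _))
  -- Conversely, the straight segment between lifts stays in the disc, and its image in space is no
  -- longer than the segment.
  · have lift : ∀ y ∈ Metric.closedBall (proj L B z₀) r, ∃ z, proj L B z = y ∧ dist z z₀ ≤ r := by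
      intro y hy
      rw [Metric.mem_closedBall, dist_comm] at hy
      -- Lifting needs a strict inequality, hence a radius larger than `r`; the bound by `r` is
      -- recovered because distances are preserved at this scale.
      obtain ⟨z, rfl, hz⟩ := exists_proj_of_dist_lt (z := z₀) (y := y) (r := systole L B / 4)
        (by linarith)
      refine ⟨z, rfl, ?_⟩
      rwa [dist_comm, dist_eq_norm, ← dist_proj_of_le (L := L) (B := B) (by linarith)]
    obtain ⟨z, rfl, hz⟩ := lift a ha
    obtain ⟨w, rfl, hw⟩ := lift b hb
    have hzw : edist (proj L B z) (proj L B w) = edist z w := by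
      rw [edist_dist, edist_dist, dist_eq_norm, dist_proj_of_le]
      rw [← dist_eq_norm]
      linarith [dist_triangle_right z w z₀]
    rw [hzw]
    let p := segmentPath (L := L) (B := B) z w
    have hp : ∀ t, p t ∈ Metric.closedBall (proj L B z₀) r := by
      intro t
      have h1 : AffineMap.lineMap z w (t : ℝ) ∈ Metric.closedBall z₀ r :=
        (convex_closedBall z₀ r).lineMap_mem hz hw t.2
      rw [Metric.mem_closedBall, dist_eq_norm] at h1
      exact (dist_proj_le _ _).trans h1
    refine (iInf₂_le (p.map hcont) ?_).trans ?_
    · rintro _ ⟨t, rfl⟩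
      exact ⟨p t, hp t, rfl⟩
    · have hlip : LipschitzWith (nndist z w) (p.map hcont) := by
        intro s t
        wlog hst : s ≤ t generalizing s t
        · rw [edist_comm, edist_comm s]; exact this t s (le_of_not_ge hst)
        -- The comparison curve runs along the real line with constant speed equal to the distance
        -- of `z` and `w`.
        have h1 := edist_le_eVariationOn_of_radial (f := p.map hcont)
          (c := fun t : I => (nndist z w : ℝ) * t) (fun t => by
            filter_upwards [p.continuous.continuousAt.eventually (hrad (p t))] with t' ht'
            change edist (g (p t)) (g (p t')) ≤ _
            rw [ht']
            refine (lipschitzWith_segmentPath z w t t').trans_eq ?_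
            rw [edist_dist, edist_dist, Subtype.dist_eq, Real.dist_eq, Real.dist_eq, ← mul_sub,
              abs_mul, ENNReal.ofReal_mul (abs_nonneg _), NNReal.abs_eq,
              ENNReal.ofReal_coe_nnreal]) hst
        refine h1.trans ?_
        have hm : MonotoneOn (fun t : I => (nndist z w : ℝ) * t) univ := fun a _ b _ hab =>
          mul_le_mul_of_nonneg_left hab (NNReal.coe_nonneg _)
        have h2 := hm.eVariationOn_eq (mem_univ s) (mem_univ t)
        rw [univ_inter] at h2
        refine h2.le.trans_eq ?_
        rw [← mul_sub, ENNReal.ofReal_mul (NNReal.coe_nonneg _), ENNReal.ofReal_coe_nnreal,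
          edist_comm, edist_dist, Subtype.dist_eq, Real.dist_eq, abs_of_nonneg]
        exact sub_nonneg.2 hst
      rw [edist_nndist]; exact eVariationOn_le_of_lipschitz hlip

end Glide

end FlatKlein

namespace FlatKlein

section Glide

variable {L B : ℝ} [hL : Fact (0 < L)] [hB : Fact (0 < B)]

/-! ### The flat Klein bottle is a Klein bottle -/

variable (L B) in
/-- The unit square, as a fundamental domain of the glide reflection group. -/
noncomputable def squarePoint (x : I × I) : ℂ := ⟨L * (x.1 - 1 / 2), B * x.2⟩

variable (L B) in
/-- The map from the Klein bottle to the flat Klein bottle. -/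
noncomputable def fromKleinBottle : KleinBottle → FlatBottle L B :=
  Quot.lift (fun x => proj L B (squarePoint L B x)) (by
    -- The fundamental domain is centred on the axis of the glide reflection, so that the reflection
    -- is `t ↦ 1 - t`. The two identifications are a translation and the inverse of the glide
    -- reflection.
    rintro _ _ (t | t)
    · refine proj_eq_proj.2 ⟨-1, 0, ?_⟩
      apply Complex.ext
      · rw [glide_re, if_pos (by decide)]; simp only [squarePoint]; push_cast; simp; ring
      · rw [glide_im]; simp [squarePoint]
    · refine proj_eq_proj.2 ⟨0, -1, ?_⟩
      apply Complex.ext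
      · rw [glide_re, if_neg (by decide)]; simp only [squarePoint]; push_cast; simp; ring
      · rw [glide_im]; simp [squarePoint])

lemma continuous_fromKleinBottle : Continuous (fromKleinBottle L B) := by
  refine continuous_quot_lift _ (continuous_proj.comp ?_)
  have : squarePoint L B = fun x : I × I =>
      ((L * ((x.1 : ℝ) - 1 / 2) : ℝ) : ℂ) + ((B * (x.2 : ℝ) : ℝ) : ℂ) * Complex.I := by
    ext x; exact Complex.mk_eq_add_mul_I _ _
  rw [this]
  fun_prop

lemma fromKleinBottle_surjective : Function.Surjective (fromKleinBottle L B) := by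
  have key : ∀ {x c : ℝ}, 0 < c → x - ⌊x / c⌋ * c ∈ Icc 0 c := by
    intro x c hc
    have h1 : (⌊x / c⌋ : ℝ) * c ≤ x := (le_div_iff₀ hc).1 (Int.floor_le (x / c))
    have h2 : x < (⌊x / c⌋ + 1) * c := (div_lt_iff₀ hc).1 (Int.lt_floor_add_one (x / c))
    exact ⟨by linarith, by linarith⟩
  intro y
  obtain ⟨z, rfl⟩ := proj_surjective y
  obtain ⟨w, hw, him⟩ : ∃ w, proj L B w = proj L B z ∧ w.im ∈ Icc 0 B := by
    refine ⟨glide L B 0 (-⌊z.im / B⌋) z, proj_glide _ _ _, ?_⟩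
    rw [glide_im]
    simpa [sub_eq_add_neg] using key (x := z.im) hB.out
  have hre : ∃ x, proj L B x = proj L B w ∧ x.im = w.im ∧ x.re + L / 2 ∈ Icc 0 L := by
    refine ⟨glide L B (-⌊(w.re + L / 2) / L⌋) 0 w, proj_glide _ _ _, by simp [glide_im], ?_⟩
    rw [glide_re, if_pos (by simp)]
    have := key (x := w.re + L / 2) hL.out
    convert this using 1
    push_cast; ring
  obtain ⟨x, hx, hxim, hxre⟩ := hre
  have hL0 := hL.out
  have hB0 := hB.out
  rw [← hxim] at him
  refine ⟨Quot.mk _ (⟨(x.re + L / 2) / L, ?_, ?_⟩, ⟨x.im / B, ?_, ?_⟩), ?_⟩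
  · exact div_nonneg hxre.1 hL0.le
  · exact (div_le_one hL0).2 hxre.2
  · exact div_nonneg him.1 hB0.le
  · exact (div_le_one hB0).2 him.2
  · change proj L B _ = _
    rw [← hw, ← hx]
    congr 1
    apply Complex.ext
    · simp only [squarePoint]; field_simp; ring
    · simp only [squarePoint]; field_simp

/-- The size of the square leaves only `-1`, `0` and `1` for `n` and `m`. Each of the nine cases is
an equality, a side identification, or a chain of these at the corners. -/
lemma fromKleinBottle_injective : Function.Injective (fromKleinBottle L B) := by
  have hL0 := hL.out
  have hB0 := hB.out
  have hside : ∀ t : I, (Quot.mk KleinRel (0, t)) = Quot.mk KleinRel (1, t) :=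
    fun t => Quot.sound (KleinRel.side t)
  have hflip : ∀ t : I, (Quot.mk KleinRel (t, 0)) = Quot.mk KleinRel (unitInterval.symm t, 1) :=
    fun t => Quot.sound (KleinRel.flip t)
  have bound : ∀ {k : ℤ} {x : ℝ}, (k : ℝ) = x → -1 ≤ x → x ≤ 1 → k = -1 ∨ k = 0 ∨ k = 1 := by
    intro k x h h1 h2
    rw [← h] at h1 h2
    have h1' : -1 ≤ k := by exact_mod_cast h1
    have h2' : k ≤ 1 := by exact_mod_cast h2
    omega
  intro a b
  refine Quot.induction_on₂ a b fun x y h => ?_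
  obtain ⟨m, n, hmn⟩ := proj_eq_proj.1 h
  clear h a b
  have him := congrArg Complex.im hmn
  rw [glide_im] at him
  simp only [squarePoint] at him
  have him' : (n : ℝ) = x.2 - y.2 := by
    have : (n : ℝ) * B = (x.2 - y.2) * B := by linarith
    exact mul_right_cancel₀ hB0.ne' this
  have hre := congrArg Complex.re hmn
  rw [glide_re] at hre
  simp only [squarePoint] at hre
  have hn := bound him' (by linarith [x.2.2.1, y.2.2.2]) (by linarith [x.2.2.2, y.2.2.1])
  clear him
  -- the case in which the second coordinates are opposite ends
  have opp : ∀ {x y : I × I} {m : ℤ}, (x.2 : ℝ) = 1 → (y.2 : ℝ) = 0 →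
      (m : ℝ) = x.1 + y.1 - 1 → Quot.mk KleinRel x = Quot.mk KleinRel y := by
    rintro ⟨s, t⟩ ⟨s', t'⟩ m ht ht' hm
    obtain rfl : t = 1 := Subtype.ext ht
    obtain rfl : t' = 0 := Subtype.ext ht'
    simp only at hm
    rcases bound hm (by linarith [s.2.1, s'.2.1]) (by linarith [s.2.2, s'.2.2]) with rfl | rfl | rfl
    -- The extreme values of `m` occur only at corners, and these are all identified with each
    -- other.
    · have h1 : s = 0 := Subtype.ext (by push_cast at hm ⊢; linarith [s.2.1, s'.2.1])
      have h2 : s' = 0 := Subtype.ext (by push_cast at hm ⊢; linarith [s.2.1, s'.2.1])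
      rw [h1, h2, hside 1, hside 0, hflip 1, unitInterval.symm_one, hside 1]
    · have h1 : s = unitInterval.symm s' := Subtype.ext (by
        rw [unitInterval.coe_symm_eq]; push_cast at hm; linarith)
      rw [h1, hflip]
    · have h1 : s = 1 := Subtype.ext (by push_cast at hm ⊢; linarith [s.2.2, s'.2.2])
      have h2 : s' = 1 := Subtype.ext (by push_cast at hm ⊢; linarith [s.2.2, s'.2.2])
      rw [h1, h2, ← hside 0, hflip 0, unitInterval.symm_zero]
  rcases hn with rfl | rfl | rfl
  · rw [if_neg (by decide)] at hre
    refine (opp (x := y) (y := x) (m := m) ?_ ?_ ?_).symm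
    · push_cast at him'; linarith [x.2.2.1, y.2.2.2]
    · push_cast at him'; linarith [x.2.2.1, y.2.2.2]
    · exact mul_right_cancel₀ hL0.ne' (by linarith)
  · rw [if_pos (by decide)] at hre
    obtain ⟨s, t⟩ := x
    obtain ⟨s', t'⟩ := y
    simp only at him' hre
    have ht : t = t' := Subtype.ext (by push_cast at him'; linarith)
    subst ht
    have hm : (m : ℝ) = s - s' := mul_right_cancel₀ hL0.ne' (by linarith)
    rcases bound hm (by linarith [s.2.1, s'.2.2]) (by linarith [s.2.2, s'.2.1]) with rfl | rfl | rfl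
    · have h1 : s = 0 := Subtype.ext (by push_cast at hm ⊢; linarith [s.2.1, s'.2.2])
      have h2 : s' = 1 := Subtype.ext (by push_cast at hm ⊢; linarith [s.2.1, s'.2.2])
      rw [h1, h2, hside]
    · have h1 : s = s' := Subtype.ext (by push_cast at hm; linarith)
      rw [h1]
    · have h1 : s = 1 := Subtype.ext (by push_cast at hm ⊢; linarith [s.2.2, s'.2.1])
      have h2 : s' = 0 := Subtype.ext (by push_cast at hm ⊢; linarith [s.2.2, s'.2.1])
      rw [h1, h2, hside]
  · rw [if_neg (by decide)] at hre
    refine opp (m := m) ?_ ?_ ?_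
    · push_cast at him'; linarith [x.2.2.2, y.2.2.1]
    · push_cast at him'; linarith [x.2.2.2, y.2.2.1]
    · exact mul_right_cancel₀ hL0.ne' (by linarith)

instance : CompactSpace KleinBottle := inferInstanceAs (CompactSpace (Quot KleinRel))

variable (L B) in
/-- The Klein bottle is homeomorphic to the flat Klein bottle. -/
noncomputable def kleinBottleHomeo : KleinBottle ≃ₜ FlatBottle L B :=
  Continuous.homeoOfEquivCompactToT2
    (f := Equiv.ofBijective _ ⟨fromKleinBottle_injective, fromKleinBottle_surjective⟩)
    continuous_fromKleinBottle

instance : CompactSpace (FlatBottle L B) := (kleinBottleHomeo L B).compactSpace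

end Glide

end FlatKlein

namespace FlatKlein

/-! ### Fans of directions in the plane -/

/-- The cross product of two vectors of the plane. -/
def cross (z w : ℂ) : ℝ := z.re * w.im - z.im * w.re

/-- A closed fan: the directions `d 0, …, d (k - 1)` are listed in counterclockwise order, beginning
with the first one after the negative real axis, and go around the origin once. -/
structure IsFan (d : ℕ → ℂ) (k : ℕ) : Prop where
  pos : 0 < k
  periodic : d k = d 0
  cross_pos : ∀ j < k, 0 < cross (d j) (d (j + 1))
  im_ne : ∀ j < k, (d j).im ≠ 0
  -- With `last` and `upper`, the directions pass only once from the lower to the upper half plane.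
  -- This makes the total turn `2 π` and not a larger multiple.
  first : (d 0).im < 0
  last : 0 < (d (k - 1)).im
  upper : ∀ j, j + 1 < k → 0 < (d j).im → 0 < (d (j + 1)).im

lemma cross_polar (r s α β : ℝ) :
    cross (r * Complex.exp (α * Complex.I)) (s * Complex.exp (β * Complex.I)) =
      r * s * Real.sin (β - α) := by
  simp only [cross, Complex.re_ofReal_mul, Complex.im_ofReal_mul, Complex.exp_ofReal_mul_I_re,
    Complex.exp_ofReal_mul_I_im, Real.sin_sub]
  ring

/-- A choice of arguments that increases along a fan. -/
structure IsAngleFunction (d : ℕ → ℂ) (k : ℕ) (θ : ℕ → ℝ) : Prop where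
  norm_pos : ∀ j ≤ k, 0 < ‖d j‖
  polar : ∀ j ≤ k, d j = ‖d j‖ * Complex.exp (θ j * Complex.I)
  lt : ∀ j < k, θ j < θ (j + 1)
  lt_add_pi : ∀ j < k, θ (j + 1) < θ j + Real.pi
  period : θ k = θ 0 + 2 * Real.pi

/-- Principal arguments serve for `j < k`, and the first one plus `2 π` closes the circle. The half
plane conditions put each gap in `(-π, 2 π)`, and there a positive sine means a gap in `(0, π)`. -/
lemma IsFan.exists_angleFunction {d : ℕ → ℂ} {k : ℕ} (h : IsFan d k) :
    ∃ θ, IsAngleFunction d k θ := by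
  have hne : ∀ j ≤ k, d j ≠ 0 := by
    intro j hj h0
    rcases hj.lt_or_eq with hj | rfl
    · exact h.im_ne j hj (by rw [h0]; rfl)
    · rw [h.periodic] at h0
      exact h.im_ne 0 h.pos (by rw [h0]; rfl)
  let θ : ℕ → ℝ := fun j => if j < k then (d j).arg else (d 0).arg + 2 * Real.pi
  have hθ : ∀ j < k, θ j = (d j).arg := fun j hj => if_pos hj
  have hθk : θ k = (d 0).arg + 2 * Real.pi := if_neg (lt_irrefl k)
  have hpolar : ∀ j ≤ k, d j = ‖d j‖ * Complex.exp (θ j * Complex.I) := by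
    intro j hj
    rcases hj.lt_or_eq with hj | rfl
    · rw [hθ j hj, Complex.norm_mul_exp_arg_mul_I]
    · rw [hθk, h.periodic]
      push_cast
      rw [add_mul, Complex.exp_add, Complex.exp_two_pi_mul_I, mul_one,
        Complex.norm_mul_exp_arg_mul_I]
  have hpos : ∀ j ≤ k, 0 < ‖d j‖ := fun j hj => norm_pos_iff.2 (hne j hj)
  have hsin : ∀ j < k, 0 < Real.sin (θ (j + 1) - θ j) := by
    intro j hj
    have h1 := h.cross_pos j hj
    rw [hpolar j hj.le, hpolar (j + 1) hj, cross_polar] at h1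
    exact pos_of_mul_pos_right h1 (mul_pos (hpos j hj.le) (hpos (j + 1) hj)).le
  -- an angle in `(-π, 2π)` with positive sine is in `(0, π)`
  have key : ∀ x : ℝ, -Real.pi < x → x < 2 * Real.pi → 0 < Real.sin x → 0 < x ∧ x < Real.pi := by
    intro x h1 h2 h3
    constructor
    · by_contra! h4
      exact absurd (Real.sin_nonpos_of_nonpos_of_neg_pi_le h4 h1.le) (not_le.2 h3)
    · by_contra! h4
      have := Real.sin_nonneg_of_nonneg_of_le_pi (x := x - Real.pi) (by linarith) (by linarith)
      rw [Real.sin_sub_pi] at this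
      linarith
  have hneg : ∀ z : ℂ, z.im < 0 → -Real.pi < z.arg ∧ z.arg < 0 := fun z hz =>
    ⟨Complex.neg_pi_lt_arg z, Complex.arg_neg_iff.2 hz⟩
  have hnn : ∀ z : ℂ, 0 < z.im → 0 ≤ z.arg ∧ z.arg < Real.pi := fun z hz =>
    ⟨Complex.arg_nonneg_iff.2 hz.le, Complex.arg_lt_pi_iff.2 (Or.inr hz.ne')⟩
  have hgap : ∀ j < k, 0 < θ (j + 1) - θ j ∧ θ (j + 1) - θ j < Real.pi := by
    intro j hj
    refine key _ ?_ ?_ (hsin j hj)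
    · rcases (Nat.succ_le_of_lt hj).lt_or_eq with hj' | hj'
      · rw [hθ _ hj', hθ _ hj]
        rcases (h.im_ne j hj).lt_or_gt with hj0 | hj0
        · linarith [(hneg _ hj0).2, Complex.neg_pi_lt_arg (d (j + 1))]
        · linarith [(hnn _ hj0).2, (hnn _ (h.upper j hj' hj0)).1]
      · have : j = k - 1 := by omega
        have h2 := hneg _ h.first
        have h3 := hnn _ h.last
        rw [← this] at h3
        have h4 : θ (j + 1) = (d 0).arg + 2 * Real.pi := by rw [← hθk]; congr 1
        rw [h4, hθ _ hj]
        linarith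
    · rcases (Nat.succ_le_of_lt hj).lt_or_eq with hj' | hj'
      · rw [hθ _ hj', hθ _ hj]
        linarith [Complex.arg_le_pi (d (j + 1)), Complex.neg_pi_lt_arg (d j)]
      · have : j = k - 1 := by omega
        have h2 := hneg _ h.first
        have h3 := hnn _ h.last
        rw [← this] at h3
        have h4 : θ (j + 1) = (d 0).arg + 2 * Real.pi := by rw [← hθk]; congr 1
        rw [h4, hθ _ hj]
        linarith
  exact ⟨θ, hpos, hpolar, fun j hj => by linarith [(hgap j hj).1],
    fun j hj => by linarith [(hgap j hj).2], by rw [hθk, hθ 0 h.pos]⟩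

namespace IsAngleFunction

variable {d : ℕ → ℂ} {k : ℕ} {θ : ℕ → ℝ}

lemma monotone (h : IsAngleFunction d k θ) {i j : ℕ} (hij : i ≤ j) (hj : j ≤ k) : θ i ≤ θ j := by
  induction j, hij using Nat.le_induction with
  | base => exact le_rfl
  | succ j _ ih => exact (ih (by omega)).trans (h.lt j (by omega)).le

lemma strictMono (h : IsAngleFunction d k θ) {i j : ℕ} (hij : i < j) (hj : j ≤ k) : θ i < θ j :=
  (h.lt i (by omega)).trans_le (h.monotone hij hj)

end IsAngleFunction

end FlatKlein

/-! ### Polar form of the sectors of a fan: they cover the plane and do not overlap. -/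

namespace FlatKlein

/-- Rotation by `-α` turns the combination into `w`, whose argument lies between `0` and `β - α` and
reaches an end only when one of the coefficients vanishes. -/
lemma exists_polar_of_sector {r s α β a b : ℝ} (hr : 0 < r) (hs : 0 < s) (h1 : α < β)
    (h2 : β < α + Real.pi) (ha : 0 ≤ a) (hb : 0 ≤ b) (hab : ¬(a = 0 ∧ b = 0)) :
    ∃ φ ρ : ℝ, α ≤ φ ∧ φ ≤ β ∧ 0 < ρ ∧ (φ = α → b = 0) ∧ (φ = β → a = 0) ∧
      a • (r * Complex.exp (α * Complex.I)) + b • (s * Complex.exp (β * Complex.I)) =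
        ρ * Complex.exp (φ * Complex.I) := by
  have hsin : 0 < Real.sin (β - α) := Real.sin_pos_of_pos_of_lt_pi (by linarith) (by linarith)
  set w : ℂ := ⟨a * r + b * s * Real.cos (β - α), b * s * Real.sin (β - α)⟩ with hw
  have hw0 : w ≠ 0 := by
    intro h0
    have him : b * s * Real.sin (β - α) = 0 := congrArg Complex.im h0
    have hb0 : b = 0 := by simpa [hs.ne', hsin.ne'] using him
    have hre : a * r + b * s * Real.cos (β - α) = 0 := congrArg Complex.re h0
    exact hab ⟨by simpa [hb0, hr.ne'] using hre, hb0⟩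
  -- The cross product with the second ray isolates `a`, as the imaginary part of `w` isolates `b`.
  have hcross : ‖w‖ * Real.sin (β - α - w.arg) = a * r * Real.sin (β - α) := by
    have h3 := cross_polar ‖w‖ 1 w.arg (β - α)
    rw [Complex.norm_mul_exp_arg_mul_I, mul_one] at h3
    rw [← h3]
    simp only [cross, Complex.re_ofReal_mul, Complex.im_ofReal_mul, Complex.exp_ofReal_mul_I_re,
      Complex.exp_ofReal_mul_I_im, hw]
    ring
  have hn : 0 < ‖w‖ := norm_pos_iff.2 hw0
  refine ⟨α + w.arg, ‖w‖, ?_, ?_, hn, ?_, ?_, ?_⟩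
  · have : 0 ≤ w.arg := Complex.arg_nonneg_iff.2 (by simp only [hw]; positivity)
    linarith
  · by_contra! hlt
    have h4 : Real.sin (β - α - w.arg) < 0 :=
      Real.sin_neg_of_neg_of_neg_pi_lt (by linarith) (by linarith [Complex.arg_le_pi w])
    have h5 : 0 ≤ a * r * Real.sin (β - α) := by positivity
    nlinarith
  · intro h0
    have h3 : w.arg = 0 := by linarith
    have h4 : b * s * Real.sin (β - α) = 0 := (Complex.arg_eq_zero_iff.1 h3).2
    simpa [hs.ne', hsin.ne'] using h4
  · intro h0
    have h3 : β - α - w.arg = 0 := by linarith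
    rw [h3, Real.sin_zero, mul_zero] at hcross
    simpa [hr.ne', hsin.ne'] using hcross.symm
  · push_cast
    rw [add_mul, Complex.exp_add, mul_left_comm, Complex.norm_mul_exp_arg_mul_I]
    have h5 : Complex.exp (β * Complex.I) =
        Complex.exp (α * Complex.I) * Complex.exp ((β - α : ℝ) * Complex.I) := by
      rw [← Complex.exp_add]; congr 1; push_cast; ring
    have h6 : w = a * r + b * s * Complex.exp ((β - α : ℝ) * Complex.I) := by
      apply Complex.ext
      · simp [hw, Complex.exp_ofReal_mul_I_re, -Complex.ofReal_sub, mul_assoc]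
      · simp [hw, Complex.exp_ofReal_mul_I_im, -Complex.ofReal_sub, mul_assoc]
    rw [h5, h6, Complex.real_smul, Complex.real_smul]
    ring

/-- Two numbers in an interval of length `2 π` that are arguments of the same direction. -/
lemma eq_or_eq_add_of_polar {ρ ρ' φ φ' : ℝ} (hρ : 0 < ρ) (hρ' : 0 < ρ') (hle : φ ≤ φ')
    (hle' : φ' ≤ φ + 2 * Real.pi)
    (h : ρ * Complex.exp (φ * Complex.I) = ρ' * Complex.exp (φ' * Complex.I)) :
    φ' = φ ∨ φ' = φ + 2 * Real.pi := by
  have h1 : ρ = ρ' := by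
    have := congrArg norm h
    simpa [Complex.norm_exp_ofReal_mul_I, abs_of_pos hρ, abs_of_pos hρ'] using this
  rw [h1, mul_right_inj' (by exact_mod_cast hρ'.ne')] at h
  obtain ⟨n, hn⟩ := Complex.exp_eq_exp_iff_exists_int.1 h.symm
  have h2 : φ' = φ + n * (2 * Real.pi) := by
    have := congrArg Complex.im hn
    simpa using this
  have hpi := Real.two_pi_pos
  have hn0 : 0 ≤ n := by
    by_contra! h3
    have : (n : ℝ) ≤ -1 := by exact_mod_cast Int.le_sub_one_of_lt h3
    nlinarith
  have hn1 : n ≤ 1 := by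
    by_contra! h3
    have : (2 : ℝ) ≤ n := by exact_mod_cast h3
    nlinarith
  interval_cases n
  · left; simpa using h2
  · right; simpa using h2

namespace IsAngleFunction

variable {d : ℕ → ℂ} {k : ℕ} {θ : ℕ → ℝ}

/-- The sectors of a fan cover the plane. -/
theorem exists_sector (h : IsAngleFunction d k θ) {z : ℂ} (hz : z ≠ 0) :
    ∃ j < k, ∃ a b : ℝ, 0 ≤ a ∧ 0 ≤ b ∧ z = a • d j + b • d (j + 1) := by
  set φ := toIcoMod Real.two_pi_pos (θ 0) z.arg with hφ
  have hmem := toIcoMod_mem_Ico Real.two_pi_pos (θ 0) z.arg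
  rw [← hφ, ← h.period] at hmem
  have hz' : z = ‖z‖ * Complex.exp (φ * Complex.I) := by
    conv_lhs => rw [← Complex.norm_mul_exp_arg_mul_I z]
    congr 1
    rw [Complex.exp_eq_exp_iff_exists_int]
    refine ⟨toIcoDiv Real.two_pi_pos (θ 0) z.arg, ?_⟩
    have : z.arg = φ + toIcoDiv Real.two_pi_pos (θ 0) z.arg • (2 * Real.pi) :=
      (toIcoMod_add_toIcoDiv_zsmul _ _ _).symm
    conv_lhs => rw [this]
    simp only [zsmul_eq_mul]
    push_cast
    ring
  obtain ⟨j, hj, h1, h2⟩ : ∃ j < k, θ j ≤ φ ∧ φ < θ (j + 1) := by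
    by_contra! hno
    have : ∀ j ≤ k, θ j ≤ φ := by
      intro j
      induction j with
      | zero => exact fun _ => hmem.1
      | succ j ih => exact fun hj => hno j hj (ih (by omega))
    exact absurd (this k le_rfl) (not_le.2 hmem.2)
  have hlt := h.lt j hj
  have hpi := h.lt_add_pi j hj
  have hsin : 0 < Real.sin (θ (j + 1) - θ j) :=
    Real.sin_pos_of_pos_of_lt_pi (by linarith) (by linarith)
  have hr := h.norm_pos j hj.le
  have hs := h.norm_pos (j + 1) hj
  have p1 := h.polar j hj.le
  have p2 := h.polar (j + 1) hj
  generalize ‖d j‖ = r at hr p1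
  generalize ‖d (j + 1)‖ = s at hs p2
  have ha : 0 ≤ Real.sin (θ (j + 1) - φ) :=
    Real.sin_nonneg_of_nonneg_of_le_pi (by linarith) (by linarith)
  have hb : 0 ≤ Real.sin (φ - θ j) :=
    Real.sin_nonneg_of_nonneg_of_le_pi (by linarith) (by linarith)
  -- The law of sines in the parallelogram with diagonal `z` and sides along the two rays.
  refine ⟨j, hj, ‖z‖ * Real.sin (θ (j + 1) - φ) / (r * Real.sin (θ (j + 1) - θ j)),
    ‖z‖ * Real.sin (φ - θ j) / (s * Real.sin (θ (j + 1) - θ j)), by positivity,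
    by positivity, ?_⟩
  conv_lhs => rw [hz']
  rw [p1, p2]
  have hr0 := hr.ne'
  have hs0 := hs.ne'
  have hsin0 := hsin.ne'
  set m := Real.sin (θ (j + 1) - θ j) with hm
  have e1 : ∀ t c : ℝ, ‖z‖ * t / (r * m) * (r * c) = ‖z‖ * (t * c) / m := by
    intro t c; field_simp
  have e2 : ∀ t c : ℝ, ‖z‖ * t / (s * m) * (s * c) = ‖z‖ * (t * c) / m := by
    intro t c; field_simp
  have e3 : ∀ c c', c * m = c' → ‖z‖ * c = ‖z‖ * c' / m := by
    rintro c _ rfl; field_simp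
  apply Complex.ext
  · simp only [Complex.add_re, Complex.smul_re, Complex.re_ofReal_mul, Complex.exp_ofReal_mul_I_re,
      smul_eq_mul, e1, e2]
    rw [← add_div, ← mul_add]
    apply e3
    rw [hm, Real.sin_sub, Real.sin_sub, Real.sin_sub]
    ring
  · simp only [Complex.add_im, Complex.smul_im, Complex.im_ofReal_mul, Complex.exp_ofReal_mul_I_im,
      smul_eq_mul, e1, e2]
    rw [← add_div, ← mul_add]
    apply e3
    rw [hm, Real.sin_sub, Real.sin_sub, Real.sin_sub]
    ring

lemma cross_pos (h : IsAngleFunction d k θ) {j : ℕ} (hj : j < k) : 0 < cross (d j) (d (j + 1)) := by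
  rw [h.polar j hj.le, h.polar (j + 1) hj, cross_polar]
  have hlt := h.lt j hj
  have hpi := h.lt_add_pi j hj
  have := h.norm_pos j hj.le
  have := h.norm_pos (j + 1) hj
  have : 0 < Real.sin (θ (j + 1) - θ j) :=
    Real.sin_pos_of_pos_of_lt_pi (by linarith) (by linarith)
  positivity

lemma ne_zero (h : IsAngleFunction d k θ) {j : ℕ} (hj : j ≤ k) : d j ≠ 0 :=
  norm_pos_iff.1 (h.norm_pos j hj)

end IsAngleFunction

/-- The coordinates of a vector with respect to two independent vectors. -/
lemma eq_of_cross_ne_zero {z w : ℂ} (h : cross z w ≠ 0) {a b a' b' : ℝ}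
    (he : a • z + b • w = a' • z + b' • w) : a = a' ∧ b = b' := by
  have hre := congrArg Complex.re he
  have him := congrArg Complex.im he
  simp only [Complex.add_re, Complex.add_im, Complex.smul_re, Complex.smul_im, smul_eq_mul] at hre him
  constructor
  · refine mul_right_cancel₀ h ?_
    simp only [cross]
    linear_combination w.im * hre - w.re * him
  · refine mul_right_cancel₀ h ?_
    simp only [cross]
    linear_combination z.re * him - z.im * hre

/-- The cone over a closed chain of directions is parametrized injectively: positions in the cone
determine the points of any other cone over the same combinatorial chain. -/
def IsEmbeddedCone {E : Type*} [AddCommGroup E] [Module ℝ E] (d : ℕ → E) (k : ℕ) : Prop :=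
  ∀ j < k, ∀ l < k, j ≤ l → ∀ a b a' b' : ℝ, 0 ≤ a → 0 ≤ b → 0 ≤ a' → 0 ≤ b' →
    a • d j + b • d (j + 1) = a' • d l + b' • d (l + 1) →
      -- The admitted coincidences: the same point of one sector, the common ray of consecutive
      -- sectors, the common ray of the first and the last sector, and the apex.
      (j = l ∧ a = a' ∧ b = b') ∨ (j + 1 = l ∧ a = 0 ∧ b = a' ∧ b' = 0) ∨
        (j = 0 ∧ l + 1 = k ∧ b = 0 ∧ a' = 0 ∧ a = b') ∨ (a = 0 ∧ b = 0 ∧ a' = 0 ∧ b' = 0)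

/-- The admitted coincidences concern only indices and coefficients, so they persist over any closed
chain of the same length. This makes piecewise linear maps on the cone well defined, and with `g`
taken in the realization it yields injectivity. -/
lemma IsEmbeddedCone.eq {E E' : Type*} [AddCommGroup E] [Module ℝ E] [AddCommGroup E'] [Module ℝ E']
    {d : ℕ → E} {k : ℕ} (h : IsEmbeddedCone d k) {g : ℕ → E'} (hg : g k = g 0) {j l : ℕ} (hj : j < k)
    (hl : l < k) {a b a' b' : ℝ} (ha : 0 ≤ a) (hb : 0 ≤ b) (ha' : 0 ≤ a') (hb' : 0 ≤ b')
    (he : a • d j + b • d (j + 1) = a' • d l + b' • d (l + 1)) :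
    a • g j + b • g (j + 1) = a' • g l + b' • g (l + 1) := by
  wlog hjl : j ≤ l generalizing j l a b a' b'
  · exact (this hl hj ha' hb' ha hb he.symm (le_of_not_ge hjl)).symm
  rcases h j hj l hl hjl a b a' b' ha hb ha' hb' he with
    ⟨rfl, rfl, rfl⟩ | ⟨rfl, rfl, rfl, rfl⟩ | ⟨rfl, h1, rfl, rfl, rfl⟩ | ⟨rfl, rfl, rfl, rfl⟩
  · rfl
  · simp
  · rw [h1, hg]; simp
  · simp

/-- The sectors of a fan do not overlap. -/
theorem IsAngleFunction.isEmbeddedCone {d : ℕ → ℂ} {k : ℕ} {θ : ℕ → ℝ}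
    (h : IsAngleFunction d k θ) (hd : d k = d 0) : IsEmbeddedCone d k := by
  intro j hj l hl hjl a b a' b' ha hb ha' hb' he
  rcases hjl.eq_or_lt with rfl | hjl
  · exact Or.inl ⟨rfl, eq_of_cross_ne_zero (h.cross_pos hj).ne' he⟩
  right
  by_cases hab : a = 0 ∧ b = 0
  · right; right
    rw [hab.1, hab.2, zero_smul, zero_smul, add_zero] at he
    obtain ⟨h1, h2⟩ := eq_of_cross_ne_zero (h.cross_pos hl).ne' (a := 0) (b := 0)
      (by simpa using he)
    exact ⟨hab.1, hab.2, h1.symm, h2.symm⟩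
  by_cases hab' : a' = 0 ∧ b' = 0
  · right; right
    rw [hab'.1, hab'.2, zero_smul, zero_smul, add_zero] at he
    obtain ⟨h1, h2⟩ := eq_of_cross_ne_zero (h.cross_pos hj).ne' (a' := 0) (b' := 0)
      (by simpa using he)
    exact ⟨h1, h2, hab'.1, hab'.2⟩
  obtain ⟨φ, ρ, p1, p2, p3, p4, p5, p6⟩ := exists_polar_of_sector (h.norm_pos j hj.le)
    (h.norm_pos (j + 1) hj) (h.lt j hj) (h.lt_add_pi j hj) ha hb hab
  obtain ⟨φ', ρ', q1, q2, q3, q4, q5, q6⟩ := exists_polar_of_sector (h.norm_pos l hl.le)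
    (h.norm_pos (l + 1) hl) (h.lt l hl) (h.lt_add_pi l hl) ha' hb' hab'
  rw [← h.polar j hj.le, ← h.polar (j + 1) hj] at p6
  rw [← h.polar l hl.le, ← h.polar (l + 1) hl] at q6
  have r1 : θ (j + 1) ≤ θ l := h.monotone hjl hl.le
  have r2 : θ 0 ≤ θ j := h.monotone (Nat.zero_le j) hj.le
  have r3 : θ (l + 1) ≤ θ k := h.monotone hl le_rfl
  have r4 := h.period
  -- All arguments lie in `[θ 0, θ k]`, an interval of length `2 π`: equal directions have equal
  -- arguments, or arguments at its two ends.
  rcases eq_or_eq_add_of_polar p3 q3 (by linarith) (by linarith) (p6.symm.trans (he.trans q6)) with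
    heq | heq
  · have e1 : j + 1 = l := by
      by_contra hne
      have := h.strictMono (show j + 1 < l by omega) hl.le
      linarith
    have ea := p5 (by linarith)
    have eb := q4 (by linarith)
    left
    refine ⟨e1, ea, ?_, eb⟩
    rw [ea, eb, ← e1, zero_smul, zero_smul, zero_add, add_zero] at he
    exact smul_left_injective ℝ (h.ne_zero hj) he
  · have e1 : j = 0 := by
      by_contra hne
      have := h.strictMono (show 0 < j by omega) hj.le
      linarith
    have e2 : l + 1 = k := by
      by_contra hne
      have := h.strictMono (show l + 1 < k by omega) le_rfl
      linarith
    have eb := p4 (by linarith)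
    have ea := q5 (by linarith)
    right; left
    refine ⟨e1, e2, eb, ea, ?_⟩
    rw [ea, eb, e1, e2, hd, zero_smul, zero_smul, zero_add, add_zero] at he
    exact smul_left_injective ℝ (h.ne_zero (Nat.zero_le k)) he

/-- The angles of the sectors of a fan add up to `2 π`. -/
theorem IsAngleFunction.sum_angle {d : ℕ → ℂ} {k : ℕ} {θ : ℕ → ℝ} (h : IsAngleFunction d k θ) :
    ∑ j ∈ Finset.range k, InnerProductGeometry.angle (d j) (d (j + 1)) = 2 * Real.pi := by
  have : ∀ j ∈ Finset.range k,
      InnerProductGeometry.angle (d j) (d (j + 1)) = θ (j + 1) - θ j := by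
    intro j hj
    rw [Finset.mem_range] at hj
    have hr := h.norm_pos j hj.le
    have hs := h.norm_pos (j + 1) hj
    have hlt := h.lt j hj
    have hpi := h.lt_add_pi j hj
    have hcos : inner ℝ (d j) (d (j + 1)) / (‖d j‖ * ‖d (j + 1)‖) =
        Real.cos (θ (j + 1) - θ j) := by
      rw [div_eq_iff (mul_pos hr hs).ne', Complex.inner]
      conv_lhs => rw [h.polar j hj.le, h.polar (j + 1) hj]
      simp only [map_mul, Complex.conj_ofReal, Complex.mul_re, Complex.mul_im, Complex.conj_re,
        Complex.conj_im, Complex.ofReal_re, Complex.ofReal_im, Complex.exp_ofReal_mul_I_re,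
        Complex.exp_ofReal_mul_I_im, Real.cos_sub]
      ring
    rw [InnerProductGeometry.angle, hcos, Real.arccos_cos (by linarith) (by linarith)]
  rw [Finset.sum_congr rfl this, Finset.sum_range_sub, h.period]
  ring

end FlatKlein

/-! ### Piecewise linear maps on fans, and the metric of triangles. -/

namespace FlatKlein

/-- A piecewise linear map from the plane with prescribed values on the rays of a fan. -/
theorem IsFan.exists_continuous {d : ℕ → ℂ} {k : ℕ} (h : IsFan d k) {E : Type*} [AddCommGroup E]
    [Module ℝ E] [TopologicalSpace E] [ContinuousAdd E] [ContinuousSMul ℝ E] (g : ℕ → E)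
    (hg : g k = g 0) : ∃ H : ℂ → E, Continuous H ∧ ∀ z, ∃ j < k, ∃ a b : ℝ, 0 ≤ a ∧ 0 ≤ b ∧
      z = a • d j + b • d (j + 1) ∧ H z = a • g j + b • g (j + 1) := by
  obtain ⟨θ, hθ⟩ := h.exists_angleFunction
  have hcone := hθ.isEmbeddedCone h.periodic
  have hex : ∀ z, ∃ j < k, ∃ a b : ℝ, 0 ≤ a ∧ 0 ≤ b ∧ z = a • d j + b • d (j + 1) := by
    intro z
    by_cases hz : z = 0
    · exact ⟨0, h.pos, 0, 0, le_rfl, le_rfl, by simp [hz]⟩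
    · exact hθ.exists_sector hz
  choose J hJ a b ha hb hz using hex
  refine ⟨fun z => a z • g (J z) + b z • g (J z + 1), ?_,
    fun z => ⟨J z, hJ z, a z, b z, ha z, hb z, hz z, rfl⟩⟩
  -- Cramer's rule gives coordinates that are continuous on the whole plane. On the closed sector
  -- `j` they compute the map, whichever sector was chosen for the point, so continuity follows from
  -- the finite closed cover by sectors.
  let α : ℕ → ℂ → ℝ := fun j z => cross z (d (j + 1)) / cross (d j) (d (j + 1))
  let β : ℕ → ℂ → ℝ := fun j z => cross (d j) z / cross (d j) (d (j + 1))
  have hα : ∀ j, Continuous (α j) := fun j => by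
    simp only [α, cross]; fun_prop
  have hβ : ∀ j, Continuous (β j) := fun j => by
    simp only [β, cross]; fun_prop
  have hαβ : ∀ j < k, ∀ z, z = α j z • d j + β j z • d (j + 1) := by
    intro j hj z
    have h0 := (h.cross_pos j hj).ne'
    apply Complex.ext
    · simp only [α, β, Complex.add_re, Complex.smul_re, smul_eq_mul]
      rw [div_mul_eq_mul_div, div_mul_eq_mul_div, ← add_div, eq_div_iff h0]
      simp only [cross]; ring
    · simp only [α, β, Complex.add_im, Complex.smul_im, smul_eq_mul]
      rw [div_mul_eq_mul_div, div_mul_eq_mul_div, ← add_div, eq_div_iff h0]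
      simp only [cross]; ring
  refine LocallyFinite.continuous (f := fun j : Fin k => {z | 0 ≤ α j z ∧ 0 ≤ β j z})
    (locallyFinite_of_finite _) ?_ ?_ ?_
  · refine eq_univ_of_forall fun z => mem_iUnion.2 ⟨⟨J z, hJ z⟩, ?_⟩
    obtain ⟨e1, e2⟩ := eq_of_cross_ne_zero (h.cross_pos _ (hJ z)).ne'
      ((hz z).symm.trans (hαβ _ (hJ z) z))
    exact ⟨(ha z).trans_eq e1, (hb z).trans_eq e2⟩
  · exact fun j => (isClosed_le continuous_const (hα j)).inter
      (isClosed_le continuous_const (hβ j))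
  · intro j
    refine ContinuousOn.congr (f := fun z => α j z • g j + β j z • g (j + 1)) ?_ ?_
    · have h1 := hα j
      have h2 := hβ j
      exact Continuous.continuousOn (by fun_prop)
    · rintro z ⟨h1, h2⟩
      exact hcone.eq hg (hJ z) j.2 (ha z) (hb z) h1 h2 ((hz z).symm.trans (hαβ j j.2 z))

/-- The points of a triangle, in affine coordinates at its first corner. -/
lemma mem_convexHull_triple {E : Type*} [AddCommGroup E] [Module ℝ E] {x y z p : E} :
    p ∈ convexHull ℝ {x, y, z} ↔ ∃ s t : ℝ, 0 ≤ s ∧ 0 ≤ t ∧ s + t ≤ 1 ∧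
      p = x + s • (y - x) + t • (z - x) := by
  rw [convexHull_insert (insert_nonempty _ _), convexHull_pair, mem_convexJoin]
  constructor
  · rintro ⟨a, ha, b, ⟨α, β, hα, hβ, hαβ, rfl⟩, ⟨γ, δ, hγ, hδ, hγδ, rfl⟩⟩
    rw [mem_singleton_iff] at ha
    subst ha
    refine ⟨δ * α, δ * β, by positivity, by positivity, by rw [← mul_add, hαβ]; linarith, ?_⟩
    obtain rfl : γ = 1 - δ := by linarith
    obtain rfl : α = 1 - β := by linarith
    module
  · rintro ⟨s, t, hs, ht, hst, rfl⟩
    rcases (add_nonneg hs ht).eq_or_lt with h0 | h0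
    · obtain rfl : s = 0 := by linarith
      obtain rfl : t = 0 := by linarith
      exact ⟨x, rfl, y, left_mem_segment _ _ _, by simpa using left_mem_segment ℝ x y⟩
    · refine ⟨x, rfl, (s / (s + t)) • y + (t / (s + t)) • z,
        ⟨_, _, by positivity, by positivity, by field_simp, rfl⟩,
        1 - (s + t), s + t, by linarith, h0.le, by ring, ?_⟩
      rw [smul_add, smul_smul, smul_smul, mul_div_cancel₀ _ h0.ne', mul_div_cancel₀ _ h0.ne']
      module

/-- Side-side-side: by polarization, three side lengths determine the inner product, hence the
metric on the span. -/
lemma norm_smul_add_smul_eq {E E' : Type*} [NormedAddCommGroup E] [InnerProductSpace ℝ E]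
    [NormedAddCommGroup E'] [InnerProductSpace ℝ E'] {u v : E} {u' v' : E'} (hu : ‖u‖ = ‖u'‖)
    (hv : ‖v‖ = ‖v'‖) (huv : ‖u - v‖ = ‖u' - v'‖) (s t : ℝ) :
    ‖s • u + t • v‖ = ‖s • u' + t • v'‖ := by
  have h1 : inner ℝ u v = inner ℝ u' v' := by
    have h2 := norm_sub_sq_real u v
    have h3 := norm_sub_sq_real u' v'
    rw [huv, h3, hu, hv] at h2
    linarith
  have h4 : ‖s • u + t • v‖ ^ 2 = ‖s • u' + t • v'‖ ^ 2 := by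
    rw [norm_add_sq_real, norm_add_sq_real, norm_smul, norm_smul, norm_smul, norm_smul,
      real_inner_smul_left, real_inner_smul_right, real_inner_smul_left, real_inner_smul_right, hu,
      hv, h1]
  exact (pow_left_inj₀ (norm_nonneg _) (norm_nonneg _) two_ne_zero).1 h4

end FlatKlein

namespace FlatKlein

open PolyhedralComplex

/-! ### Developments of polygonal complexes -/

/-- Given the cyclically ordered neighbours `nb w j` of each vertex `w` of a triangulation, the
triples that are the vertices of a triangle. -/
def IsTriangle {W : Type*} (nb : W → ℕ → W) (w a b : W) : Prop :=
  ∃ j, s(nb w j, nb w (j + 1)) = s(a, b)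

/-- Charts of a polygonal complex in the plane: each vertex `w` of the refined complex has a
closed star with `deg w` triangles, in which the vertices `nb w j` follow each other cyclically;
`pos w e` is the position of the vertex `e` in the chart of the vertex `w`. The charts differ by
glide reflections, and are isometric to the stars of a piecewise linear map to space. -/
structure IsDevelopment {V F : Type} (K : PolyhedralComplex V F) (P : V ⊕ F → E3) (L B : ℝ)
    (deg : V ⊕ F → ℕ) (nb : V ⊕ F → ℕ → V ⊕ F) (pos : V ⊕ F → V ⊕ F → ℂ) : Prop where
  periodic : ∀ w, Function.Periodic (nb w) (deg w)
  deg_face : ∀ f, deg (Sum.inr f) = K.size f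
  nb_face : ∀ f (i : Fin (K.size f)), nb (Sum.inr f) i = Sum.inl (K.vert f i)
  rotate : ∀ {w a b}, IsTriangle nb w a b → IsTriangle nb a w b
  exists_face : ∀ {w a b}, IsTriangle nb w a b →
    (∃ f, w = Sum.inr f) ∨ (∃ f, a = Sum.inr f) ∨ ∃ f, b = Sum.inr f
  -- The same group element serves all three vertices, and hence the whole triangle.
  chart : ∀ {w a b}, IsTriangle nb w a b → ∃ m n : ℤ, pos w w = glide L B m n (pos a w) ∧
    pos w a = glide L B m n (pos a a) ∧ pos w b = glide L B m n (pos a b)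
  fan : ∀ w, IsFan (fun j => pos w (nb w j) - pos w w) (deg w)
  norm_eq : ∀ w j, ‖P (nb w j) - P w‖ = ‖pos w (nb w j) - pos w w‖
  cone : ∀ w, IsEmbeddedCone (fun j => P (nb w j) - P w) (deg w)

lemma IsTriangle.swap {W : Type*} {nb : W → ℕ → W} {w a b : W} (h : IsTriangle nb w a b) :
    IsTriangle nb w b a := by
  obtain ⟨j, hj⟩ := h
  exact ⟨j, hj.trans Sym2.eq_swap⟩

/-- A vertex of the geometric realization. -/
def bpt {W : Type*} [DecidableEq W] (w : W) : W → ℝ := Pi.single w 1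

/-- The triangle with given vertices in the geometric realization. -/
def hull {W : Type*} [DecidableEq W] (w a b : W) : Set (W → ℝ) :=
  convexHull ℝ {bpt w, bpt a, bpt b}

section Hull

variable {W : Type*} [DecidableEq W] {w a b : W}

lemma hull_swap : hull w a b = hull w b a := by
  rw [hull, hull, pair_comm]

lemma hull_rotate : hull w a b = hull a w b := by
  rw [hull, hull, insert_comm]

lemma mem_of_pos {x : W → ℝ} (hx : x ∈ hull w a b) {u : W} (hu : x u ≠ 0) :
    u = w ∨ u = a ∨ u = b := by
  obtain ⟨s, t, -, -, -, rfl⟩ := mem_convexHull_triple.1 hx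
  by_contra! hne
  exact hu (by simp [bpt, hne.1, hne.2.1, hne.2.2])

lemma isCompact_hull [Finite W] : IsCompact (hull w a b) :=
  (Set.toFinite ({bpt w, bpt a, bpt b} : Set (W → ℝ))).isCompact_convexHull ℝ

lemma exists_pos_of_mem_hull [Fintype W] {x : W → ℝ} (hx : x ∈ hull w a b) : ∃ u, 0 < x u := by
  have hsum : ∑ u, x u = 1 := by
    obtain ⟨s, t, -, -, -, rfl⟩ := mem_convexHull_triple.1 hx
    simp [bpt, Finset.sum_add_distrib, ← Finset.mul_sum]
  by_contra! hno
  have := Finset.sum_nonpos fun u (_ : u ∈ Finset.univ) => hno u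
  linarith

end Hull

namespace IsDevelopment

variable {V F : Type} {K : PolyhedralComplex V F} {P : V ⊕ F → E3} {L B : ℝ} {deg : V ⊕ F → ℕ}
  {nb : V ⊕ F → ℕ → V ⊕ F} {pos : V ⊕ F → V ⊕ F → ℂ}

lemma deg_pos (h : IsDevelopment K P L B deg nb pos) (w : V ⊕ F) : 0 < deg w := (h.fan w).pos

/-- At the last vertex the index `i + 1` equals the size of the face; periodicity of `nb` then wraps
around as `finRotate` does. -/
lemma nb_next (h : IsDevelopment K P L B deg nb pos) (f : F) (i : Fin (K.size f)) :
    nb (Sum.inr f) (i + 1) = Sum.inl (K.next f i) := by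
  rw [PolyhedralComplex.next, ← h.nb_face]
  by_cases hi : (i : ℕ) + 1 = K.size f
  · have h1 : (finRotate (K.size f) i : ℕ) = 0 := by
      obtain ⟨n, hn⟩ : ∃ n, K.size f = n + 1 := ⟨i, hi.symm⟩
      generalize K.size f = m at *
      subst hn
      rw [coe_finRotate, if_pos (Fin.ext (by simp; omega))]
    rw [h1, hi, ← h.deg_face]
    simpa using h.periodic (Sum.inr f) 0
  · have h1 : (finRotate (K.size f) i : ℕ) = i + 1 := by
      have := i.2
      obtain ⟨n, hn⟩ : ∃ n, K.size f = n + 1 := ⟨K.size f - 1, by omega⟩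
      generalize K.size f = m at *
      subst hn
      rw [coe_finRotate, if_neg (fun h => hi (by rw [h]; simp))]
    rw [h1]

/-- A triangle at a vertex, with an index in the range of one period. -/
lemma exists_index (h : IsDevelopment K P L B deg nb pos) {w a b : V ⊕ F}
    (ht : IsTriangle nb w a b) : ∃ j < deg w, s(nb w j, nb w (j + 1)) = s(a, b) := by
  obtain ⟨j, hj⟩ := ht
  refine ⟨j % deg w, Nat.mod_lt _ (h.deg_pos w), ?_⟩
  rw [← hj, (h.periodic w).map_mod_nat]
  congr 1
  rw [← (h.periodic w).map_mod_nat (j % deg w + 1), Nat.mod_add_mod, (h.periodic w).map_mod_nat]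

lemma isTriangle_face (h : IsDevelopment K P L B deg nb pos) {f : F} {a b : V ⊕ F} :
    IsTriangle nb (Sum.inr f) a b ↔
      ∃ i, s(Sum.inl (K.vert f i), Sum.inl (K.next f i)) = s(a, b) := by
  constructor
  · intro ht
    obtain ⟨j, hj, he⟩ := h.exists_index ht
    rw [h.deg_face] at hj
    refine ⟨⟨j, hj⟩, ?_⟩
    rw [← h.nb_face, ← h.nb_next]
    exact he
  · rintro ⟨i, hi⟩
    refine ⟨i, ?_⟩
    rw [h.nb_face, h.nb_next]
    exact hi

variable [DecidableEq V] [DecidableEq F]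

lemma mem_cell (h : IsDevelopment K P L B deg nb pos) {x : V ⊕ F → ℝ} {f : F} :
    x ∈ K.cell f ↔ ∃ a b, IsTriangle nb (Sum.inr f) a b ∧ x ∈ hull (Sum.inr f) a b := by
  simp only [cell, mem_iUnion, h.isTriangle_face]
  constructor
  · rintro ⟨i, hi⟩
    exact ⟨_, _, ⟨i, rfl⟩, hi⟩
  · rintro ⟨a, b, ⟨i, hi⟩, hx⟩
    refine ⟨i, ?_⟩
    rcases Sym2.eq_iff.1 hi with ⟨rfl, rfl⟩ | ⟨rfl, rfl⟩
    · exact hx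
    · rw [hull_swap] at hx; exact hx

lemma mem_space (h : IsDevelopment K P L B deg nb pos) {x : V ⊕ F → ℝ} :
    x ∈ K.space ↔ ∃ w a b, IsTriangle nb w a b ∧ x ∈ hull w a b := by
  simp only [space, mem_iUnion, h.mem_cell]
  constructor
  · rintro ⟨f, a, b, ht, hx⟩
    exact ⟨_, a, b, ht, hx⟩
  · rintro ⟨w, a, b, ht, hx⟩
    rcases h.exists_face ht with ⟨f, rfl⟩ | ⟨f, rfl⟩ | ⟨f, rfl⟩
    · exact ⟨f, a, b, ht, hx⟩
    · exact ⟨f, w, b, h.rotate ht, by rwa [hull_rotate] at hx⟩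
    · exact ⟨f, w, a, h.rotate ht.swap, by rwa [hull_swap, hull_rotate] at hx⟩

/-- A point with a positive coordinate lies in the star of the corresponding vertex. -/
lemma exists_star (h : IsDevelopment K P L B deg nb pos) {x : V ⊕ F → ℝ} {w a b u : V ⊕ F}
    (ht : IsTriangle nb w a b) (hx : x ∈ hull w a b) (hu : x u ≠ 0) :
    ∃ a' b', IsTriangle nb u a' b' ∧ x ∈ hull u a' b' ∧ hull u a' b' = hull w a b ∧
      (w = u ∨ w = a' ∨ w = b') := by
  rcases mem_of_pos hx hu with rfl | rfl | rfl
  · exact ⟨a, b, ht, hx, rfl, Or.inl rfl⟩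
  · exact ⟨w, b, h.rotate ht, by rwa [hull_rotate] at hx, hull_rotate, Or.inr (Or.inl rfl)⟩
  · refine ⟨w, a, h.rotate ht.swap, by rwa [hull_swap, hull_rotate] at hx, ?_, Or.inr (Or.inl rfl)⟩
    rw [hull_swap (w := w), hull_rotate (w := w)]

variable [Fintype V] [Fintype F]

variable (pos) in
/-- The affine extension of a chart. -/
noncomputable def chartMap (w : V ⊕ F) : (V ⊕ F → ℝ) →ₗ[ℝ] ℂ := Fintype.linearCombination ℝ (pos w)

lemma linearCombination_bpt {W E : Type*} [Fintype W] [DecidableEq W] [AddCommGroup E] [Module ℝ E]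
    (v : W → E) (w : W) : Fintype.linearCombination ℝ v (bpt w) = v w := by
  rw [bpt, Fintype.linearCombination_apply_single, one_smul]

lemma chartMap_bpt (w a : V ⊕ F) : chartMap pos w (bpt a) = pos w a := linearCombination_bpt _ _

omit [DecidableEq V] [DecidableEq F] in
lemma plMap_eq (P : V ⊕ F → E3) (x : V ⊕ F → ℝ) :
    plMap (P ∘ Sum.inl) (P ∘ Sum.inr) x = Fintype.linearCombination ℝ P x := by
  rw [Fintype.linearCombination_apply, Fintype.sum_sum_type]
  rfl

/-- The charts of the vertices of a triangle differ by a glide reflection. -/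
lemma exists_chartMap_eq (h : IsDevelopment K P L B deg nb pos) {w a b : V ⊕ F}
    (ht : IsTriangle nb w a b) : ∃ m n : ℤ, ∀ x ∈ hull w a b,
      chartMap pos w x = glide L B m n (chartMap pos a x) := by
  obtain ⟨m, n, h1, h2, h3⟩ := h.chart ht
  refine ⟨m, n, fun x hx => ?_⟩
  obtain ⟨s, t, -, -, -, rfl⟩ := mem_convexHull_triple.1 hx
  have key : ∀ z₀ z₁ z₂ : ℂ, glide L B m n (z₀ + s • (z₁ - z₀) + t • (z₂ - z₀)) =
      glide L B m n z₀ + s • (glide L B m n z₁ - glide L B m n z₀) +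
        t • (glide L B m n z₂ - glide L B m n z₀) := by
    intro z₀ z₁ z₂
    have := glide_affine (L := L) (B := B) m n Finset.univ ![1 - s - t, s, t] ![z₀, z₁, z₂]
      (by simp [Fin.sum_univ_three]; ring)
    simp only [Fin.sum_univ_three, Matrix.cons_val_zero, Matrix.cons_val_one,
      Matrix.cons_val] at this
    convert this using 1
    · congr 1; module
    · module
  simp only [map_add, map_smul, map_sub, chartMap_bpt, key, h1, h2, h3]

lemma proj_chartMap_eq (h : IsDevelopment K P L B deg nb pos) {w a b : V ⊕ F}
    (ht : IsTriangle nb w a b) {x : V ⊕ F → ℝ} (hx : x ∈ hull w a b) :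
    proj L B (chartMap pos w x) = proj L B (chartMap pos a x) := by
  obtain ⟨m, n, hmn⟩ := h.exists_chartMap_eq ht
  rw [hmn x hx, proj_glide]

/-- On a triangle, the chart and the map to space have the same metric. -/
lemma norm_chartMap_sub (h : IsDevelopment K P L B deg nb pos) {w a b : V ⊕ F}
    (ht : IsTriangle nb w a b) {x y : V ⊕ F → ℝ} (hx : x ∈ hull w a b) (hy : y ∈ hull w a b) :
    ‖Fintype.linearCombination ℝ P x - Fintype.linearCombination ℝ P y‖ =
      ‖chartMap pos w x - chartMap pos w y‖ := by
  have edge : ∀ {w a b}, IsTriangle nb w a b → ‖P a - P w‖ = ‖pos w a - pos w w‖ := by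
    intro w a b ht
    obtain ⟨j, hj⟩ := ht
    rcases Sym2.eq_iff.1 hj with ⟨rfl, rfl⟩ | ⟨rfl, rfl⟩ <;> exact h.norm_eq _ _
  have h1 := edge ht
  have h2 := edge ht.swap
  -- The side opposite to `w` is measured in the chart of `a`, and the glide between the charts
  -- preserves its length.
  have h3 : ‖(P a - P w) - (P b - P w)‖ = ‖(pos w a - pos w w) - (pos w b - pos w w)‖ := by
    rw [sub_sub_sub_cancel_right, sub_sub_sub_cancel_right, norm_sub_rev, edge (h.rotate ht).swap]
    obtain ⟨m, n, -, e1, e2⟩ := h.chart ht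
    rw [e1, e2, norm_glide_sub_glide, norm_sub_rev]
  obtain ⟨s, t, -, -, -, rfl⟩ := mem_convexHull_triple.1 hx
  obtain ⟨s', t', -, -, -, rfl⟩ := mem_convexHull_triple.1 hy
  have h4 := norm_smul_add_smul_eq h1 h2 h3 (s - s') (t - t')
  simp only [map_add, map_smul, map_sub, chartMap_bpt, linearCombination_bpt]
  have key : ∀ {E : Type} [AddCommGroup E] [Module ℝ E] (a b c : E),
      a + s • b + t • c - (a + s' • b + t' • c) = (s - s') • b + (t - t') • c :=
    fun a b c => by module
  rw [key, key]
  exact h4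

omit [Fintype V] [Fintype F] in
/-- A linear map that embeds the cone at a vertex is injective on the star of that vertex. -/
lemma injOn_star (h : IsDevelopment K P L B deg nb pos) {E : Type*} [AddCommGroup E] [Module ℝ E]
    (f : (V ⊕ F → ℝ) →ₗ[ℝ] E) {w : V ⊕ F}
    (hf : IsEmbeddedCone (fun j => f (bpt (nb w j)) - f (bpt w)) (deg w)) :
    InjOn f {x | ∃ a b, IsTriangle nb w a b ∧ x ∈ hull w a b} := by
  have rep : ∀ x ∈ {x | ∃ a b, IsTriangle nb w a b ∧ x ∈ hull w a b}, ∃ j < deg w, ∃ s t : ℝ,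
      0 ≤ s ∧ 0 ≤ t ∧
        x = bpt w + (s • (bpt (nb w j) - bpt w) + t • (bpt (nb w (j + 1)) - bpt w)) := by
    rintro x ⟨a, b, ht, hx⟩
    obtain ⟨j, hj, he⟩ := h.exists_index ht
    obtain ⟨s, t, hs, ht', -, rfl⟩ := mem_convexHull_triple.1 hx
    rcases Sym2.eq_iff.1 he with ⟨rfl, rfl⟩ | ⟨rfl, rfl⟩
    · exact ⟨j, hj, s, t, hs, ht', add_assoc _ _ _⟩
    · exact ⟨j, hj, t, s, ht', hs, by rw [add_assoc, add_comm (t • _)]⟩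
  intro x hx y hy hxy
  obtain ⟨j, hj, s, t, hs, ht, rfl⟩ := rep x hx
  obtain ⟨l, hl, s', t', hs', ht', rfl⟩ := rep y hy
  congr 1
  -- Equal images are a coincidence in the embedded cone, which is carried back to the star in the
  -- realization.
  refine hf.eq (g := fun j => bpt (nb w j) - bpt w) ?_ hj hl hs ht hs' ht' ?_
  · simpa using congrArg (fun e => bpt e - bpt w) (h.periodic w 0)
  · simpa only [map_add, map_smul, map_sub, add_right_inj] using hxy

lemma injOn_chartMap (h : IsDevelopment K P L B deg nb pos) (w : V ⊕ F) :
    InjOn (chartMap pos w) {x | ∃ a b, IsTriangle nb w a b ∧ x ∈ hull w a b} := by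
  refine h.injOn_star _ ?_
  simp only [chartMap_bpt]
  obtain ⟨θ, hθ⟩ := (h.fan w).exists_angleFunction
  exact hθ.isEmbeddedCone (h.fan w).periodic

lemma injOn_plMap (h : IsDevelopment K P L B deg nb pos) (w : V ⊕ F) :
    InjOn (Fintype.linearCombination ℝ P) {x | ∃ a b, IsTriangle nb w a b ∧ x ∈ hull w a b} := by
  refine h.injOn_star _ ?_
  simp only [linearCombination_bpt]
  exact h.cone w

end IsDevelopment

end FlatKlein

/-! ### The developing map is a homeomorphism, and the map to space is a local isometric embedding.
-/

namespace FlatKlein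

open PolyhedralComplex

/-- A locally injective open map from a compact space to a connected space is injective if one
fibre has at most one point. -/
lemma injective_of_local {X Y : Type*} [TopologicalSpace X] [CompactSpace X] [T2Space X]
    [TopologicalSpace Y] [T2Space Y] [PreconnectedSpace Y] {f : X → Y} (hf : Continuous f)
    (ho : IsOpenMap f) (hinj : ∀ x, ∃ U ∈ 𝓝 x, InjOn f U) {y : Y}
    (hy : ∀ x x', f x = y → f x' = y → x = x') : Function.Injective f := by
  -- Local injectivity makes the set of double points closed, so that its image `S` in `Y` is
  -- compact; openness of `f` makes `S` open. Hence `S` is empty or everything, and the fibre over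
  -- `y` excludes the latter.
  let D : Set (X × X) := {q | f q.1 = f q.2 ∧ q.1 ≠ q.2}
  have hclosed : IsClosed D := by
    rw [← isOpen_compl_iff, isOpen_iff_mem_nhds]
    rintro ⟨x, x'⟩ hq
    by_cases hxx : f x = f x'
    · obtain rfl : x = x' := by by_contra hne; exact hq ⟨hxx, hne⟩
      obtain ⟨U, hU, hUinj⟩ := hinj x
      filter_upwards [prod_mem_nhds hU hU] with q hq1 hq2
      exact hq2.2 (hUinj hq1.1 hq1.2 hq2.1)
    · have : {q : X × X | f q.1 ≠ f q.2} ∈ 𝓝 (x, x') :=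
        (isOpen_ne_fun (hf.comp continuous_fst) (hf.comp continuous_snd)).mem_nhds hxx
      filter_upwards [this] with q hq1 hq2
      exact hq1 hq2.1
  let S : Set Y := (fun q : X × X => f q.1) '' D
  have hS : IsClopen S := by
    refine ⟨(hclosed.isCompact.image (hf.comp continuous_fst)).isClosed, ?_⟩
    rw [isOpen_iff_mem_nhds]
    rintro _ ⟨⟨x, x'⟩, ⟨h1, h2⟩, rfl⟩
    obtain ⟨U, U', hU, hU', hx, hx', hd⟩ := t2_separation h2
    have h3 := ho.image_mem_nhds (hU.mem_nhds hx)
    have h4 := ho.image_mem_nhds (hU'.mem_nhds hx')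
    rw [← h1] at h4
    filter_upwards [h3, h4]
    rintro _ ⟨u, hu, rfl⟩ ⟨u', hu', he⟩
    exact ⟨(u, u'), ⟨he.symm, hd.ne_of_mem hu hu'⟩, rfl⟩
  intro x x' hxx
  by_contra hne
  have huniv : S = univ := hS.eq_univ ⟨_, (x, x'), ⟨hxx, hne⟩, rfl⟩
  obtain ⟨⟨u, u'⟩, ⟨h1, h2⟩, h3⟩ : y ∈ S := huniv ▸ mem_univ y
  exact h2 (hy u u' h3 (h1 ▸ h3))

namespace IsDevelopment

variable {V F : Type} {K : PolyhedralComplex V F} {P : V ⊕ F → E3} {L B : ℝ} {deg : V ⊕ F → ℕ}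
  {nb : V ⊕ F → ℕ → V ⊕ F} {pos : V ⊕ F → V ⊕ F → ℂ} [DecidableEq V] [DecidableEq F] [Fintype V]
  [Fintype F]

variable (K L B pos) in
/-- The developing map from the realization of a polygonal complex to the flat Klein bottle. -/
noncomputable def develop (x : K.space) : FlatBottle L B :=
  proj L B (chartMap pos (Sum.inr (mem_iUnion.1 x.2).choose) (x : V ⊕ F → ℝ))

/-- A vertex `u` at which `x` has a positive coordinate belongs to every triangle through `x`, so
all charts can be compared with the chart of `u`. -/
lemma develop_eq (h : IsDevelopment K P L B deg nb pos) {x : K.space} {w a b : V ⊕ F}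
    (ht : IsTriangle nb w a b) (hx : (x : V ⊕ F → ℝ) ∈ hull w a b) :
    develop K L B pos x = proj L B (chartMap pos w x) := by
  obtain ⟨a', b', ht', hx'⟩ := h.mem_cell.1 (mem_iUnion.1 x.2).choose_spec
  obtain ⟨u, hu⟩ := exists_pos_of_mem_hull hx
  have key : ∀ {w a b : V ⊕ F}, IsTriangle nb w a b → (x : V ⊕ F → ℝ) ∈ hull w a b →
      proj L B (chartMap pos w x) = proj L B (chartMap pos u x) := by
    intro w a b ht hx
    rcases mem_of_pos hx hu.ne' with rfl | rfl | rfl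
    · rfl
    · exact h.proj_chartMap_eq ht hx
    · exact h.proj_chartMap_eq ht.swap (by rwa [hull_swap] at hx)
  rw [develop, key ht' hx', key ht hx]

omit [Fintype V] [Fintype F] in
lemma exists_star_of_pos (h : IsDevelopment K P L B deg nb pos) {x : V ⊕ F → ℝ} (hx : x ∈ K.space)
    {u : V ⊕ F} (hu : 0 < x u) : ∃ a b, IsTriangle nb u a b ∧ x ∈ hull u a b := by
  obtain ⟨w, a, b, ht, hx⟩ := h.mem_space.1 hx
  obtain ⟨a', b', h1, h2, -⟩ := h.exists_star ht hx hu.ne'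
  exact ⟨a', b', h1, h2⟩

lemma exists_pos (h : IsDevelopment K P L B deg nb pos) {x : V ⊕ F → ℝ} (hx : x ∈ K.space) :
    ∃ u, 0 < x u := by
  obtain ⟨w, a, b, -, hx⟩ := h.mem_space.1 hx
  exact exists_pos_of_mem_hull hx

lemma isCompact_space (h : IsDevelopment K P L B deg nb pos) : IsCompact K.space := by
  have : K.space = ⋃ τ : {τ : (V ⊕ F) × (V ⊕ F) × (V ⊕ F) // IsTriangle nb τ.1 τ.2.1 τ.2.2},
      hull τ.1.1 τ.1.2.1 τ.1.2.2 := by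
    ext x
    rw [h.mem_space, mem_iUnion]
    exact ⟨fun ⟨w, a, b, ht, hx⟩ => ⟨⟨(w, a, b), ht⟩, hx⟩, fun ⟨τ, hx⟩ => ⟨_, _, _, τ.2, hx⟩⟩
  rw [this]
  exact isCompact_iUnion fun _ => isCompact_hull

omit [DecidableEq V] [DecidableEq F] in
lemma continuous_chartMap (w : V ⊕ F) : Continuous (chartMap pos w) :=
  LinearMap.continuous_of_finiteDimensional _

/-- Near a point of the realization, all points lie in a common triangle with it. -/
lemma eventually_common_triangle (h : IsDevelopment K P L B deg nb pos) (x : K.space) :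
    ∀ᶠ y : K.space in 𝓝 x, ∃ w a b, IsTriangle nb w a b ∧ (x : V ⊕ F → ℝ) ∈ hull w a b ∧
      (y : V ⊕ F → ℝ) ∈ hull w a b := by
  -- Triangles are closed and finite in number, so a neighbourhood of `x` avoids all those that miss
  -- `x`.
  have : ∀ᶠ y : K.space in 𝓝 x, ∀ τ : (V ⊕ F) × (V ⊕ F) × (V ⊕ F),
      (x : V ⊕ F → ℝ) ∉ hull τ.1 τ.2.1 τ.2.2 → (y : V ⊕ F → ℝ) ∉ hull τ.1 τ.2.1 τ.2.2 := by
    rw [Filter.eventually_all]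
    intro τ
    by_cases hx : (x : V ⊕ F → ℝ) ∈ hull τ.1 τ.2.1 τ.2.2
    · exact Filter.Eventually.of_forall fun y hy => absurd hx hy
    · have h1 : IsOpen {y : K.space | (y : V ⊕ F → ℝ) ∉ hull τ.1 τ.2.1 τ.2.2} :=
        (isCompact_hull.isClosed.isOpen_compl).preimage continuous_subtype_val
      filter_upwards [h1.mem_nhds hx] with y hy _ using hy
  filter_upwards [this] with y hy
  obtain ⟨w, a, b, ht, hyt⟩ := h.mem_space.1 y.2
  exact ⟨w, a, b, ht, by_contra fun hx => hy (w, a, b) hx hyt, hyt⟩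

variable [hL : Fact (0 < L)] [hB : Fact (0 < B)]

lemma continuous_develop (h : IsDevelopment K P L B deg nb pos) :
    Continuous (develop K L B pos) := by
  refine LocallyFinite.continuous
    (f := fun τ : {τ : (V ⊕ F) × (V ⊕ F) × (V ⊕ F) // IsTriangle nb τ.1 τ.2.1 τ.2.2} =>
      {x : K.space | (x : V ⊕ F → ℝ) ∈ hull τ.1.1 τ.1.2.1 τ.1.2.2})
    (locallyFinite_of_finite _) ?_ ?_ ?_
  · refine eq_univ_of_forall fun x => mem_iUnion.2 ?_
    obtain ⟨w, a, b, ht, hx⟩ := h.mem_space.1 x.2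
    exact ⟨⟨(w, a, b), ht⟩, hx⟩
  · exact fun τ => isCompact_hull.isClosed.preimage continuous_subtype_val
  · intro τ
    exact ContinuousOn.congr (f := fun x : K.space => proj L B (chartMap pos τ.1.1 x))
      (continuous_proj.comp ((continuous_chartMap _).comp continuous_subtype_val)).continuousOn
      fun x hx => h.develop_eq τ.2 hx

omit [Fintype V] [Fintype F] in
lemma eventually_pos {x : K.space} {w : V ⊕ F} (hw : 0 < (x : V ⊕ F → ℝ) w) :
    ∀ᶠ y : K.space in 𝓝 x, 0 < (y : V ⊕ F → ℝ) w :=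
  ((continuous_apply w).comp continuous_subtype_val).continuousAt.eventually (lt_mem_nhds hw)

lemma eventually_close (w : V ⊕ F) (x : K.space) {ε : ℝ} (hε : 0 < ε) :
    ∀ᶠ y : K.space in 𝓝 x, ‖chartMap pos w y - chartMap pos w x‖ < ε := by
  have : Continuous fun y : K.space => ‖chartMap pos w y - chartMap pos w x‖ :=
    (((continuous_chartMap w).comp continuous_subtype_val).sub continuous_const).norm
  exact this.continuousAt.eventually (gt_mem_nhds (by simpa using hε))

/-- A chart is injective on the star, and the projection is injective on the chart image of a small
part of the star. -/
lemma develop_locally_injective (h : IsDevelopment K P L B deg nb pos) (x : K.space) :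
    ∃ U ∈ 𝓝 x, InjOn (develop K L B pos) U := by
  obtain ⟨w, hw⟩ := h.exists_pos x.2
  have hs := systole_pos (L := L) (B := B)
  refine ⟨_, (eventually_pos hw).and (eventually_close (pos := pos) w x
    (ε := systole L B / 4) (by linarith)), ?_⟩
  rintro y ⟨hy1, hy2⟩ z ⟨hz1, hz2⟩ hyz
  obtain ⟨a, b, ht, hy⟩ := h.exists_star_of_pos y.2 hy1
  obtain ⟨a', b', ht', hz⟩ := h.exists_star_of_pos z.2 hz1
  rw [h.develop_eq ht hy, h.develop_eq ht' hz] at hyz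
  have hclose : ‖chartMap pos w (y : V ⊕ F → ℝ) - chartMap pos w (z : V ⊕ F → ℝ)‖ ≤
      systole L B / 2 := by
    have := norm_sub_le_norm_sub_add_norm_sub (chartMap pos w (y : V ⊕ F → ℝ))
      (chartMap pos w (x : V ⊕ F → ℝ)) (chartMap pos w (z : V ⊕ F → ℝ))
    rw [norm_sub_rev (chartMap pos w (x : V ⊕ F → ℝ))] at this
    linarith
  have h0 := dist_proj_of_le hclose
  rw [hyz, dist_self, eq_comm, norm_eq_zero, sub_eq_zero] at h0
  exact Subtype.ext (h.injOn_chartMap w ⟨a, b, ht, hy⟩ ⟨a', b', ht', hz⟩ h0)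

omit [DecidableEq V] [DecidableEq F] [Fintype V] [Fintype F] hL hB in
lemma nb_ne (h : IsDevelopment K P L B deg nb pos) (w : V ⊕ F) (j : ℕ) : nb w j ≠ w := by
  intro he
  have h1 := (h.fan w).im_ne (j % deg w) (Nat.mod_lt _ (h.deg_pos w))
  simp only [(h.periodic w).map_mod_nat, he, sub_self, Complex.zero_im, ne_eq,
    not_true_eq_false] at h1

/-- Since a fan goes all the way around, the chart of a star has a piecewise linear right inverse
`G` on the whole plane. Near the image of `x` it takes values in the star close to `x`, so the image
of a neighbourhood contains a disc. -/
lemma isOpenMap_develop (h : IsDevelopment K P L B deg nb pos) :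
    IsOpenMap (develop K L B pos) := by
  rw [isOpenMap_iff_nhds_le]
  intro x S hS
  rw [Filter.mem_map] at hS
  obtain ⟨O, hO, hOS⟩ := mem_nhds_subtype _ _ _ |>.1 hS
  obtain ⟨w, hw⟩ := h.exists_pos x.2
  have hper : bpt (nb w (deg w)) - bpt w = bpt (nb w 0) - bpt w := by
    simpa using congrArg (fun e => bpt e - bpt w) (h.periodic w 0)
  obtain ⟨H, hHc, hH⟩ := (h.fan w).exists_continuous (fun j => bpt (nb w j) - bpt w) hper
  let G : ℂ → V ⊕ F → ℝ := fun z => bpt w + H (z - pos w w)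
  have hG : Continuous G := by fun_prop
  -- `G` is a right inverse of the chart, and takes values in the star where its `w`-coordinate is
  -- positive
  have hright : ∀ z, chartMap pos w (G z) = z ∧
      (0 < G z w → ∃ a b, IsTriangle nb w a b ∧ G z ∈ hull w a b) := by
    intro z
    obtain ⟨j, hj, a, b, ha, hb, hz, hHz⟩ := hH (z - pos w w)
    have hGz : G z = bpt w + a • (bpt (nb w j) - bpt w) + b • (bpt (nb w (j + 1)) - bpt w) := by
      rw [add_assoc, ← hHz]
    constructor
    · rw [hGz]
      simp only [map_add, map_smul, map_sub, chartMap_bpt]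
      rw [add_assoc, ← hz, add_sub_cancel]
    · intro hpos
      refine ⟨nb w j, nb w (j + 1), ⟨j, rfl⟩, mem_convexHull_triple.2 ⟨a, b, ha, hb, ?_, hGz⟩⟩
      rw [hGz] at hpos
      simp [bpt, (h.nb_ne w _).symm] at hpos
      linarith
  -- Both sides lie in the cone at `w` and have the same chart image, and the fan is an embedded
  -- cone.
  have hGx : G (chartMap pos w x) = x := by
    obtain ⟨a, b, ht, hx⟩ := h.exists_star_of_pos x.2 hw
    obtain ⟨l, hl, s, t, hs, ht0, hz, hHz⟩ := hH (chartMap pos w x - pos w w)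
    have hGz : G (chartMap pos w x) = bpt w + H (chartMap pos w x - pos w w) := rfl
    obtain ⟨j, hj, he⟩ := h.exists_index ht
    obtain ⟨θ, hθ⟩ := (h.fan w).exists_angleFunction
    have hcone := hθ.isEmbeddedCone (h.fan w).periodic
    have key : ∀ s' t' : ℝ, 0 ≤ s' → 0 ≤ t' → (x : V ⊕ F → ℝ) = bpt w +
        (s' • (bpt (nb w j) - bpt w) + t' • (bpt (nb w (j + 1)) - bpt w)) →
        G (chartMap pos w x) = x := by
      intro s' t' hs' ht' hx
      rw [hGz, hHz, hx, add_right_inj]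
      refine hcone.eq (g := fun j => bpt (nb w j) - bpt w) hper hl hj hs ht0 hs' ht' ?_
      rw [← hz, hx]
      simp only [map_add, map_smul, map_sub, chartMap_bpt, add_sub_cancel_left]
    obtain ⟨s', t', hs', ht', -, hx⟩ := mem_convexHull_triple.1 hx
    rcases Sym2.eq_iff.1 he with ⟨rfl, rfl⟩ | ⟨rfl, rfl⟩
    · exact key s' t' hs' ht' (by rw [hx, add_assoc])
    · exact key t' s' ht' hs' (by rw [hx, add_assoc, add_comm (t' • _)])
  have hT : {z | G z ∈ O ∧ 0 < G z w} ∈ 𝓝 (chartMap pos w x) := by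
    refine Filter.inter_mem (hG.continuousAt (by rwa [hGx])) ?_
    have h1 : Continuous fun z => G z w := (continuous_apply w).comp hG
    exact h1.continuousAt.eventually (lt_mem_nhds (by simpa only [hGx] using hw))
  obtain ⟨a, b, ht, hx⟩ := h.exists_star_of_pos x.2 hw
  rw [h.develop_eq ht hx]
  refine Filter.mem_of_superset (isOpenMap_proj.image_mem_nhds hT) ?_
  rintro _ ⟨z, ⟨hz1, hz2⟩, rfl⟩
  obtain ⟨h1, h2⟩ := hright z
  obtain ⟨a', b', ht', hz'⟩ := h2 hz2
  have h3 : G z ∈ K.space := h.mem_space.2 ⟨w, a', b', ht', hz'⟩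
  have h4 := hOS (show (⟨G z, h3⟩ : K.space) ∈ _ from hz1)
  rw [mem_preimage, h.develop_eq (x := ⟨G z, h3⟩) ht' hz', h1] at h4
  exact h4

/-- A development is bijective if the centre of some face is covered only once. -/
theorem exists_homeomorph (h : IsDevelopment K P L B deg nb pos) (f₀ : F)
    (hbase : ∀ f a b, IsTriangle nb (Sum.inr f) a b → ∀ m n : ℤ,
      glide L B m n (pos (Sum.inr f₀) (Sum.inr f₀)) ∈ convexHull ℝ
        {pos (Sum.inr f) (Sum.inr f), pos (Sum.inr f) a, pos (Sum.inr f) b} →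
      f = f₀ ∧ m = 0 ∧ n = 0) :
    ∃ φ : K.space ≃ₜ FlatBottle L B, ∀ x, φ x = develop K L B pos x := by
  have : CompactSpace K.space := isCompact_iff_compactSpace.1 h.isCompact_space
  -- A point over the centre lies in a triangle whose chart contains some translate of the centre.
  -- By `hbase` the face is `f₀` and the translate trivial, and the chart of `f₀` is injective on
  -- its star.
  have hfib : ∀ x : K.space, develop K L B pos x = proj L B (pos (Sum.inr f₀) (Sum.inr f₀)) →
      (x : V ⊕ F → ℝ) ∈ {x | ∃ a b, IsTriangle nb (Sum.inr f₀) a b ∧ x ∈ hull (Sum.inr f₀) a b} ∧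
        chartMap pos (Sum.inr f₀) x = pos (Sum.inr f₀) (Sum.inr f₀) := by
    intro x hx
    obtain ⟨f, hf⟩ := mem_iUnion.1 x.2
    obtain ⟨a, b, ht, hxt⟩ := h.mem_cell.1 hf
    rw [h.develop_eq ht hxt, proj_eq_proj] at hx
    obtain ⟨m, n, hmn⟩ := hx
    have hmem : chartMap pos (Sum.inr f) x ∈ convexHull ℝ
        {pos (Sum.inr f) (Sum.inr f), pos (Sum.inr f) a, pos (Sum.inr f) b} := by
      obtain ⟨s, t, hs, ht, hst, he⟩ := mem_convexHull_triple.1 hxt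
      refine mem_convexHull_triple.2 ⟨s, t, hs, ht, hst, ?_⟩
      rw [he]
      simp only [map_add, map_smul, map_sub, chartMap_bpt]
    rw [hmn] at hmem
    obtain ⟨rfl, rfl, rfl⟩ := hbase f a b ht m n hmem
    exact ⟨⟨a, b, ht, hxt⟩, by rw [hmn, glide_zero]⟩
  have hinj : Function.Injective (develop K L B pos) := by
    refine injective_of_local h.continuous_develop h.isOpenMap_develop h.develop_locally_injective
      (y := proj L B (pos (Sum.inr f₀) (Sum.inr f₀))) fun x x' hx hx' => ?_
    obtain ⟨h1, h2⟩ := hfib x hx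
    obtain ⟨h1', h2'⟩ := hfib x' hx'
    exact Subtype.ext (h.injOn_chartMap _ h1 h1' (h2.trans h2'.symm))
  have hsurj : Function.Surjective (develop K L B pos) := by
    have hne : (range (develop K L B pos)).Nonempty := by
      have hmem : bpt (Sum.inr f₀ : V ⊕ F) ∈ K.space :=
        h.mem_space.2 ⟨_, _, _, ⟨0, rfl⟩, subset_convexHull ℝ _ (mem_insert _ _)⟩
      exact ⟨_, ⟨_, hmem⟩, rfl⟩
    have hclopen : IsClopen (range (develop K L B pos)) :=
      ⟨(isCompact_range h.continuous_develop).isClosed, h.isOpenMap_develop.isOpen_range⟩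
    exact range_eq_univ.1 (hclopen.eq_univ hne)
  exact ⟨Continuous.homeoOfEquivCompactToT2 (f := Equiv.ofBijective _ ⟨hinj, hsurj⟩)
    h.continuous_develop, fun x => rfl⟩

/-- Piecewise linear maps with the metric of a development are local isometric embeddings. -/
theorem isLocalIsometricEmbedding (h : IsDevelopment K P L B deg nb pos)
    (φ : K.space ≃ₜ FlatBottle L B) (hφ : ∀ x, φ x = develop K L B pos x) :
    IsLocalIsometricEmbedding fun m => Fintype.linearCombination ℝ P (φ.symm m : V ⊕ F → ℝ) := by
  have : Nonempty (V ⊕ F) := by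
    obtain ⟨m⟩ : Nonempty (FlatBottle L B) := inferInstance
    obtain ⟨w, -⟩ := h.exists_pos (φ.symm m).2
    exact ⟨w⟩
  -- Nearby points share a triangle with the given one, and there the two metrics agree; injectivity
  -- on the open star comes from the embedded cone in space.
  refine isLocalIsometricEmbedding_of_radial (fun m => ?_) fun m => ?_
  · have hs := systole_pos (L := L) (B := B)
    have h1 := h.eventually_common_triangle (φ.symm m)
    have h2 : ∀ᶠ y : K.space in 𝓝 (φ.symm m), ∀ w,
        ‖chartMap pos w y - chartMap pos w (φ.symm m)‖ < systole L B / 2 :=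
      Filter.eventually_all.2 fun w => eventually_close w _ (by linarith)
    filter_upwards [φ.symm.continuous.continuousAt.eventually (h1.and h2)] with m' hm'
    obtain ⟨⟨w, a, b, ht, hx, hy⟩, hclose⟩ := hm'
    have h3 := h.develop_eq ht hx
    have h4 := h.develop_eq ht hy
    rw [← hφ, φ.apply_symm_apply] at h3 h4
    have h5 := dist_proj_of_le (L := L) (B := B) ((norm_sub_rev _ _).trans_le (hclose w).le)
    rw [← h3, ← h4] at h5
    rw [edist_dist, edist_dist, dist_eq_norm, h.norm_chartMap_sub ht hx hy, h5]
  · obtain ⟨w, hw⟩ := h.exists_pos (φ.symm m).2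
    refine ⟨_, φ.symm.continuous.continuousAt.eventually (eventually_pos hw), ?_⟩
    intro y hy z hz hyz
    exact φ.symm.injective (Subtype.ext (h.injOn_plMap w (h.exists_star_of_pos (φ.symm y).2 hy)
      (h.exists_star_of_pos (φ.symm z).2 hz) hyz))

end IsDevelopment

end FlatKlein

/-! ### Embedded cones from separating planes; links and vertex figures. -/

namespace FlatKlein

open PolyhedralComplex

/-- A closed chain of directions in which consecutive gaps lie on different sides of their common
direction and other gaps are separated by a hyperplane bounds an embedded cone. -/
theorem isEmbeddedCone_of_separation {E : Type*} [AddCommGroup E] [Module ℝ E] {u : ℕ → E} {k : ℕ}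
    (hper : Function.Periodic u k)
    (hadj : ∀ j < k, ∃ f : E →ₗ[ℝ] ℝ, f (u (j + 1)) = 0 ∧ 0 < f (u j) ∧ f (u (j + 2)) < 0)
    (hfar : ∀ j < k, ∀ l < k, j + 1 < l → ¬(j = 0 ∧ l + 1 = k) → ∃ f : E →ₗ[ℝ] ℝ,
      (0 < f (u j) ∧ 0 < f (u (j + 1)) ∧ f (u l) ≤ 0 ∧ f (u (l + 1)) ≤ 0) ∨
      (0 ≤ f (u j) ∧ 0 ≤ f (u (j + 1)) ∧ f (u l) < 0 ∧ f (u (l + 1)) < 0)) :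
    IsEmbeddedCone u k := by
  have hne : ∀ j < k, u (j + 1) ≠ 0 := by
    intro j hj h0
    by_cases hj' : j + 1 < k
    · obtain ⟨f, -, hf, -⟩ := hadj (j + 1) hj'
      simp [h0] at hf
    · obtain ⟨f, -, hf, -⟩ := hadj 0 (by omega)
      have h1 : u (j + 1) = u 0 := by
        rw [show j + 1 = 0 + k by omega, hper]
      simp [← h1, h0] at hf
  have hindep : ∀ j < k, ∀ a b : ℝ, a • u j + b • u (j + 1) = 0 → a = 0 ∧ b = 0 := by
    intro j hj a b h0
    obtain ⟨f, hf0, hf1, -⟩ := hadj j hj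
    have h1 := congrArg f h0
    simp only [map_add, map_smul, hf0, smul_eq_mul, mul_zero, add_zero, map_zero] at h1
    have ha : a = 0 := (mul_eq_zero.1 h1).resolve_right hf1.ne'
    rw [ha, zero_smul, zero_add] at h0
    exact ⟨ha, (smul_eq_zero.1 h0).resolve_right (hne j hj)⟩
  have hzero : ∀ {x y p q : ℝ}, 0 ≤ x → 0 ≤ y → 0 < p → q < 0 → x * p = y * q → x = 0 ∧ y = 0 := by
    intro x y p q hx hy hp hq h
    have h1 : 0 ≤ x * p := mul_nonneg hx hp.le
    have h2 : y * q ≤ 0 := mul_nonpos_of_nonneg_of_nonpos hy hq.le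
    exact ⟨(mul_eq_zero.1 (le_antisymm (h ▸ h2) h1)).resolve_right hp.ne',
      (mul_eq_zero.1 (le_antisymm h2 (h ▸ h1))).resolve_right hq.ne⟩
  intro j hj l hl hjl a b a' b' ha hb ha' hb' he
  rcases hjl.eq_or_lt with rfl | hjl
  · left
    obtain ⟨h1, h2⟩ := hindep j hj (a - a') (b - b') (by rw [← sub_eq_zero.2 he]; module)
    exact ⟨rfl, by linarith, by linarith⟩
  right
  by_cases h1 : j + 1 = l
  · left
    obtain ⟨f, hf0, hf1, hf2⟩ := hadj j hj
    subst h1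
    have h2 := congrArg f he
    simp only [map_add, map_smul, hf0, smul_eq_mul, mul_zero, add_zero, zero_add] at h2
    obtain ⟨rfl, rfl⟩ := hzero ha hb' hf1 hf2 h2
    rw [zero_smul, zero_smul, zero_add, add_zero] at he
    exact ⟨rfl, rfl, smul_left_injective ℝ (hne j hj) he, rfl⟩
  by_cases h2 : j = 0 ∧ l + 1 = k
  · right; left
    obtain ⟨rfl, rfl⟩ := h2
    -- The last and the first gap are consecutive too; the functional for `l = k - 1` is read modulo
    -- `k`.
    obtain ⟨f, hf0, hf1, hf2⟩ := hadj l hl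
    have e1 : u (l + 1) = u 0 := by simpa using hper 0
    have e2 : u (l + 2) = u 1 := by rw [← hper 1]; congr 1; ring
    rw [e1] at hf0 he
    rw [e2] at hf2
    have h2 := congrArg f he
    simp only [map_add, map_smul, hf0, smul_eq_mul, mul_zero, add_zero, zero_add] at h2
    obtain ⟨rfl, rfl⟩ := hzero ha' hb hf1 hf2 h2.symm
    rw [zero_smul, zero_smul, zero_add, add_zero] at he
    exact ⟨rfl, rfl, rfl, rfl, smul_left_injective ℝ (e1 ▸ hne l hl) he⟩
  · right; right
    -- On a common point the functional has both signs, so it vanishes and kills the coefficients on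
    -- the strict side; independence of the other two directions does the rest.
    obtain ⟨f, hf⟩ := hfar j hj l hl (by omega) h2
    have h3 := congrArg f he
    simp only [map_add, map_smul, smul_eq_mul] at h3
    rcases hf with ⟨p1, p2, p3, p4⟩ | ⟨p1, p2, p3, p4⟩
    · have q1 := mul_nonneg ha p1.le
      have q2 := mul_nonneg hb p2.le
      have q3 := mul_nonpos_of_nonneg_of_nonpos ha' p3
      have q4 := mul_nonpos_of_nonneg_of_nonpos hb' p4
      have ha0 : a = 0 := (mul_eq_zero.1 (show a * f (u j) = 0 by linarith)).resolve_right p1.ne'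
      have hb0 : b = 0 :=
        (mul_eq_zero.1 (show b * f (u (j + 1)) = 0 by linarith)).resolve_right p2.ne'
      rw [ha0, hb0, zero_smul, zero_smul, zero_add] at he
      exact ⟨ha0, hb0, hindep l hl a' b' he.symm⟩
    · have q1 := mul_nonneg ha p1
      have q2 := mul_nonneg hb p2
      have q3 := mul_nonpos_of_nonneg_of_nonpos ha' p3.le
      have q4 := mul_nonpos_of_nonneg_of_nonpos hb' p4.le
      have ha0 : a' = 0 := (mul_eq_zero.1 (show a' * f (u l) = 0 by linarith)).resolve_right p3.ne
      have hb0 : b' = 0 :=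
        (mul_eq_zero.1 (show b' * f (u (l + 1)) = 0 by linarith)).resolve_right p4.ne
      rw [ha0, hb0, zero_smul, zero_smul, zero_add] at he
      obtain ⟨e1, e2⟩ := hindep j hj a b he
      exact ⟨e1, e2, ha0, hb0⟩

/-- Two gaps, each less than `π`, do not add up to `2 π`. -/
lemma IsAngleFunction.three_le {d : ℕ → ℂ} {k : ℕ} {θ : ℕ → ℝ} (h : IsAngleFunction d k θ) :
    3 ≤ k := by
  have hp := Real.pi_pos
  have h1 := h.period
  by_contra! hk
  interval_cases k
  · linarith
  · have := h.lt_add_pi 0 (by norm_num)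
    norm_num at this
    linarith
  · have := h.lt_add_pi 0 (by norm_num)
    have := h.lt_add_pi 1 (by norm_num)
    norm_num at *
    linarith

namespace IsDevelopment

variable {V F : Type} {K : PolyhedralComplex V F} {P : V ⊕ F → E3} {L B : ℝ} {deg : V ⊕ F → ℕ}
  {nb : V ⊕ F → ℕ → V ⊕ F} {pos : V ⊕ F → V ⊕ F → ℂ}

lemma three_le_deg (h : IsDevelopment K P L B deg nb pos) (w : V ⊕ F) : 3 ≤ deg w := by
  obtain ⟨θ, hθ⟩ := (h.fan w).exists_angleFunction
  exact hθ.three_le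

lemma isEmbeddedCone_fan (h : IsDevelopment K P L B deg nb pos) (w : V ⊕ F) :
    IsEmbeddedCone (fun j => pos w (nb w j) - pos w w) (deg w) := by
  obtain ⟨θ, hθ⟩ := (h.fan w).exists_angleFunction
  exact hθ.isEmbeddedCone (h.fan w).periodic

/-- A coincidence with coefficients `1, 0` on both sides is possible in an embedded cone only for
equal indices. -/
lemma nb_injOn (h : IsDevelopment K P L B deg nb pos) {w : V ⊕ F} {j l : ℕ} (hj : j < deg w)
    (hl : l < deg w) (he : nb w j = nb w l) : j = l := by
  wlog hjl : j ≤ l generalizing j l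
  · exact (this hl hj he.symm (le_of_not_ge hjl)).symm
  rcases h.isEmbeddedCone_fan w j hj l hl hjl 1 0 1 0 zero_le_one le_rfl zero_le_one le_rfl
    (by simp [he]) with h1 | h1 | h1 | h1
  · exact h1.1
  all_goals norm_num at h1

/-- The sum of the two directions lies inside the gap, so it identifies the gap, and it does not
depend on their order. -/
lemma gap_injOn (h : IsDevelopment K P L B deg nb pos) {w : V ⊕ F} {j l : ℕ} (hj : j < deg w)
    (hl : l < deg w) (he : s(nb w j, nb w (j + 1)) = s(nb w l, nb w (l + 1))) : j = l := by
  wlog hjl : j ≤ l generalizing j l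
  · exact (this hl hj he.symm (le_of_not_ge hjl)).symm
  rcases h.isEmbeddedCone_fan w j hj l hl hjl 1 1 1 1 zero_le_one zero_le_one zero_le_one
    zero_le_one (by
      rcases Sym2.eq_iff.1 he with ⟨h1, h2⟩ | ⟨h1, h2⟩
      · simp only [h1, h2]
      · simp only [h1, h2]; rw [add_comm]) with h1 | h1 | h1 | h1
  · exact h1.1
  all_goals norm_num at h1

/-- The triangles at a vertex, in terms of the corners of the faces. -/
lemma isTriangle_vertex (h : IsDevelopment K P L B deg nb pos) {v : V} {a b : V ⊕ F} :
    IsTriangle nb (Sum.inl v) a b ↔ ∃ f, ∃ i : Fin (K.size f), K.vert f i = v ∧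
      (s(Sum.inl (K.prev f i), Sum.inr f) = s(a, b) ∨
        s(Sum.inr f, Sum.inl (K.next f i)) = s(a, b)) := by
  constructor
  · have key : ∀ {f b}, IsTriangle nb (Sum.inl v) (Sum.inr f) b → ∃ i : Fin (K.size f),
        K.vert f i = v ∧ (b = Sum.inl (K.prev f i) ∨ b = Sum.inl (K.next f i)) := by
      intro f b ht
      obtain ⟨i, hi⟩ := h.isTriangle_face.1 (h.rotate ht)
      rcases Sym2.eq_iff.1 hi with ⟨h1, rfl⟩ | ⟨rfl, h1⟩
      · exact ⟨i, Sum.inl_injective h1, Or.inr rfl⟩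
      · refine ⟨finRotate _ i, Sum.inl_injective h1, Or.inl ?_⟩
        rw [PolyhedralComplex.prev, Equiv.symm_apply_apply]
    intro ht
    rcases h.exists_face ht with ⟨f, h0⟩ | ⟨f, rfl⟩ | ⟨f, rfl⟩
    · cases h0
    · obtain ⟨i, hi, rfl | rfl⟩ := key ht
      · exact ⟨f, i, hi, Or.inl Sym2.eq_swap⟩
      · exact ⟨f, i, hi, Or.inr rfl⟩
    · obtain ⟨i, hi, rfl | rfl⟩ := key ht.swap
      · exact ⟨f, i, hi, Or.inl rfl⟩
      · exact ⟨f, i, hi, Or.inr Sym2.eq_swap⟩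
  · rintro ⟨f, i, rfl, hi⟩
    have h1 : IsTriangle nb (Sum.inl (K.vert f i)) (Sum.inl (K.prev f i)) (Sum.inr f) := by
      have h2 : IsTriangle nb (Sum.inr f) (Sum.inl (K.prev f i)) (Sum.inl (K.vert f i)) := by
        refine h.isTriangle_face.2 ⟨(finRotate _).symm i, ?_⟩
        rw [PolyhedralComplex.next, Equiv.apply_symm_apply]
        rfl
      exact (h.rotate h2.swap).swap
    have h2 : IsTriangle nb (Sum.inl (K.vert f i)) (Sum.inr f) (Sum.inl (K.next f i)) :=
      h.rotate (h.isTriangle_face.2 ⟨i, rfl⟩)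
    rcases hi with hi | hi
    · obtain ⟨j, hj⟩ := h1
      exact ⟨j, hj.trans hi⟩
    · obtain ⟨j, hj⟩ := h2
      exact ⟨j, hj.trans hi⟩

section Link

variable [DecidableEq V] [DecidableEq F]

lemma link_eq (h : IsDevelopment K P L B deg nb pos) (v : V) :
    K.link v = ⋃ j : ℕ, segment ℝ (bpt (nb (Sum.inl v) j)) (bpt (nb (Sum.inl v) (j + 1))) := by
  have key : ∀ {a b a' b' : V ⊕ F}, s(a, b) = s(a', b') →
      segment ℝ (bpt a) (bpt b) = segment ℝ (bpt a') (bpt b') := by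
    intro a b a' b' he
    rcases Sym2.eq_iff.1 he with ⟨rfl, rfl⟩ | ⟨rfl, rfl⟩
    · rfl
    · exact segment_symm _ _ _
  ext x
  simp only [link, mem_iUnion]
  constructor
  · rintro ⟨f, i, hi, hx | hx⟩
    · obtain ⟨j, hj⟩ := h.isTriangle_vertex.2 ⟨f, i, hi, Or.inl rfl⟩
      exact ⟨j, (key hj).symm ▸ hx⟩
    · obtain ⟨j, hj⟩ := h.isTriangle_vertex.2 ⟨f, i, hi, Or.inr rfl⟩
      exact ⟨j, (key hj).symm ▸ hx⟩
  · rintro ⟨j, hx⟩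
    obtain ⟨f, i, hi, h1 | h1⟩ := h.isTriangle_vertex.1 ⟨j, rfl⟩
    · exact ⟨f, i, hi, Or.inl (show x ∈ segment ℝ (bpt _) (bpt _) from (key h1).symm ▸ hx)⟩
    · exact ⟨f, i, hi, Or.inr (show x ∈ segment ℝ (bpt _) (bpt _) from (key h1).symm ▸ hx)⟩

lemma isConnected_link (h : IsDevelopment K P L B deg nb pos) (v : V) : IsConnected (K.link v) := by
  rw [h.link_eq]
  refine IsConnected.iUnion_of_chain (fun j => ?_) fun j => ?_
  · exact (convex_segment _ _).isConnected ⟨_, left_mem_segment _ _ _⟩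
  · exact ⟨_, right_mem_segment _ _ _, left_mem_segment _ _ _⟩

variable [Fintype V] [Fintype F]

/-- The vertex figures of a development in space are embedded. -/
theorem hasEmbeddedVertexFigure (h : IsDevelopment K P L B deg nb pos) (v : V) :
    HasEmbeddedVertexFigure K (P ∘ Sum.inl) (P ∘ Sum.inr) v := by
  set w : V ⊕ F := Sum.inl v
  have rep : ∀ x ∈ K.link v, ∃ j < deg w, ∃ s t : ℝ, 0 ≤ s ∧ 0 ≤ t ∧ s + t = 1 ∧
      x = s • bpt (nb w j) + t • bpt (nb w (j + 1)) := by
    intro x hx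
    rw [h.link_eq, mem_iUnion] at hx
    obtain ⟨j, s, t, hs, ht, hst, rfl⟩ := hx
    obtain ⟨l, hl, he⟩ := h.exists_index ⟨j, rfl⟩
    rcases Sym2.eq_iff.1 he with ⟨h1, h2⟩ | ⟨h1, h2⟩
    · exact ⟨l, hl, s, t, hs, ht, hst, by rw [h1, h2]⟩
    · exact ⟨l, hl, t, s, ht, hs, by linarith, by rw [h1, h2, add_comm]⟩
  have eval : ∀ (j : ℕ) (s t : ℝ), s + t = 1 →
      plMap (P ∘ Sum.inl) (P ∘ Sum.inr) (s • bpt (nb w j) + t • bpt (nb w (j + 1))) -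
        (P ∘ Sum.inl) v = s • (P (nb w j) - P w) + t • (P (nb w (j + 1)) - P w) := by
    intro j s t hst
    obtain rfl : s = 1 - t := by linarith
    rw [plMap_eq]
    simp only [map_add, map_smul, linearCombination_bpt, Function.comp_apply, w]
    module
  have hne : ∀ x ∈ K.link v, plMap (P ∘ Sum.inl) (P ∘ Sum.inr) x ≠ (P ∘ Sum.inl) v := by
    intro x hx h0
    obtain ⟨j, hj, s, t, hs, ht, hst, rfl⟩ := rep x hx
    rw [← sub_eq_zero, eval j s t hst] at h0
    rcases h.cone w j hj j hj le_rfl s t 0 0 hs ht le_rfl le_rfl (by simpa using h0) with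
      h1 | h1 | h1 | h1
    · linarith [h1.2.1, h1.2.2]
    · linarith [h1.2.1, h1.2.2.1]
    · linarith [h1.2.2.1, h1.2.2.2.2]
    · linarith [h1.1, h1.2.1]
  refine ⟨hne, fun x hx y hy hxy => ?_⟩
  have hx0 := inv_pos.2 (norm_pos_iff.2 (sub_ne_zero.2 (hne x hx)))
  have hy0 := inv_pos.2 (norm_pos_iff.2 (sub_ne_zero.2 (hne y hy)))
  rw [vertexFigure, vertexFigure] at hxy
  set ρ := ‖plMap (P ∘ Sum.inl) (P ∘ Sum.inr) x - (P ∘ Sum.inl) v‖⁻¹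
  set ρ' := ‖plMap (P ∘ Sum.inl) (P ∘ Sum.inr) y - (P ∘ Sum.inl) v‖⁻¹
  obtain ⟨j, hj, s, t, hs, ht, hst, rfl⟩ := rep x hx
  obtain ⟨l, hl, s', t', hs', ht', hst', rfl⟩ := rep y hy
  rw [eval j s t hst, eval l s' t' hst'] at hxy
  -- Equal directions are a coincidence in the embedded cone. In the realization it reads `ρ • x =
  -- ρ' • y`, and since the coordinates of a point of the link add up to one, `ρ = ρ'`.
  have h1 := (h.cone w).eq (g := fun j => bpt (nb w j))
    (by simpa using congrArg bpt (h.periodic w 0)) hj hl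
    (mul_nonneg hx0.le hs) (mul_nonneg hx0.le ht) (mul_nonneg hy0.le hs') (mul_nonneg hy0.le ht')
    (by simpa only [smul_add, smul_smul] using hxy)
  have h2 : ρ = ρ' := by
    have := congrArg (fun x : V ⊕ F → ℝ => ∑ e, x e) h1
    simp only [bpt, Pi.add_apply, Pi.smul_apply, smul_eq_mul, Finset.sum_add_distrib,
      ← Finset.mul_sum, Finset.sum_pi_single', Finset.mem_univ, if_true, mul_one] at this
    rw [← mul_add, ← mul_add, hst, hst', mul_one, mul_one] at this
    exact this
  rw [h2] at h1
  simp only [mul_smul, ← smul_add] at h1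
  exact smul_right_injective _ hy0.ne' h1

end Link

end IsDevelopment

end FlatKlein

/-! ### Angle sums, edges, and planarity of the faces. -/

namespace FlatKlein

open PolyhedralComplex

/-- This makes the two neighbours of a vertex in a face distinct, and prevents a face from running
back along an edge. -/
lemma finRotate_finRotate_ne {m : ℕ} (hm : 3 ≤ m) (i : Fin m) :
    finRotate m (finRotate m i) ≠ i := by
  obtain ⟨n, rfl⟩ : ∃ n, m = n + 3 := ⟨m - 3, by omega⟩
  intro he
  have h2 := congrArg Fin.val he
  have hi := i.2
  simp only [finRotate_apply, Fin.val_add, Fin.val_one] at h2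
  rcases (show i + 2 < n + 3 ∨ (i : ℕ) + 2 = n + 3 ∨ (i : ℕ) + 1 = n + 3 by omega) with h3 | h3 | h3
  · rw [Nat.mod_eq_of_lt (show (i : ℕ) + 1 < n + 3 by omega), Nat.mod_eq_of_lt h3] at h2
    omega
  · rw [Nat.mod_eq_of_lt (show (i : ℕ) + 1 < n + 3 by omega), h3, Nat.mod_self] at h2
    omega
  · rw [h3, Nat.mod_self, Nat.mod_eq_of_lt (by omega)] at h2
    omega

namespace IsDevelopment

variable {V F : Type} {K : PolyhedralComplex V F} {P : V ⊕ F → E3} {L B : ℝ} {deg : V ⊕ F → ℕ}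
  {nb : V ⊕ F → ℕ → V ⊕ F} {pos : V ⊕ F → V ⊕ F → ℂ}

lemma norm_of_isTriangle (h : IsDevelopment K P L B deg nb pos) {w a b : V ⊕ F}
    (ht : IsTriangle nb w a b) : ‖P a - P w‖ = ‖pos w a - pos w w‖ := by
  obtain ⟨j, hj⟩ := ht
  rcases Sym2.eq_iff.1 hj with ⟨rfl, rfl⟩ | ⟨rfl, rfl⟩ <;> exact h.norm_eq _ _

/-- The triangles in space are congruent to those in the charts. -/
lemma angle_of_isTriangle (h : IsDevelopment K P L B deg nb pos) {w a b : V ⊕ F}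
    (ht : IsTriangle nb w a b) : InnerProductGeometry.angle (P a - P w) (P b - P w) =
      InnerProductGeometry.angle (pos w a - pos w w) (pos w b - pos w w) := by
  have h1 := h.norm_of_isTriangle ht
  have h2 := h.norm_of_isTriangle ht.swap
  have h3 : ‖(P a - P w) - (P b - P w)‖ = ‖(pos w a - pos w w) - (pos w b - pos w w)‖ := by
    rw [sub_sub_sub_cancel_right, sub_sub_sub_cancel_right, norm_sub_rev,
      h.norm_of_isTriangle (h.rotate ht).swap]
    obtain ⟨m, n, -, e1, e2⟩ := h.chart ht
    rw [e1, e2, norm_glide_sub_glide, norm_sub_rev]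
  have h4 := norm_sub_sq_real (P a - P w) (P b - P w)
  have h5 := norm_sub_sq_real (pos w a - pos w w) (pos w b - pos w w)
  rw [h3, h5, h1, h2] at h4
  rw [InnerProductGeometry.angle, InnerProductGeometry.angle, h1, h2]
  congr 2
  linarith

lemma prev_ne_next (K : PolyhedralComplex V F) (f : F) (i : Fin (K.size f)) :
    K.prev f i ≠ K.next f i := by
  intro he
  have h1 := K.vert_injective f he
  rw [Equiv.symm_apply_eq] at h1
  exact finRotate_finRotate_ne (K.three_le_size f) i h1.symm

/-- The angles of the faces at a vertex add up to `2 π`. -/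
theorem angleSum_eq [Fintype V] [Fintype F] [DecidableEq V] (h : IsDevelopment K P L B deg nb pos)
    (v : V) : K.angleSum (P ∘ Sum.inl) (P ∘ Sum.inr) v = 2 * Real.pi := by
  set w : V ⊕ F := Sum.inl v with hw
  -- the neighbours of `v` in the two triangles at a corner
  let pair : (Σ f, Fin (K.size f)) × Bool → Sym2 (V ⊕ F) := fun s =>
    if s.2 then s(Sum.inl (K.prev s.1.1 s.1.2), Sum.inr s.1.1)
    else s(Sum.inr s.1.1, Sum.inl (K.next s.1.1 s.1.2))
  let α : (Σ f, Fin (K.size f)) × Bool → ℝ := fun s =>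
    if s.2 then InnerProductGeometry.angle (P (Sum.inl (K.prev s.1.1 s.1.2)) - P w)
      (P (Sum.inr s.1.1) - P w)
    else InnerProductGeometry.angle (P (Sum.inr s.1.1) - P w)
      (P (Sum.inl (K.next s.1.1 s.1.2)) - P w)
  let S : Finset ((Σ f, Fin (K.size f)) × Bool) :=
    (Finset.univ.filter fun s => K.vert s.1 s.2 = v) ×ˢ Finset.univ
  have hS : ∀ s, s ∈ S ↔ K.vert s.1.1 s.1.2 = v := by simp [S]
  have hsum : K.angleSum (P ∘ Sum.inl) (P ∘ Sum.inr) v = ∑ s ∈ S, α s := by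
    have h1 := Finset.sum_sigma (Finset.univ : Finset F) (fun f => (Finset.univ : Finset (Fin (K.size f))))
      (fun s : Σ f, Fin (K.size f) =>
        if K.vert s.1 s.2 = v then K.faceAngle (P ∘ Sum.inl) (P ∘ Sum.inr) s.1 s.2 else 0)
    rw [angleSum, ← h1, Finset.univ_sigma_univ, ← Finset.sum_filter, Finset.sum_product]
    refine Finset.sum_congr rfl fun s hs => ?_
    rw [Finset.mem_filter] at hs
    rw [Fintype.sum_bool, faceAngle, EuclideanGeometry.angle, EuclideanGeometry.angle, hs.2]
    rfl
  obtain ⟨θ, hθ⟩ := (h.fan w).exists_angleFunction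
  rw [hsum, ← hθ.sum_angle]
  have htri : ∀ s ∈ S, ∃ j < deg w, s(nb w j, nb w (j + 1)) = pair s := by
    rintro ⟨⟨f, i⟩, ε⟩ hs
    have hi := (hS _).1 hs
    cases ε
    · exact h.exists_index (h.isTriangle_vertex.2 ⟨f, i, hi, Or.inr rfl⟩)
    · exact h.exists_index (h.isTriangle_vertex.2 ⟨f, i, hi, Or.inl rfl⟩)
  choose! J hJ hJp using htri
  -- Each half of a face corner at `v` fills exactly one gap of the star. The two halves of one
  -- corner fill different gaps because the previous and the next vertex differ.
  refine Finset.sum_bij (fun s _ => J s) (fun s hs => Finset.mem_range.2 (hJ s hs)) ?_ ?_ ?_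
  · rintro ⟨⟨f, i⟩, ε⟩ hs ⟨⟨f', i'⟩, ε'⟩ hs' he
    have h1 := (hJp _ hs).symm.trans ((congrArg (fun j => s(nb w j, nb w (j + 1))) he).trans
      (hJp _ hs'))
    have hi := (hS _).1 hs
    have hi' := (hS _).1 hs'
    have hf : f = f' := by
      cases ε <;> cases ε' <;> simp [pair] at h1 <;> tauto
    subst hf
    obtain rfl : i = i' := K.vert_injective f (hi.trans hi'.symm)
    have hne := prev_ne_next K f i
    cases ε <;> cases ε' <;> simp [pair, hne, hne.symm] at h1 <;> rfl
  · intro j hj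
    rw [Finset.mem_range] at hj
    obtain ⟨f, i, hi, h1 | h1⟩ := h.isTriangle_vertex.1 (⟨j, rfl⟩ : IsTriangle nb w _ _)
    · have hs := (hS ((⟨f, i⟩, true))).2 hi
      exact ⟨_, hs, h.gap_injOn (hJ _ hs) hj ((hJp _ hs).trans h1)⟩
    · have hs := (hS ((⟨f, i⟩, false))).2 hi
      exact ⟨_, hs, h.gap_injOn (hJ _ hs) hj ((hJp _ hs).trans h1)⟩
  · intro s hs
    rw [← h.angle_of_isTriangle ⟨J s, rfl⟩]
    have h1 := hJp s hs
    obtain ⟨⟨f, i⟩, ε⟩ := s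
    cases ε <;> rcases Sym2.eq_iff.1 h1 with ⟨h1, h2⟩ | ⟨h1, h2⟩ <;> rw [h1, h2]
    · rfl
    · exact InnerProductGeometry.angle_comm _ _
    · rfl
    · exact InnerProductGeometry.angle_comm _ _

/-- Every edge of a developed complex belongs to exactly two faces. -/
theorem card_side_eq [Fintype F] [DecidableEq V] [DecidableEq F]
    (h : IsDevelopment K P L B deg nb pos) {e : Sym2 V} (he : e ∈ K.edges) :
    (Finset.univ.filter fun s => K.side s = e).card = 2 := by
  obtain ⟨⟨f, i⟩, -, rfl⟩ := Finset.mem_image.1 he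
  set v := K.vert f i with hv
  set u := K.next f i with hu
  have hside : ∀ s, K.side s = K.side ⟨f, i⟩ →
      IsTriangle nb (Sum.inl v) (Sum.inl u) (Sum.inr s.1) := by
    intro s hs
    refine (h.rotate (h.isTriangle_face.2 ⟨s.2, ?_⟩)).swap
    exact congrArg (Sym2.map Sum.inl) hs
  have hinj : Set.InjOn (fun s : Σ f, Fin (K.size f) => s.1)
      (Finset.univ.filter fun s => K.side s = K.side ⟨f, i⟩ : Finset _) := by
    rintro ⟨g, a⟩ ha ⟨g', b⟩ hb hg
    obtain rfl : g = g' := hg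
    rw [Finset.mem_coe, Finset.mem_filter] at ha hb
    rcases Sym2.eq_iff.1 (ha.2.trans hb.2.symm) with ⟨h1, -⟩ | ⟨h1, h2⟩
    · obtain rfl : a = b := K.vert_injective g h1
      rfl
    · have h3 : a = finRotate _ b := K.vert_injective g h1
      have h4 : finRotate _ a = b := K.vert_injective g h2
      exact absurd (h3 ▸ h4) (finRotate_finRotate_ne (K.three_le_size g) b)
  set w : V ⊕ F := Sum.inl v
  have hdeg := h.three_le_deg w
  -- The faces along the edge are the two neighbours of `u` in the cyclic star of `v`, at the
  -- positions `j + 1` and `j - 1`; the latter is written `j + (deg w - 1)`.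
  obtain ⟨j, hj, hju⟩ : ∃ j < deg w, nb w j = Sum.inl u := by
    obtain ⟨j, hj⟩ := hside ⟨f, i⟩ rfl
    rcases Sym2.eq_iff.1 hj with ⟨h1, -⟩ | ⟨-, h1⟩
    · exact ⟨j % deg w, Nat.mod_lt _ (by omega), by rw [(h.periodic w).map_mod_nat, h1]⟩
    · exact ⟨(j + 1) % deg w, Nat.mod_lt _ (by omega), by rw [(h.periodic w).map_mod_nat, h1]⟩
  have hnext : IsTriangle nb w (Sum.inl u) (nb w (j + 1)) := ⟨j, by rw [hju]⟩
  have hprev : IsTriangle nb w (Sum.inl u) (nb w (j + (deg w - 1))) := by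
    refine ⟨j + (deg w - 1), ?_⟩
    rw [show j + (deg w - 1) + 1 = j + deg w by omega, h.periodic w, hju]
    exact Sym2.eq_swap
  have hface : ∀ {x}, IsTriangle nb w (Sum.inl u) x → ∃ g, x = Sum.inr g := by
    intro x hx
    rcases h.exists_face hx with ⟨g, hg⟩ | ⟨g, hg⟩ | hg
    · exact absurd hg Sum.inl_ne_inr
    · exact absurd hg Sum.inl_ne_inr
    · exact hg
  obtain ⟨g₁, hg₁⟩ := hface hnext
  obtain ⟨g₂, hg₂⟩ := hface hprev
  -- Equality would give `1 ≡ deg w - 1` modulo `deg w`, which is impossible for a degree of at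
  -- least three.
  have hne : g₁ ≠ g₂ := by
    rintro rfl
    have h1 := hg₁.trans hg₂.symm
    rw [← (h.periodic w).map_mod_nat, ← (h.periodic w).map_mod_nat (j + (deg w - 1))] at h1
    have h2 := h.nb_injOn (Nat.mod_lt _ (by omega)) (Nat.mod_lt _ (by omega)) h1
    have h3 : j + 1 ≡ j + (deg w - 1) [MOD deg w] := h2
    have h4 := (Nat.ModEq.add_left_cancel' j h3)
    rw [Nat.ModEq, Nat.mod_eq_of_lt (by omega), Nat.mod_eq_of_lt (by omega)] at h4
    omega
  have himage : (Finset.univ.filter fun s => K.side s = K.side ⟨f, i⟩).image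
      (fun s : Σ f, Fin (K.size f) => s.1) = {g₁, g₂} := by
    ext g
    simp only [Finset.mem_image, Finset.mem_filter, Finset.mem_univ, true_and,
      Finset.mem_insert, Finset.mem_singleton]
    constructor
    · rintro ⟨s, hs, rfl⟩
      obtain ⟨l, hl, hlp⟩ := h.exists_index (hside s hs)
      rcases Sym2.eq_iff.1 hlp with ⟨h1, h2⟩ | ⟨h1, h2⟩
      · obtain rfl := h.nb_injOn hl hj (h1.trans hju.symm)
        exact Or.inl (Sum.inr_injective (h2.symm.trans hg₁))
      · right
        apply Sum.inr_injective (α := V)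
        rw [← h1, ← hg₂]
        by_cases hl' : l + 1 < deg w
        · obtain rfl := h.nb_injOn hl' hj (h2.trans hju.symm)
          rw [show l + 1 + (deg w - 1) = l + deg w by omega, h.periodic w]
        · have h0 : nb w (l + 1) = nb w 0 := by
            rw [show l + 1 = 0 + deg w by omega, h.periodic w]
          obtain rfl := h.nb_injOn hj (by omega) (hju.trans (h2.symm.trans h0))
          congr 1; omega
    · have key : ∀ g, IsTriangle nb w (Sum.inl u) (Sum.inr g) →
          ∃ s : Σ f, Fin (K.size f), K.side s = K.side ⟨f, i⟩ ∧ s.1 = g := by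
        intro g hg
        obtain ⟨l, hl⟩ := h.isTriangle_face.1 (h.rotate hg.swap)
        exact ⟨⟨g, l⟩, Sym2.map.injective Sum.inl_injective hl, rfl⟩
      rintro (rfl | rfl)
      · exact key _ (hg₁ ▸ hnext)
      · exact key _ (hg₂ ▸ hprev)
  rw [← Finset.card_image_of_injOn hinj, himage, Finset.card_pair hne]

/-- The number of edges of a developed complex. -/
theorem two_mul_card_edges [Fintype F] [DecidableEq V] [DecidableEq F]
    (h : IsDevelopment K P L B deg nb pos) : 2 * K.edges.card = ∑ f, K.size f := by
  have h1 := Finset.card_eq_sum_card_image K.side Finset.univ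
  change _ = ∑ e ∈ K.edges, _ at h1
  rw [Finset.sum_congr rfl fun e he => h.card_side_eq he, Finset.sum_const, smul_eq_mul,
    Finset.card_univ, Fintype.card_sigma] at h1
  simp only [Fintype.card_fin] at h1
  rw [h1, mul_comm]

variable [Fintype V] [Fintype F] [DecidableEq V] [DecidableEq F]

omit [Fintype V] in
theorem isClosedSurface (h : IsDevelopment K P L B deg nb pos) (hc : IsConnected K.space) :
    K.IsClosedSurface where
  edge_twice _ he := h.card_side_eq he
  link_connected := h.isConnected_link
  connected := hc

theorem hasPlanarFaces (h : IsDevelopment K P L B deg nb pos)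
    (hplane : ∀ f, ∃ u v : E3, ∀ j, P (nb (Sum.inr f) j) - P (Sum.inr f) ∈ Submodule.span ℝ {u, v}) :
    HasPlanarFaces K (P ∘ Sum.inl) (P ∘ Sum.inr) := by
  intro f
  have hcell : ∀ x ∈ K.cell f, ∃ a b, IsTriangle nb (Sum.inr f) a b ∧ x ∈ hull (Sum.inr f) a b :=
    fun x hx => h.mem_cell.1 hx
  constructor
  · obtain ⟨u, v, huv⟩ := hplane f
    have hmem : ∀ x ∈ K.cell f, plMap (P ∘ Sum.inl) (P ∘ Sum.inr) x - P (Sum.inr f) ∈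
        Submodule.span ℝ {u, v} := by
      intro x hx
      obtain ⟨a, b, ⟨j, hj⟩, hx⟩ := hcell x hx
      obtain ⟨s, t, -, -, -, rfl⟩ := mem_convexHull_triple.1 hx
      have hab : P a - P (Sum.inr f) ∈ Submodule.span ℝ {u, v} ∧
          P b - P (Sum.inr f) ∈ Submodule.span ℝ {u, v} := by
        rcases Sym2.eq_iff.1 hj with ⟨rfl, rfl⟩ | ⟨rfl, rfl⟩
        · exact ⟨huv _, huv _⟩
        · exact ⟨huv _, huv _⟩
      rw [plMap_eq]
      simp only [map_add, map_smul, map_sub, linearCombination_bpt]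
      rw [add_assoc, add_sub_cancel_left]
      exact Submodule.add_mem _ (Submodule.smul_mem _ _ hab.1) (Submodule.smul_mem _ _ hab.2)
    have hspan : vectorSpan ℝ (plMap (P ∘ Sum.inl) (P ∘ Sum.inr) '' K.cell f) ≤
        Submodule.span ℝ {u, v} := by
      rw [vectorSpan_def, Submodule.span_le]
      rintro _ ⟨_, ⟨x, hx, rfl⟩, _, ⟨y, hy, rfl⟩, rfl⟩
      simpa using Submodule.sub_mem _ (hmem x hx) (hmem y hy)
    refine (Submodule.rank_mono hspan).trans ?_
    have := rank_span_finset_le (R := ℝ) ({u, v} : Finset E3)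
    rw [Finset.coe_pair] at this
    exact this.trans (by exact_mod_cast Finset.card_le_two)
  · intro x hx y hy hxy
    rw [plMap_eq, plMap_eq] at hxy
    exact h.injOn_plMap (Sum.inr f) (hcell x hx) (hcell y hy) hxy

end IsDevelopment

end FlatKlein

/-! ### Torsion in the first homology group. -/

namespace FlatKlein

open PolyhedralComplex

section Homology

variable {V F : Type} (K : PolyhedralComplex V F) [Fintype V] [Fintype F] [DecidableEq V]

/-- The pairing of a 1-chain with a cochain. -/
def pairing (ψ : V → V → ℤ) : (V → V → ℤ) →+ ℤ where
  toFun c := ∑ u, ∑ v, ψ u v * c u v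
  map_zero' := by simp
  map_add' a b := by simp [mul_add, Finset.sum_add_distrib]

/-- The value of a cochain on the boundary of a face. -/
def faceValue (ψ : V → V → ℤ) (f : F) : ℤ :=
  ∑ i, (ψ (K.vert f i) (K.next f i) - ψ (K.next f i) (K.vert f i))

lemma sum_sum_ite_and (ψ : V → V → ℤ) (x y : V) :
    ∑ u, ∑ v, ψ u v * (if x = u ∧ y = v then 1 else 0) = ψ x y := by
  simp [ite_and]

/-- A 1-chain records each edge in both directions with opposite signs; this is why `faceValue`
antisymmetrizes `ψ`. -/
lemma pairing_boundary₂ (ψ : V → V → ℤ) (a : F → ℤ) :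
    pairing ψ (K.boundary₂ a) = ∑ f, a f * faceValue K ψ f := by
  change ∑ u, ∑ v, ψ u v * ∑ f, a f * ∑ i : Fin (K.size f), _ = _
  simp only [Finset.mul_sum]
  rw [Finset.sum_congr rfl fun u _ => Finset.sum_comm, Finset.sum_comm]
  refine Finset.sum_congr rfl fun f _ => ?_
  rw [faceValue, Finset.mul_sum, Finset.sum_congr rfl fun u _ => Finset.sum_comm, Finset.sum_comm]
  refine Finset.sum_congr rfl fun i _ => ?_
  have h1 := sum_sum_ite_and ψ (K.vert f i) (K.next f i)
  have h2 := sum_sum_ite_and ψ (K.next f i) (K.vert f i)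
  rw [← h1, ← h2, ← Finset.sum_sub_distrib, Finset.mul_sum]
  refine Finset.sum_congr rfl fun u _ => ?_
  rw [← Finset.sum_sub_distrib, Finset.mul_sum]
  refine Finset.sum_congr rfl fun v _ => ?_
  simp only [and_comm (a := K.vert f i = v)]
  ring

lemma boundary₁_boundary₂ (a : F → ℤ) : boundary₁ (K.boundary₂ a) = 0 := by
  ext v
  change ∑ u, ∑ f, a f * ∑ i : Fin (K.size f), _ = (0 : ℤ)
  rw [Finset.sum_comm]
  refine Finset.sum_eq_zero fun f _ => ?_
  rw [← Finset.mul_sum, Finset.sum_comm]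
  have h1 : ∀ i : Fin (K.size f), ∑ u, ((if K.vert f i = u ∧ K.next f i = v then (1 : ℤ) else 0) -
      (if K.vert f i = v ∧ K.next f i = u then 1 else 0)) =
      (if K.next f i = v then 1 else 0) - (if K.vert f i = v then 1 else 0) := by
    intro i
    simp [ite_and, Finset.sum_sub_distrib]
  rw [Finset.sum_congr rfl fun i _ => h1 i, Finset.sum_sub_distrib]
  have h2 := Equiv.sum_comp (finRotate (K.size f)) fun i => if K.vert f i = v then (1 : ℤ) else 0
  rw [show ∑ i, (if K.next f i = v then (1 : ℤ) else 0) = _ from h2, sub_self, mul_zero]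

omit [Fintype V] in
lemma boundary₂_antisymm (a : F → ℤ) (u v : V) : K.boundary₂ a u v = -K.boundary₂ a v u := by
  change ∑ f, a f * ∑ i : Fin (K.size f), _ = -∑ f, a f * ∑ i : Fin (K.size f), _
  rw [← Finset.sum_neg_distrib]
  refine Finset.sum_congr rfl fun f _ => ?_
  rw [← mul_neg, ← Finset.sum_neg_distrib]
  congr 1
  exact Finset.sum_congr rfl fun i _ => by ring

omit [Fintype V] in
lemma boundary₂_eq_zero (a : F → ℤ) {u v : V} (h : s(u, v) ∉ K.edges) : K.boundary₂ a u v = 0 := by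
  change ∑ f, a f * ∑ i : Fin (K.size f), _ = (0 : ℤ)
  refine Finset.sum_eq_zero fun f _ => ?_
  rw [Finset.sum_eq_zero, mul_zero]
  intro i _
  have h1 : K.side ⟨f, i⟩ ≠ s(u, v) := fun he =>
    h (he ▸ Finset.mem_image_of_mem _ (Finset.mem_univ _))
  rw [if_neg, if_neg, sub_self]
  · rintro ⟨e1, e2⟩
    exact h1 (Sym2.eq_iff.2 (Or.inr ⟨e1, e2⟩))
  · rintro ⟨e1, e2⟩
    exact h1 (Sym2.eq_iff.2 (Or.inl ⟨e1, e2⟩))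

-- However the faces are oriented, the coefficient of an edge is a sum of two signs: the number of
-- sides along it, which is two, minus twice the number of reversed ones.
omit [Fintype V] in
lemma two_dvd_boundary₂_one
    (htwice : ∀ e ∈ K.edges, (Finset.univ.filter fun s => K.side s = e).card = 2) (u v : V) :
    2 ∣ K.boundary₂ (fun _ => 1) u v := by
  by_cases he : s(u, v) ∈ K.edges
  · by_cases huv : u = v
    · subst huv
      have := boundary₂_antisymm K (fun _ => 1) u u
      rw [show K.boundary₂ (fun _ => 1) u u = 0 by omega]
      exact dvd_zero 2
    have h1 : K.boundary₂ (fun _ => 1) u v = ∑ s : Σ f, Fin (K.size f),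
        ((if K.side s = s(u, v) then 1 else 0) -
          2 * (if K.vert s.1 s.2 = v ∧ K.next s.1 s.2 = u then 1 else 0)) := by
      change ∑ f, 1 * ∑ i : Fin (K.size f), _ = _
      rw [Fintype.sum_sigma]
      refine Finset.sum_congr rfl fun f _ => ?_
      rw [one_mul]
      refine Finset.sum_congr rfl fun i _ => ?_
      simp only [side, Sym2.eq_iff]
      by_cases h1 : K.vert f i = u ∧ K.next f i = v <;>
        by_cases h2 : K.vert f i = v ∧ K.next f i = u <;> simp only [h1, h2]
      · exact absurd (h1.1.symm.trans h2.1) huv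
      all_goals simp
      all_goals simp [huv, Ne.symm huv]
    rw [h1, Finset.sum_sub_distrib, ← Finset.mul_sum, Finset.sum_boole, htwice _ he]
    exact dvd_sub (by norm_num) (dvd_mul_right _ _)
  · rw [boundary₂_eq_zero K _ he]
    exact dvd_zero 2

/-- Half of the boundary of the sum of all faces is a torsion class; it is detected by a cochain
that is even on all faces, but whose sum over all faces is not divisible by four. -/
theorem exists_torsion
    (htwice : ∀ e ∈ K.edges, (Finset.univ.filter fun s => K.side s = e).card = 2) (ψ : V → V → ℤ)
    (heven : ∀ f, 2 ∣ faceValue K ψ f) (hodd : ¬ 4 ∣ ∑ f, faceValue K ψ f) :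
    ∃ z : K.H₁, z ≠ 0 ∧ IsOfFinAddOrder z := by
  let z : V → V → ℤ := fun u v => K.boundary₂ (fun _ => 1) u v / 2
  have hz : 2 • z = K.boundary₂ (fun _ => 1) := by
    ext u v
    have := Int.mul_ediv_cancel' (two_dvd_boundary₂_one K htwice u v)
    simpa [z] using this
  have hz' : ∀ u v, 2 * z u v = K.boundary₂ (fun _ => 1) u v := fun u v => by
    rw [← hz]; simp
  have hmem : z ∈ K.cycles₁ := by
    refine ⟨⟨fun u v => ?_, fun u v h => ?_⟩, ?_⟩
    · have h1 := hz' u v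
      have h2 := hz' v u
      rw [boundary₂_antisymm] at h1
      omega
    · have h1 := hz' u v
      rw [boundary₂_eq_zero K _ h] at h1
      omega
    · change boundary₁ z = 0
      have h1 := boundary₁_boundary₂ K (fun _ => 1)
      rw [← hz, map_nsmul] at h1
      exact (smul_eq_zero.1 h1).resolve_left two_ne_zero
  refine ⟨QuotientAddGroup.mk ⟨z, hmem⟩, ?_, ?_⟩
  · rw [Ne, QuotientAddGroup.eq_zero_iff]
    rintro ⟨a, ha⟩
    have ha' : K.boundary₂ a = z := ha
    -- If `z` bounded `a`, the pairing of `2 z` with `ψ` would be twice a combination of even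
    -- numbers, and also the sum of `ψ` over all faces.
    have h1 := congrArg (pairing ψ) hz
    rw [← ha', map_nsmul, pairing_boundary₂, pairing_boundary₂] at h1
    apply hodd
    simp only [one_mul] at h1
    rw [← h1]
    obtain ⟨k, hk⟩ : 2 ∣ ∑ f, a f * faceValue K ψ f :=
      Finset.dvd_sum fun f _ => dvd_mul_of_dvd_right (heven f) _
    rw [hk]
    exact ⟨k, by simp; ring⟩
  · rw [isOfFinAddOrder_iff_nsmul_eq_zero]
    refine ⟨2, two_pos, ?_⟩
    rw [← QuotientAddGroup.mk_nsmul, QuotientAddGroup.eq_zero_iff]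
    exact ⟨fun _ => 1, hz.symm⟩

end Homology

end FlatKlein

/-! ### The data: positions, faces and stars. -/

namespace FlatKlein

/-- The eighteen vertices of the coarse triangulation: three coordinates in space, then two in the
plane. -/
def coarseTable : List (List ℤ) :=
  -- The rows `i`, `i + 3`, `i + 6` form orbits of a symmetry of order three: a cyclic permutation
  -- of the space coordinates goes with a reflection of the strip and a shift by a third of
  -- `coarseHeight`.
  [[4159553175142184194389035, 4159553175142184194389035, 25551540933016274336961215,
   -30305315990321627701977255, -3565331292979015023762030], [-5347996939468522535643045,
   -19609322111384582630691165, 12478659525426552583167105, -1782665646489507511881015, 0],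
   [19822062761856257984458615, -21636039791916670830306590, -5120295002895426689637350,
   28007148815122416647406330, 7741423948959056471173935], [25551540933016274336961215,
   4159553175142184194389035, 4159553175142184194389035, 30305315990321627701977255,
   35653312929790150237620300], [12478659525426552583167105, -5347996939468522535643045,
   -19609322111384582630691165, 1782665646489507511881015, 39218644222769165261382330],
   [-5120295002895426689637350, 19822062761856257984458615, -21636039791916670830306590,
   -28007148815122416647406330, 46960068171728221732556265], [4159553175142184194389035,
   25551540933016274336961215, 4159553175142184194389035, -30305315990321627701977255,
   74871957152559315499002630], [-19609322111384582630691165, 12478659525426552583167105,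
   -5347996939468522535643045, -1782665646489507511881015, 78437288445538330522764660],
   [-21636039791916670830306590, -5120295002895426689637350, 19822062761856257984458615,
   28007148815122416647406330, 86178712394497386993938595], [370186724243718638049373,
   1313562984393645582412187, -17756151624611036420344653, -11748221246027348201536921,
   35851028604686387312921566], [17483843481508511754691035, -19973923709336762509916565,
   6375674834262474864585765, 17637410034317988959402925, 13473416568431423175519720],
   [23410060237852763319578215, 1127327984273689237004335, -10253780401531661568270215,
   42152514370142784874107555, 26643961981051828450831050], [-17756151624611036420344653,
   370186724243718638049373, 1313562984393645582412187, 11748221246027348201536921,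
   75069672827455552574303896], [6375674834262474864585765, 17483843481508511754691035,
   -19973923709336762509916565, -17637410034317988959402925, 52692060791200588436902050],
   [-10253780401531661568270215, 23410060237852763319578215, 1127327984273689237004335,
   -42152514370142784874107555, 65862606203820993712213380], [1313562984393645582412187,
   -17756151624611036420344653, 370186724243718638049373, -11748221246027348201536921,
   114288317050224717835686226], [-19973923709336762509916565, 6375674834262474864585765,
   17483843481508511754691035, 17637410034317988959402925, 91910705013969753698284380],
   [1127327984273689237004335, -10253780401531661568270215, 23410060237852763319578215,
   42152514370142784874107555, 105081250426590158973595710]]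

/-- The triangles of the coarse triangulation, by the codes of their corners. -/
def coarseTriangles : List (List ℕ) :=
  [[4, 85, 49], [49, 85, 40], [40, 85, 13], [13, 85, 4], [13, 94, 40], [40, 94, 31], [31, 94, 22],
   [22, 94, 13], [22, 103, 31], [31, 103, 52], [52, 103, 7], [7, 103, 22], [49, 121, 58], [58,
   121, 67], [67, 121, 40], [40, 121, 49], [40, 112, 67], [67, 112, 76], [76, 112, 31], [31, 112,
   40], [31, 133, 76], [76, 133, 61], [61, 133, 52], [52, 133, 31], [58, 139, 23], [23, 139, 14],
   [14, 139, 67], [67, 139, 58], [67, 148, 14], [14, 148, 5], [5, 148, 76], [76, 148, 67], [76,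
   157, 5], [5, 157, 26], [26, 157, 61], [61, 157, 76]]

/-- The vertices inside the coarse triangles: `6 t + k` is the `k`-th vertex inside the triangle `t`. -/
def innerTable : List ℕ :=
  [0, 1, 2, 3, 4, 6, 7, 8, 9, 10, 12, 13, 14, 15, 16, 18, 19, 20, 21, 22, 23, 24, 25, 26, 27, 28,
   30, 31, 32, 33, 34, 36, 37, 38, 39, 40, 41, 42, 43, 44, 45, 46, 48, 49, 50, 51, 52, 54, 55, 56,
   57, 58, 59, 60, 61, 62, 63, 64, 66, 67, 68, 69, 70, 71, 72, 73, 74, 75, 76, 77, 78, 79, 80, 81,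
   82, 84, 85, 86, 87, 88, 90, 91, 92, 93, 94, 96, 97, 98, 99, 100, 102, 103, 104, 105, 106, 108,
   109, 110, 111, 112, 114, 115, 116, 117, 118, 119, 120, 121, 122, 123, 124, 126, 127, 128, 129,
   130, 131, 132, 133, 134, 135, 136, 138, 139, 140, 141, 142, 143, 144, 145, 146, 147, 148, 150,
   151, 152, 153, 154, 156, 157, 158, 159, 160, 162, 163, 164, 165, 166, 167, 168, 169, 170, 171,
   172, 174, 175, 176, 177, 178, 180, 181, 182, 183, 184, 185, 186, 187, 188, 189, 190, 192, 193,
   194, 195, 196, 198, 199, 200, 201, 202, 203, 204, 205, 206, 207, 208, 210, 211, 212, 213, 214,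
   215]

/-- The faces, by the codes of their vertices. -/
def faceTable : List (List ℕ) :=
  [[184, 175, 85, 49], [166, 4, 85, 175], [4, 166, 193, 184, 49], [166, 175, 202], [193, 202,
   184], [166, 202, 193], [202, 175, 184], [220, 85, 40, 229], [85, 220, 211, 49], [238, 229, 40,
   49, 211], [220, 247, 211], [247, 229, 238], [247, 238, 211], [220, 229, 247], [13, 274, 265,
   85], [265, 256, 40, 85], [274, 13, 40, 256, 283], [292, 256, 265], [274, 283, 292], [292, 283,
   256], [274, 292, 265], [4, 319, 310, 85], [13, 85, 310], [301, 13, 310], [4, 13, 301, 328,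
   319], [337, 301, 310], [319, 328, 337], [328, 301, 337], [346, 337, 310], [319, 337, 346],
   [319, 346, 310], [364, 94, 40, 373], [355, 13, 94, 364], [13, 355, 382, 373, 40], [355, 364,
   391], [382, 391, 373], [355, 391, 382], [391, 364, 373], [409, 94, 31, 418], [94, 409, 400,
   40], [400, 427, 418, 31, 40], [409, 436, 400], [436, 418, 427], [436, 427, 400], [409, 418,
   436], [22, 463, 454, 94], [94, 454, 31], [454, 445, 31], [472, 22, 31], [445, 472, 31], [463,
   22, 472], [454, 481, 445], [463, 472, 481], [481, 472, 445], [454, 490, 481], [463, 481, 490],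
   [463, 490, 454], [13, 517, 508, 94], [499, 22, 94, 508], [517, 13, 22, 499, 526], [535, 499,
   508], [517, 526, 535], [526, 499, 535], [517, 535, 508], [553, 103, 31, 562], [544, 22, 103,
   553], [22, 544, 571, 562, 31], [544, 553, 580], [571, 580, 562], [544, 580, 571], [580, 553,
   562], [598, 103, 52, 607], [103, 598, 31], [598, 589, 31], [31, 589, 616, 607, 52], [598, 625,
   589], [616, 625, 607], [589, 625, 616], [598, 634, 625], [625, 634, 607], [634, 598, 607], [7,
   661, 652, 103], [103, 652, 643, 52], [661, 7, 52, 643, 670], [652, 679, 643], [661, 670, 679],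
   [679, 670, 643], [661, 679, 652], [22, 706, 697, 103], [7, 103, 697], [688, 7, 697], [7, 715,
   22], [7, 688, 715], [22, 715, 706], [688, 697, 724], [706, 715, 724], [688, 724, 715], [733,
   724, 697], [706, 724, 733], [706, 733, 697], [751, 121, 58, 760], [49, 121, 751], [49, 751,
   742], [49, 769, 58], [49, 742, 769], [769, 760, 58], [742, 751, 778], [769, 778, 760], [742,
   778, 769], [778, 751, 787], [778, 787, 760], [787, 751, 760], [805, 121, 67, 814], [121, 805,
   796, 58], [796, 823, 814, 67, 58], [805, 832, 796], [832, 814, 823], [832, 823, 796], [832,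
   805, 814], [40, 859, 850, 121], [121, 850, 841, 67], [868, 859, 40, 67, 841], [850, 877, 841],
   [859, 868, 877], [877, 868, 841], [859, 877, 850], [49, 904, 895, 121], [886, 40, 121, 895],
   [40, 886, 913, 904, 49], [886, 895, 922], [913, 922, 904], [886, 922, 913], [904, 922, 895],
   [949, 940, 112, 67], [931, 40, 112, 940], [40, 931, 958, 949, 67], [931, 940, 967], [958, 967,
   949], [931, 967, 958], [967, 940, 949], [985, 112, 76, 994], [112, 985, 976, 67], [67, 976,
   1003, 994, 76], [985, 1012, 976], [1003, 1012, 994], [976, 1012, 1003], [1012, 985, 994], [31,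
   1039, 1030, 112], [112, 1030, 1021, 76], [1039, 31, 76, 1021, 1048], [1030, 1057, 1021], [1039,
   1048, 1057], [1057, 1048, 1021], [1039, 1057, 1030], [40, 1084, 1075, 112], [31, 112, 1075],
   [1066, 31, 1075], [40, 31, 1066, 1093, 1084], [1066, 1075, 1102], [1084, 1093, 1102], [1093,
   1066, 1102], [1111, 1102, 1075], [1084, 1102, 1111], [1084, 1111, 1075], [1129, 133, 76, 1138],
   [1120, 31, 133, 1129], [31, 1120, 1147, 1138, 76], [1120, 1129, 1156], [1147, 1156, 1138],
   [1120, 1156, 1147], [1156, 1129, 1138], [1174, 133, 61, 1183], [133, 1174, 76], [1174, 1165,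
   76], [1192, 1183, 61, 76, 1165], [1174, 1201, 1165], [1201, 1183, 1192], [1201, 1192, 1165],
   [1174, 1210, 1201], [1210, 1183, 1201], [1174, 1183, 1210], [52, 1237, 1228, 133], [133, 1228,
   1219, 61], [1237, 52, 61, 1219, 1246], [1228, 1255, 1219], [1237, 1246, 1255], [1255, 1246,
   1219], [1237, 1255, 1228], [31, 1282, 1273, 133], [52, 133, 1273], [1264, 52, 1273], [31, 52,
   1291], [1291, 52, 1264], [31, 1291, 1282], [1300, 1264, 1273], [1282, 1291, 1300], [1291, 1264,
   1300], [1309, 1300, 1273], [1282, 1300, 1309], [1282, 1309, 1273], [1336, 1327, 139, 23],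
   [1318, 58, 139, 1327], [58, 1318, 1345, 1336, 23], [1318, 1327, 1354], [1345, 1354, 1336],
   [1318, 1354, 1345], [1354, 1327, 1336], [1372, 139, 14, 1381], [139, 1372, 1363, 23], [1390,
   1381, 14, 23, 1363], [1372, 1399, 1363], [1399, 1381, 1390], [1399, 1390, 1363], [1372, 1381,
   1399], [67, 1426, 1417, 139], [1417, 1408, 14, 139], [1426, 67, 14, 1408, 1435], [1444, 1408,
   1417], [1426, 1435, 1444], [1444, 1435, 1408], [1426, 1444, 1417], [58, 1471, 1462, 139], [67,
   139, 1462], [1453, 67, 1462], [58, 67, 1453, 1480, 1471], [1489, 1453, 1462], [1471, 1480,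
   1489], [1480, 1453, 1489], [1498, 1489, 1462], [1471, 1489, 1498], [1471, 1498, 1462], [1516,
   148, 14, 1525], [1507, 67, 148, 1516], [67, 1507, 1534, 1525, 14], [1507, 1516, 1543], [1534,
   1543, 1525], [1507, 1543, 1534], [1543, 1516, 1525], [1561, 148, 5, 1570], [148, 1561, 1552,
   14], [1552, 1579, 1570, 5, 14], [1561, 1588, 1552], [1588, 1570, 1579], [1588, 1579, 1552],
   [1561, 1570, 1588], [76, 1615, 1606, 148], [148, 1606, 5], [1606, 1597, 5], [1624, 76, 5],
   [1597, 1624, 5], [1615, 76, 1624], [1606, 1633, 1597], [1615, 1624, 1633], [1633, 1624, 1597],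
   [1606, 1642, 1633], [1615, 1633, 1642], [1615, 1642, 1606], [67, 1669, 1660, 148], [1651, 76,
   148, 1660], [1669, 67, 76, 1651, 1678], [1687, 1651, 1660], [1669, 1678, 1687], [1678, 1651,
   1687], [1669, 1687, 1660], [1705, 157, 5, 1714], [1696, 76, 157, 1705], [76, 1696, 1723, 1714,
   5], [1696, 1705, 1732], [1723, 1732, 1714], [1696, 1732, 1723], [1732, 1705, 1714], [1750, 157,
   26, 1759], [157, 1750, 5], [1750, 1741, 5], [5, 1741, 1768, 1759, 26], [1750, 1777, 1741],
   [1768, 1777, 1759], [1741, 1777, 1768], [1750, 1786, 1777], [1777, 1786, 1759], [1786, 1750,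
   1759], [61, 1813, 1804, 157], [157, 1804, 1795, 26], [1813, 61, 26, 1795, 1822], [1804, 1831,
   1795], [1813, 1822, 1831], [1831, 1822, 1795], [1813, 1831, 1804], [76, 1858, 1849, 157], [61,
   157, 1849], [1840, 61, 1849], [61, 1867, 76], [61, 1840, 1867], [76, 1867, 1858], [1840, 1849,
   1876], [1858, 1867, 1876], [1840, 1876, 1867], [1885, 1876, 1849], [1858, 1876, 1885], [1858,
   1885, 1849]]

/-- The stars of the vertices, by the codes of the neighbours in their cyclic order. -/
def starTable : List (List ℕ) :=
  [[4350, 1749, 4341, 156, 4269, 1713, 4287, 75, 4125, 1623, 4134, 1596, 4116, 1605, 4107, 147,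
   4035, 1569, 4053, 13, 2110, 319, 2083, 85, 1903, 166, 1912, 49, 2638, 658, 2620, 100, 2692,
   694, 2701, 685, 2719, 712, 2710, 19, 4359, 1740], [4, 4053, 1551, 4044, 147, 3972, 1524, 3990,
   66, 3837, 1407, 3828, 138, 3756, 1380, 3774, 22, 2425, 517, 2407, 94, 2182, 355, 2191, 40,
   2038, 274, 2020, 85, 2092, 310, 2101, 301, 2110], [499, 2425, 13, 3774, 1362, 3765, 138, 3693,
   1335, 3711, 57, 4443, 1797, 4434, 159, 4335, 1761, 4362, 7, 2713, 715, 2731, 706, 2686, 103,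
   2479, 544, 2488, 31, 2326, 472, 2344, 463, 2299, 94, 2416], [2254, 418, 2236, 94, 2308, 454,
   2317, 445, 2335, 472, 2326, 22, 2488, 562, 2470, 103, 2542, 598, 2551, 589, 2560, 52, 3613,
   1291, 3631, 1282, 3586, 133, 3379, 1120, 3388, 76, 3235, 1039, 3217, 112, 3289, 1075, 3298,
   1066, 3307, 40], [1957, 85, 2029, 256, 2038, 13, 2191, 373, 2173, 94, 2245, 400, 2254, 31,
   3307, 1084, 3280, 112, 3100, 931, 3109, 67, 2983, 859, 2965, 121, 3037, 886, 3046, 49, 1975,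
   229], [3610, 28, 2557, 604, 2530, 100, 2629, 640, 2638, 4, 1912, 184, 1894, 85, 1966, 211,
   1975, 40, 3046, 904, 3028, 121, 2803, 751, 2812, 742, 2830, 769, 2821, 58, 3538, 1234, 3520,
   130, 3592, 1270, 3601, 1261, 3619, 1288], [3430, 130, 3529, 1216, 3538, 49, 2821, 769, 2839,
   760, 2794, 121, 2911, 796, 2920, 67, 3910, 1471, 3883, 139, 3703, 1318, 3712, 23, 4438, 1810,
   4420, 154, 4492, 1846, 4501, 1837, 4519, 1864, 4510, 73, 3457, 1180], [58, 2920, 814, 2902,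
   121, 2974, 841, 2983, 40, 3109, 949, 3091, 112, 3163, 976, 3172, 76, 4225, 1669, 4207, 148,
   3982, 1507, 3991, 14, 3838, 1426, 3820, 139, 3892, 1462, 3901, 1453, 3910], [1651, 4225, 67,
   3172, 994, 3154, 112, 3226, 1021, 3235, 31, 3388, 1138, 3370, 133, 3442, 1174, 3451, 1165,
   3460, 61, 4513, 1867, 4531, 1858, 4486, 157, 4279, 1696, 4288, 5, 4126, 1624, 4144, 1615, 4099,
   148, 4216], [175, 1903, 4, 2083, 310, 2092, 13, 2020, 265, 2029, 40, 1957, 220, 1966, 49,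
   1894], [2182, 13, 2407, 508, 2416, 22, 2299, 454, 2308, 31, 2236, 409, 2245, 40, 2173, 364],
   [553, 2479, 22, 2686, 697, 2695, 7, 2623, 652, 2632, 52, 2533, 598, 2542, 31, 2470], [3091,
   940, 3100, 40, 3280, 1075, 3289, 31, 3217, 1030, 3226, 76, 3154, 985, 3163, 67], [2803, 49,
   3028, 895, 3037, 40, 2965, 850, 2974, 67, 2902, 805, 2911, 58, 2794, 751], [1126, 3376, 28,
   3583, 1270, 3592, 49, 3520, 1225, 3529, 58, 3430, 1171, 3439, 73, 3367], [1327, 3703, 58, 3883,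
   1462, 3892, 67, 3820, 1417, 3829, 14, 3757, 1372, 3766, 23, 3694], [3982, 67, 4207, 1660, 4216,
   76, 4099, 1606, 4108, 5, 4036, 1561, 4045, 14, 3973, 1516], [1705, 4279, 76, 4486, 1849, 4495,
   61, 4423, 1804, 4432, 26, 4333, 1750, 4342, 5, 4270], [4, 1903, 175, 1921, 202, 1939, 193,
   1912], [202, 1921, 166, 1903, 85, 1894, 184, 1948], [1912, 193, 1930, 202, 1948, 175, 1894,
   49], [1912, 166, 1939, 202, 1930, 184], [193, 1939, 166, 1921, 175, 1948, 184, 1930], [1966,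
   220, 1984, 247, 2002, 238, 1975, 49], [85, 1957, 229, 2011, 247, 1984, 211, 1966], [2011, 220,
   1957, 40, 1975, 238, 1993, 247], [247, 1993, 229, 1975, 211, 2002], [220, 2011, 229, 1993, 238,
   2002, 211, 1984], [265, 2047, 292, 2065, 283, 2038, 40, 2029], [2020, 274, 2074, 292, 2047,
   256, 2029, 85], [13, 2038, 283, 2056, 292, 2074, 265, 2020], [2056, 274, 2038, 256, 2065, 292],
   [2074, 274, 2056, 283, 2065, 256, 2047, 265], [2110, 13, 2101, 310, 2119, 337, 2137, 328],
   [2083, 319, 2164, 346, 2146, 337, 2119, 301, 2101, 13, 2092, 85], [4, 2110, 328, 2128, 337,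
   2155, 346, 2164, 310, 2083], [319, 2110, 301, 2137, 337, 2128], [346, 2155, 319, 2128, 328,
   2137, 301, 2119, 310, 2146], [2164, 319, 2155, 337, 2146, 310], [13, 2182, 364, 2200, 391,
   2218, 382, 2191], [2200, 355, 2182, 94, 2173, 373, 2227, 391], [2191, 382, 2209, 391, 2227,
   364, 2173, 40], [355, 2218, 391, 2209, 373, 2191], [2218, 355, 2200, 364, 2227, 373, 2209,
   382], [2245, 409, 2263, 436, 2281, 427, 2254, 40], [94, 2236, 418, 2290, 436, 2263, 400, 2245],
   [427, 2272, 436, 2290, 409, 2236, 31, 2254], [2281, 436, 2272, 418, 2254, 400], [409, 2290,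
   418, 2272, 427, 2281, 400, 2263], [2317, 454, 2353, 481, 2371, 472, 2335, 31], [94, 2299, 463,
   2398, 490, 2380, 481, 2353, 445, 2317, 31, 2308], [2299, 22, 2344, 472, 2362, 481, 2389, 490,
   2398, 454], [481, 2362, 463, 2344, 22, 2326, 31, 2335, 445, 2371], [454, 2380, 490, 2389, 463,
   2362, 472, 2371, 445, 2353], [2398, 463, 2389, 481, 2380, 454], [2452, 526, 2425, 22, 2416,
   508, 2434, 535], [2407, 517, 2461, 535, 2434, 499, 2416, 94], [13, 2425, 526, 2443, 535, 2461,
   508, 2407], [2443, 517, 2425, 499, 2452, 535], [2461, 517, 2443, 526, 2452, 499, 2434, 508],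
   [22, 2479, 553, 2497, 580, 2515, 571, 2488], [580, 2497, 544, 2479, 103, 2470, 562, 2524],
   [2488, 571, 2506, 580, 2524, 553, 2470, 31], [2488, 544, 2515, 580, 2506, 562], [571, 2515,
   544, 2497, 553, 2524, 562, 2506], [31, 2551, 598, 2569, 625, 2587, 616, 2560], [2542, 103,
   2533, 607, 2614, 634, 2596, 625, 2569, 589, 2551, 31], [2560, 616, 2578, 625, 2605, 634, 2614,
   598, 2533, 52], [589, 2587, 625, 2578, 607, 2560], [2569, 598, 2596, 634, 2605, 607, 2578, 616,
   2587, 589], [625, 2596, 598, 2614, 607, 2605], [2632, 652, 2650, 679, 2668, 670, 2641, 52],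
   [2623, 661, 2677, 679, 2650, 643, 2632, 103], [7, 2641, 670, 2659, 679, 2677, 652, 2623],
   [2659, 661, 2641, 643, 2668, 679], [2677, 661, 2659, 670, 2668, 643, 2650, 652], [2722, 7,
   2704, 697, 2740, 724, 2758, 715], [2686, 706, 2785, 733, 2767, 724, 2740, 688, 2704, 7, 2695,
   103], [22, 2731, 715, 2749, 724, 2776, 733, 2785, 697, 2686], [22, 2713, 7, 2722, 688, 2758,
   724, 2749, 706, 2731], [2776, 706, 2749, 715, 2758, 688, 2740, 697, 2767, 733], [706, 2776,
   724, 2767, 697, 2785], [49, 2812, 751, 2848, 778, 2866, 769, 2830], [2848, 742, 2812, 49, 2803,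
   121, 2794, 760, 2893, 787, 2875, 778], [769, 2857, 778, 2884, 787, 2893, 751, 2794, 58, 2839],
   [49, 2830, 742, 2866, 778, 2857, 760, 2839, 58, 2821], [2866, 742, 2848, 751, 2875, 787, 2884,
   760, 2857, 769], [778, 2875, 751, 2893, 760, 2884], [2911, 805, 2929, 832, 2947, 823, 2920,
   58], [121, 2902, 814, 2956, 832, 2929, 796, 2911], [823, 2938, 832, 2956, 805, 2902, 67, 2920],
   [2947, 832, 2938, 814, 2920, 796], [2929, 805, 2956, 814, 2938, 823, 2947, 796], [2974, 850,
   2992, 877, 3010, 868, 2983, 67], [121, 2965, 859, 3019, 877, 2992, 841, 2974], [40, 2983, 868,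
   3001, 877, 3019, 850, 2965], [877, 3001, 859, 2983, 841, 3010], [850, 3019, 859, 3001, 868,
   3010, 841, 2992], [40, 3037, 895, 3055, 922, 3073, 913, 3046], [3028, 904, 3082, 922, 3055,
   886, 3037, 121], [3046, 913, 3064, 922, 3082, 895, 3028, 49], [3046, 886, 3073, 922, 3064,
   904], [904, 3064, 913, 3073, 886, 3055, 895, 3082], [40, 3100, 940, 3118, 967, 3136, 958,
   3109], [3145, 967, 3118, 931, 3100, 112, 3091, 949], [3109, 958, 3127, 967, 3145, 940, 3091,
   67], [3109, 931, 3136, 967, 3127, 949], [958, 3136, 931, 3118, 940, 3145, 949, 3127], [67,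
   3163, 985, 3181, 1012, 3199, 1003, 3172], [112, 3154, 994, 3208, 1012, 3181, 976, 3163], [3172,
   1003, 3190, 1012, 3208, 985, 3154, 76], [976, 3199, 1012, 3190, 994, 3172], [976, 3181, 985,
   3208, 994, 3190, 1003, 3199], [1030, 3244, 1057, 3262, 1048, 3235, 76, 3226], [3217, 1039,
   3271, 1057, 3244, 1021, 3226, 112], [31, 3235, 1048, 3253, 1057, 3271, 1030, 3217], [3253,
   1039, 3235, 1021, 3262, 1057], [3271, 1039, 3253, 1048, 3262, 1021, 3244, 1030], [3307, 31,
   3298, 1075, 3316, 1102, 3334, 1093], [3280, 1084, 3361, 1111, 3343, 1102, 3316, 1066, 3298, 31,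
   3289, 112], [40, 3307, 1093, 3325, 1102, 3352, 1111, 3361, 1075, 3280], [1084, 3307, 1066,
   3334, 1102, 3325], [3352, 1084, 3325, 1093, 3334, 1066, 3316, 1075, 3343, 1111], [1084, 3352,
   1102, 3343, 1075, 3361], [31, 3379, 1129, 3397, 1156, 3415, 1147, 3388], [1156, 3397, 1120,
   3379, 133, 3370, 1138, 3424], [3388, 1147, 3406, 1156, 3424, 1129, 3370, 76], [3388, 1120,
   3415, 1156, 3406, 1138], [1147, 3415, 1120, 3397, 1129, 3424, 1138, 3406], [3451, 1174, 3469,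
   1201, 3487, 1192, 3460, 76], [133, 3433, 1183, 3514, 1210, 3496, 1201, 3469, 1165, 3451, 76,
   3442], [1201, 3505, 1210, 3514, 1174, 3433, 61, 3460, 1192, 3478], [1201, 3478, 1183, 3460,
   1165, 3487], [1174, 3496, 1210, 3505, 1183, 3478, 1192, 3487, 1165, 3469], [3496, 1174, 3514,
   1183, 3505, 1201], [3532, 1228, 3550, 1255, 3568, 1246, 3541, 61], [3523, 1237, 3577, 1255,
   3550, 1219, 3532, 133], [52, 3541, 1246, 3559, 1255, 3577, 1228, 3523], [3559, 1237, 3541,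
   1219, 3568, 1255], [3577, 1237, 3559, 1246, 3568, 1219, 3550, 1228], [1291, 3622, 52, 3604,
   1273, 3640, 1300, 3658], [3586, 1282, 3685, 1309, 3667, 1300, 3640, 1264, 3604, 52, 3595, 133],
   [31, 3631, 1291, 3649, 1300, 3676, 1309, 3685, 1273, 3586], [3649, 1282, 3631, 31, 3613, 52,
   3622, 1264, 3658, 1300], [1309, 3676, 1282, 3649, 1291, 3658, 1264, 3640, 1273, 3667], [3685,
   1282, 3676, 1300, 3667, 1273], [58, 3703, 1327, 3721, 1354, 3739, 1345, 3712], [1354, 3721,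
   1318, 3703, 139, 3694, 1336, 3748], [3712, 1345, 3730, 1354, 3748, 1327, 3694, 23], [3712,
   1318, 3739, 1354, 3730, 1336], [1345, 3739, 1318, 3721, 1327, 3748, 1336, 3730], [3766, 1372,
   3784, 1399, 3802, 1390, 3775, 23], [139, 3757, 1381, 3811, 1399, 3784, 1363, 3766], [3811,
   1372, 3757, 14, 3775, 1390, 3793, 1399], [1399, 3793, 1381, 3775, 1363, 3802], [1372, 3811,
   1381, 3793, 1390, 3802, 1363, 3784], [1417, 3847, 1444, 3865, 1435, 3838, 14, 3829], [3820,
   1426, 3874, 1444, 3847, 1408, 3829, 139], [67, 3838, 1435, 3856, 1444, 3874, 1417, 3820],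
   [3856, 1426, 3838, 1408, 3865, 1444], [3874, 1426, 3856, 1435, 3865, 1408, 3847, 1417], [3910,
   67, 3901, 1462, 3919, 1489, 3937, 1480], [3883, 1471, 3964, 1498, 3946, 1489, 3919, 1453, 3901,
   67, 3892, 139], [58, 3910, 1480, 3928, 1489, 3955, 1498, 3964, 1462, 3883], [1471, 3910, 1453,
   3937, 1489, 3928], [1498, 3955, 1471, 3928, 1480, 3937, 1453, 3919, 1462, 3946], [3964, 1471,
   3955, 1489, 3946, 1462], [67, 3982, 1516, 4000, 1543, 4018, 1534, 3991], [4000, 1507, 3982,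
   148, 3973, 1525, 4027, 1543], [3991, 1534, 4009, 1543, 4027, 1516, 3973, 14], [1507, 4018,
   1543, 4009, 1525, 3991], [4018, 1507, 4000, 1516, 4027, 1525, 4009, 1534], [4045, 1561, 4063,
   1588, 4081, 1579, 4054, 14], [148, 4036, 1570, 4090, 1588, 4063, 1552, 4045], [1579, 4072,
   1588, 4090, 1561, 4036, 5, 4054], [4081, 1588, 4072, 1570, 4054, 1552], [1561, 4090, 1570,
   4072, 1579, 4081, 1552, 4063], [4117, 1606, 4153, 1633, 4171, 1624, 4135, 5], [148, 4099, 1615,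
   4198, 1642, 4180, 1633, 4153, 1597, 4117, 5, 4108], [4099, 76, 4144, 1624, 4162, 1633, 4189,
   1642, 4198, 1606], [1633, 4162, 1615, 4144, 76, 4126, 5, 4135, 1597, 4171], [1606, 4180, 1642,
   4189, 1615, 4162, 1624, 4171, 1597, 4153], [4198, 1615, 4189, 1633, 4180, 1606], [4252, 1678,
   4225, 76, 4216, 1660, 4234, 1687], [4207, 1669, 4261, 1687, 4234, 1651, 4216, 148], [67, 4225,
   1678, 4243, 1687, 4261, 1660, 4207], [4243, 1669, 4225, 1651, 4252, 1687], [4261, 1669, 4243,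
   1678, 4252, 1651, 4234, 1660], [76, 4279, 1705, 4297, 1732, 4315, 1723, 4288], [1732, 4297,
   1696, 4279, 157, 4270, 1714, 4324], [4288, 1723, 4306, 1732, 4324, 1705, 4270, 5], [4288, 1696,
   4315, 1732, 4306, 1714], [1723, 4315, 1696, 4297, 1705, 4324, 1714, 4306], [5, 4351, 1750,
   4369, 1777, 4387, 1768, 4360], [4342, 157, 4333, 1759, 4414, 1786, 4396, 1777, 4369, 1741,
   4351, 5], [4360, 1768, 4378, 1777, 4405, 1786, 4414, 1750, 4333, 26], [1741, 4387, 1777, 4378,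
   1759, 4360], [4369, 1750, 4396, 1786, 4405, 1759, 4378, 1768, 4387, 1741], [1777, 4396, 1750,
   4414, 1759, 4405], [4432, 1804, 4450, 1831, 4468, 1822, 4441, 26], [4423, 1813, 4477, 1831,
   4450, 1795, 4432, 157], [61, 4441, 1822, 4459, 1831, 4477, 1804, 4423], [4459, 1813, 4441,
   1795, 4468, 1831], [4477, 1813, 4459, 1822, 4468, 1795, 4450, 1804], [4522, 61, 4504, 1849,
   4540, 1876, 4558, 1867], [4486, 1858, 4585, 1885, 4567, 1876, 4540, 1840, 4504, 61, 4495, 157],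
   [76, 4531, 1867, 4549, 1876, 4576, 1885, 4585, 1849, 4486], [76, 4513, 61, 4522, 1840, 4558,
   1876, 4549, 1858, 4531], [4576, 1858, 4549, 1867, 4558, 1840, 4540, 1849, 4567, 1885], [1858,
   4576, 1876, 4567, 1849, 4585]]

/-- A point of space together with a point of the plane, with integer coordinates. -/
structure IntPoint where
  x : ℤ
  y : ℤ
  z : ℤ
  u : ℤ
  v : ℤ

namespace IntPoint

/-- The sum of two points. -/
def add (a b : IntPoint) : IntPoint := ⟨a.x + b.x, a.y + b.y, a.z + b.z, a.u + b.u, a.v + b.v⟩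

/-- The difference of two points. -/
def sub (a b : IntPoint) : IntPoint := ⟨a.x - b.x, a.y - b.y, a.z - b.z, a.u - b.u, a.v - b.v⟩

/-- An integer multiple of a point. -/
def smul (k : ℤ) (a : IntPoint) : IntPoint := ⟨k * a.x, k * a.y, k * a.z, k * a.u, k * a.v⟩

/-- The inner product of the space components. -/
def dotSpace (a b : IntPoint) : ℤ := a.x * b.x + a.y * b.y + a.z * b.z

/-- The inner product of the plane components. -/
def dotPlane (a b : IntPoint) : ℤ := a.u * b.u + a.v * b.v

/-- The cross product of the plane components. -/
def crossPlane (a b : IntPoint) : ℤ := a.u * b.v - a.v * b.u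

/-- The cross product of the space components. -/
def crossSpace (a b : IntPoint) : IntPoint :=
  ⟨a.y * b.z - a.z * b.y, a.z * b.x - a.x * b.z, a.x * b.y - a.y * b.x, 0, 0⟩

/-- The action of the glide reflection group with periods `l` and `b`. -/
def move (l b m n : ℤ) (a : IntPoint) : IntPoint :=
  ⟨a.x, a.y, a.z, (if n % 2 = 0 then a.u else -a.u) + m * l, a.v + n * b⟩

end IntPoint

/-- The point given by a list of its coordinates. -/
def listPoint : List ℤ → IntPoint
  | [x, y, z, u, v] => ⟨x, y, z, u, v⟩
  | _ => ⟨0, 0, 0, 0, 0⟩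

/-- The translational part of the group element with code `c`. -/
def codeShift (c : ℕ) : ℤ := Int.subNatNat (c / 3 % 3) 1

/-- The exponent of the glide reflection in the group element with code `c`. -/
def codeGlide (c : ℕ) : ℤ := Int.subNatNat (c % 3) 1

/-- The circumference of the plane strip, before scaling. -/
def coarseWidth : ℤ := 99829276203412420665336840

/-- The length of the glide reflection, before scaling. -/
def coarseHeight : ℤ := 117655932668307495784146990

/-- The corner of a coarse triangle with code `c`. -/
def coarsePoint (c : ℕ) : IntPoint :=
  -- A code is `9 v + 3 (m + 1) + (n + 1)`: the vertex `v`, moved by the group element with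
  -- exponents `m` and `n` in `{-1, 0, 1}`. The residue `4` modulo `9` stands for the identity.
  (listPoint (coarseTable.getD (c / 9) [])).move coarseWidth coarseHeight (codeShift c) (codeGlide c)

/-- The barycentric coordinates of the inner vertices of a coarse triangle, multiplied by 24. -/
def innerWeights (k : ℕ) : List ℤ :=
  [[16, 4, 4], [4, 16, 4], [4, 4, 16], [9, 6, 9], [7, 10, 7], [5, 10, 9]].getD k []

/-- The weighted sum of three points. -/
def weightedSum : List ℤ → List ℕ → IntPoint
  | k :: ks, c :: cs => ((coarsePoint c).smul k).add (weightedSum ks cs)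
  | _, _ => ⟨0, 0, 0, 0, 0⟩

/-- The `k`-th vertex, before scaling. -/
def rawPoint (k : ℕ) : IntPoint :=
  -- The factor `24` clears the denominators of the barycentric coordinates of the inner vertices.
  if k < 18 then (listPoint (coarseTable.getD k [])).smul 24
  else
    weightedSum (innerWeights (innerTable.getD (k - 18) 0 % 6))
      (coarseTriangles.getD (innerTable.getD (k - 18) 0 / 6) [])

/-- The period of the plane strip. -/
def width : ℤ := 1440 * coarseWidth

/-- The length of the glide reflection. -/
def height : ℤ := 1440 * coarseHeight

/-- The sum of the vertices of a face, in the chart of the face. -/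
def rawSum : List ℕ → IntPoint
  | [] => ⟨0, 0, 0, 0, 0⟩
  | c :: cs =>
    ((rawPoint (c / 9)).move (24 * coarseWidth) (24 * coarseHeight) (codeShift c) (codeGlide c)).add
      (rawSum cs)

/-- The vertices of the refined complex: first the given vertices, then the centres of the faces. -/
def point (k : ℕ) : IntPoint :=
  -- Since `60` is a multiple of `3`, `4` and `5`, the centre of a face, the mean of its vertices,
  -- is integral at this scale. The total factor `24 * 60 = 1440` also appears in `width` and
  -- `height`.
  if k < 210 then (rawPoint k).smul 60
  else (rawSum (faceTable.getD (k - 210) [])).smul (60 / (faceTable.getD (k - 210) []).length : ℕ)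

/-- The star of a vertex of the refined complex. -/
def starCodes (k : ℕ) : List ℕ :=
  if k < 210 then starTable.getD k [] else faceTable.getD (k - 210) []

/-- The code of the `j`-th neighbour of a vertex of the refined complex. -/
def code (k j : ℕ) : ℕ := (starCodes k).getD (j % (starCodes k).length) 0

/-- The vertex with code `c`, in the chart to which the code refers. -/
def neighbor (c : ℕ) : IntPoint := (point (c / 9)).move width height (codeShift c) (codeGlide c)

end FlatKlein

namespace FlatKlein

/-! ### Finite checks -/

/-- The edge from the vertex `k` to the vertex with code `c`. -/
def spoke (k c : ℕ) : IntPoint := (neighbor c).sub (point k)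

/-- A predicate holds for all consecutive triples of a list. -/
def allTriples (p : ℕ → ℕ → ℕ → Bool) : List ℕ → Bool
  | a :: b :: c :: l => p a b c && allTriples p (b :: c :: l)
  | _ => true

/-- A predicate holds for some consecutive pair of a list. -/
def anyPair (p : ℕ → ℕ → Bool) : List ℕ → Bool
  | a :: b :: l => p a b || anyPair p (b :: l)
  | _ => false

/-- The star of a vertex, with its first `n` entries repeated at the end. -/
def closedStar (k n : ℕ) : List ℕ := starCodes k ++ (starCodes k).take n

/-- The codes in the star of `k` refer to distinct vertices other than `k`. -/
def nodupCheck (k : ℕ) : Bool := decide (k :: (starCodes k).map (· / 9)).Nodup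

/-- The entries of the star of `k` are codes; neighbours of faces are vertices. -/
def rangeCheck (k : ℕ) : Bool :=
  decide (3 ≤ (starCodes k).length) &&
    (starCodes k).all fun c => decide (c / 9 < if k < 210 then 510 else 210)

/-- One of two consecutive neighbours of a vertex is a face. -/
def faceCheck (k : ℕ) : Bool :=
  decide (210 ≤ k) || allTriples (fun a b _ => decide (210 ≤ a / 9) || decide (210 ≤ b / 9))
    (closedStar k 2)

/-- The point with code `x`, in the chart to which the code `c` leads. -/
def transported (c x : ℕ) : IntPoint := (neighbor x).move width height (codeShift c) (codeGlide c)

/-- Equality of the plane components. -/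
def IntPoint.samePlace (a b : IntPoint) : Bool := decide (a.u = b.u) && decide (a.v = b.v)

/-- The codes `x` and `y` in the star of the vertex with code `c` lead to `k` and to the vertex with
code `d`, compatibly with the chart of `k`. -/
def leadsBack (k c d x y : ℕ) : Bool :=
  decide (x / 9 = k) && decide (y / 9 = d / 9) && (transported c x).samePlace (point k) &&
    (transported c y).samePlace (neighbor d)

/-- The triangle of `k` with the vertices with codes `c` and `d` also occurs in the star of `c`. -/
def rotateCheck (k c d : ℕ) : Bool :=
  -- Both orders are admitted: the other star may list the two vertices in reverse, depending on the
  -- corner and on whether the change of charts is a reflection.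
  anyPair (fun x y => leadsBack k c d x y || leadsBack k c d y x) (closedStar (c / 9) 1)

/-- All triangles at `k` occur at their other vertices. -/
def chartCheck (k : ℕ) : Bool :=
  allTriples (fun c d _ => rotateCheck k c d && rotateCheck k d c) (closedStar k 2)

/-- The edges at a vertex form a fan in the chart, and have the same lengths in space. -/
def fanCheck (k : ℕ) : Bool :=
  allTriples (fun c d _ => decide (0 < (spoke k c).crossPlane (spoke k d)) &&
      decide ((spoke k c).v ≠ 0) &&
      decide ((spoke k c).dotSpace (spoke k c) = (spoke k c).dotPlane (spoke k c)))
    (closedStar k 2)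

/-- The edges at a vertex are sorted by their arguments. -/
def sortedCheck (k : ℕ) : Bool :=
  decide ((spoke k (code k 0)).v < 0) && decide (0 < (spoke k (code k ((starCodes k).length - 1))).v) &&
    allTriples (fun c d _ => decide ((spoke k c).v < 0) || decide (0 < (spoke k d).v))
      (closedStar k 1)

/-- Normals of planes that may separate neighbouring directions. -/
def adjacentNormals (a b c : IntPoint) : List IntPoint :=
  -- The plane through `b` and `a + c` separates `a` from `c` whenever the three are independent.
  -- The first normal, the part of `a` orthogonal to `b` up to a positive factor, serves flat
  -- vertices.
  [b.crossSpace (a.crossSpace b), b.crossSpace (a.add c), (a.add c).crossSpace b]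

/-- The directions `a` and `c` are on different sides of `b`. -/
def bendCheck (k : ℕ) : Bool :=
  allTriples (fun c d e => (adjacentNormals (spoke k c) (spoke k d) (spoke k e)).any fun h =>
      decide (h.dotSpace (spoke k d) = 0) && decide (0 < h.dotSpace (spoke k c)) &&
        decide (h.dotSpace (spoke k e) < 0))
    (closedStar k 2)

/-- The plane with normal `h` separates `a` and `b` from `c` and `d`. -/
def IntPoint.separates (h a b c d : IntPoint) : Bool :=
  (decide (0 < h.dotSpace a) && decide (0 < h.dotSpace b) && decide (h.dotSpace c ≤ 0) &&
    decide (h.dotSpace d ≤ 0)) ||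
  (decide (0 ≤ h.dotSpace a) && decide (0 ≤ h.dotSpace b) && decide (h.dotSpace c < 0) &&
    decide (h.dotSpace d < 0))

/-- Normals of planes that may separate two gaps of a vertex figure. -/
def gapNormals (a b c d : IntPoint) : List IntPoint :=
  -- These are candidates only; each is tested by `IntPoint.separates`, and one success is enough.
  [b.crossSpace (a.crossSpace b), a.crossSpace b, b.crossSpace a, a.add b,
   (a.crossSpace b).crossSpace a, (c.crossSpace d).crossSpace d, c.crossSpace (c.crossSpace d),
   (a.crossSpace b).crossSpace (a.sub b), c.crossSpace d, d.crossSpace c]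

/-- Two gaps of a vertex figure can be separated. -/
def gapsSeparated (a b c d : IntPoint) : Bool :=
  (gapNormals a b c d).any fun h => h.separates a b c d

/-- A gap can be separated from all gaps of a list. -/
def separatedFrom (a b : IntPoint) : List IntPoint → Bool
  | c :: d :: l => gapsSeparated a b c d && separatedFrom a b (d :: l)
  | _ => true

/-- Any two gaps of a list without common direction can be separated. -/
def allSeparated : List IntPoint → Bool
  | a :: b :: l => separatedFrom a b l && allSeparated (b :: l)
  | _ => true

/-- Any two gaps of a star without common direction can be separated. -/
def starSeparated (k : ℕ) : Bool :=
  -- The list covers all gaps but the closing one, from the last direction to the first. That gap is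
  -- tested separately; `tail.dropLast` omits its two adjacent gaps.
  allSeparated ((starCodes k).map (spoke k)) &&
    separatedFrom (spoke k (code k ((starCodes k).length - 1))) (spoke k (code k 0))
      ((starCodes k).map (spoke k)).tail.dropLast

/-- The vector `w` is in the plane spanned by `u` and `v`, in the same position as in the chart. -/
def IntPoint.inSpan (u v w : IntPoint) : Bool :=
  decide (u.crossPlane v * w.x = w.crossPlane v * u.x + u.crossPlane w * v.x) &&
    decide (u.crossPlane v * w.y = w.crossPlane v * u.y + u.crossPlane w * v.y) &&
      decide (u.crossPlane v * w.z = w.crossPlane v * u.z + u.crossPlane w * v.z)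

/-- A face is planar. -/
def planeCheck (k : ℕ) : Bool :=
  (starCodes k).all fun c => (spoke k (code k 0)).inSpan (spoke k (code k 1)) (spoke k c)

/-- The point `q` is to the right of a side of the triangle `a b c`. -/
def IntPoint.outside (q a b c : IntPoint) : Bool :=
  decide ((b.sub a).crossPlane (q.sub a) < 0) || decide ((c.sub b).crossPlane (q.sub b) < 0) ||
    decide ((a.sub c).crossPlane (q.sub c) < 0)

/-- The point lies in a rectangle that meets the orbit of the centre of the first face only once. -/
def IntPoint.inBox (a : IntPoint) : Bool :=
  decide (-width < 3 * a.u) && decide (4 * a.u < 3 * width) && decide (-height < 2 * a.v) &&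
    decide (4 * a.v < 5 * height)

/-- The triangles of a face other than the first one do not contain the centre of the first face. -/
def baseCheck (k : ℕ) : Bool :=
  (point k).inBox && allTriples (fun c d _ => (neighbor c).inBox &&
      (decide (k = 210) || (point 210).outside (point k) (neighbor c) (neighbor d)))
    (closedStar k 2)

/-- The position of the centre of the first face. -/
def centerCheck : Bool :=
  decide (-width ≤ 4 * (point 210).u) && decide (3 * (point 210).u ≤ 2 * width) &&
    decide (2 * (point 210).v ≤ height) && decide (height ≤ 4 * (point 210).v)

end FlatKlein

namespace FlatKlein

/-! ### Real coordinates -/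

namespace IntPoint

/-- The plane component of a point. -/
noncomputable def toPlane (a : IntPoint) : ℂ := ⟨a.u, a.v⟩

/-- The space component of a point. -/
noncomputable def toSpace (a : IntPoint) : E3 := !₂[(a.x : ℝ), a.y, a.z]

/-- The inner product with the space component of a point. -/
noncomputable def functional (h : IntPoint) : E3 →ₗ[ℝ] ℝ where
  toFun p := h.x * p 0 + h.y * p 1 + h.z * p 2
  map_add' p q := by simp; ring
  map_smul' r p := by simp; ring

lemma toPlane_sub (a b : IntPoint) : (a.sub b).toPlane = a.toPlane - b.toPlane := by
  apply Complex.ext <;> simp [toPlane, sub]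

lemma toSpace_sub (a b : IntPoint) : (a.sub b).toSpace = a.toSpace - b.toSpace := by
  ext i; fin_cases i <;> simp [toSpace, sub]

lemma toSpace_move (l b m n : ℤ) (a : IntPoint) : (a.move l b m n).toSpace = a.toSpace := rfl

lemma toPlane_move (l b m n : ℤ) (a : IntPoint) :
    (a.move l b m n).toPlane = glide l b m n a.toPlane := by
  apply Complex.ext
  · rw [glide_re]
    simp only [toPlane, move, Int.even_iff]
    split_ifs <;> push_cast <;> rfl
  · rw [glide_im]
    simp [toPlane, move]

lemma cross_toPlane (a b : IntPoint) : cross a.toPlane b.toPlane = (a.crossPlane b : ℤ) := by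
  simp [cross, toPlane, crossPlane]

lemma functional_toSpace (h a : IntPoint) : h.functional a.toSpace = (h.dotSpace a : ℤ) := by
  simp [functional, toSpace, dotSpace]

lemma norm_toSpace_eq {a : IntPoint} (h : a.dotSpace a = a.dotPlane a) :
    ‖a.toSpace‖ = ‖a.toPlane‖ := by
  have h1 : (a.x : ℝ) * a.x + a.y * a.y + a.z * a.z = a.u * a.u + a.v * a.v := by exact_mod_cast h
  have h2 : ‖a.toSpace‖ ^ 2 = ‖a.toPlane‖ ^ 2 := by
    rw [EuclideanSpace.norm_sq_eq, ← Complex.normSq_eq_norm_sq, Complex.normSq_apply]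
    simp only [toSpace, toPlane, Fin.sum_univ_three, Real.norm_eq_abs, sq_abs]
    simp only [Matrix.cons_val_zero, Matrix.cons_val_one, Matrix.cons_val]
    linarith
  exact (pow_left_inj₀ (norm_nonneg _) (norm_nonneg _) two_ne_zero).1 h2

lemma toPlane_eq {a b : IntPoint} (h : a.samePlace b = true) : a.toPlane = b.toPlane := by
  simp only [samePlace, Bool.and_eq_true, decide_eq_true_eq] at h
  simp [toPlane, h.1, h.2]

end IntPoint

/-! ### Lists -/

lemma allTriples_getD {p : ℕ → ℕ → ℕ → Bool} : ∀ {l : List ℕ}, allTriples p l = true → ∀ i,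
    i + 2 < l.length → p (l.getD i 0) (l.getD (i + 1) 0) (l.getD (i + 2) 0) = true
  | [], _, i, h => by simp at h
  | [a], _, i, h => by simp at h
  | [a, b], _, i, h => by simp at h
  | a :: b :: c :: l, hl, i, h => by
    simp only [allTriples, Bool.and_eq_true] at hl
    cases i with
    | zero => exact hl.1
    | succ i => exact allTriples_getD hl.2 i (by simpa using h)

lemma anyPair_getD {p : ℕ → ℕ → Bool} : ∀ {l : List ℕ}, anyPair p l = true → ∃ i,
    i + 1 < l.length ∧ p (l.getD i 0) (l.getD (i + 1) 0) = true
  | [], h => by simp [anyPair] at h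
  | [a], h => by simp [anyPair] at h
  | a :: b :: l, h => by
    simp only [anyPair, Bool.or_eq_true] at h
    rcases h with h | h
    · exact ⟨0, by simp, h⟩
    · obtain ⟨i, hi, hp⟩ := anyPair_getD h
      exact ⟨i + 1, by simpa using hi, hp⟩

lemma separatedFrom_getElem {a b : IntPoint} : ∀ {l : List IntPoint}, separatedFrom a b l = true →
    ∀ i, (h : i + 1 < l.length) → gapsSeparated a b l[i] l[i + 1] = true
  | [], _, i, h => by simp at h
  | [c], _, i, h => by simp at h
  | c :: d :: l, hl, i, h => by
    simp only [separatedFrom, Bool.and_eq_true] at hl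
    cases i with
    | zero => exact hl.1
    | succ i => exact separatedFrom_getElem hl.2 i (by simpa using h)

lemma allSeparated_getElem : ∀ {l : List IntPoint}, allSeparated l = true → ∀ j i,
    (h : i + 1 < l.length) → (hj : j + 1 < i) →
      gapsSeparated l[j] l[j + 1] l[i] l[i + 1] = true
  | [], _, _, i, h, _ => by simp at h
  | [c], _, _, i, h, _ => by simp at h
  | a :: b :: l, hl, j, i, h, hj => by
    simp only [allSeparated, Bool.and_eq_true] at hl
    obtain ⟨i, rfl⟩ : ∃ i', i = i' + 2 := ⟨i - 2, by omega⟩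
    cases j with
    | zero => exact separatedFrom_getElem hl.1 i (by simp at h; omega)
    | succ j => exact allSeparated_getElem hl.2 j (i + 1) (by simp at h ⊢; omega) (by omega)

/-! ### Stars -/

lemma code_periodic (k : ℕ) : Function.Periodic (code k) (starCodes k).length := fun j => by
  rw [code, code, Nat.add_mod_right]

lemma code_mod_add (k i j : ℕ) : code k (j % (starCodes k).length + i) = code k (j + i) := by
  rw [code, code, Nat.mod_add_mod]

lemma closedStar_getD {k n i : ℕ} (hn : n ≤ (starCodes k).length)
    (hi : i < (starCodes k).length + n) : (closedStar k n).getD i 0 = code k i := by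
  rw [closedStar, code]
  by_cases h : i < (starCodes k).length
  · rw [List.getD_append _ _ _ _ h, Nat.mod_eq_of_lt h]
  · push Not at h
    rw [List.getD_append_right _ _ _ _ h, Nat.mod_eq_sub_mod h, Nat.mod_eq_of_lt (by omega)]
    rw [List.getD_eq_getElem?_getD, List.getD_eq_getElem?_getD, List.getElem?_take_of_lt (by omega)]

lemma length_closedStar {k n : ℕ} (hn : n ≤ (starCodes k).length) :
    (closedStar k n).length = (starCodes k).length + n := by
  simp [closedStar, hn]

/-- Two entries repeated at the end close the cycle, so a check along the list holds at every index
of the periodic star. -/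
lemma allTriples_star {p : ℕ → ℕ → ℕ → Bool} {k : ℕ} (hk : 3 ≤ (starCodes k).length)
    (h : allTriples p (closedStar k 2) = true) (j : ℕ) :
    p (code k j) (code k (j + 1)) (code k (j + 2)) = true := by
  have hj := Nat.mod_lt j (show 0 < (starCodes k).length by omega)
  have h1 := allTriples_getD h (j % (starCodes k).length)
    (by rw [length_closedStar (by omega)]; omega)
  rw [closedStar_getD (by omega) (by omega), closedStar_getD (by omega) (by omega),
    closedStar_getD (by omega) (by omega), code_mod_add, code_mod_add] at h1
  have h0 := code_mod_add k 0 j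
  simp only [add_zero] at h0
  rwa [h0] at h1

end FlatKlein

namespace FlatKlein

/-! ### The finite checks succeed -/

section

set_option maxRecDepth 100000

lemma all_nodupCheck : (List.range 510).all nodupCheck = true := by decide +kernel

lemma all_rangeCheck : (List.range 510).all rangeCheck = true := by decide +kernel

lemma all_faceCheck : (List.range 510).all faceCheck = true := by decide +kernel

lemma all_chartCheck : (List.range 510).all chartCheck = true := by decide +kernel

lemma all_fanCheck : (List.range 510).all fanCheck = true := by decide +kernel

lemma all_sortedCheck : (List.range 510).all sortedCheck = true := by decide +kernel

lemma all_bendCheck : (List.range 510).all bendCheck = true := by decide +kernel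

lemma all_starSeparated : (List.range 510).all starSeparated = true := by decide +kernel

lemma all_planeCheck : (List.range 300).all (fun f => planeCheck (f + 210)) = true := by decide +kernel

lemma all_baseCheck : (List.range 300).all (fun f => baseCheck (f + 210)) = true := by decide +kernel

lemma centerCheck_eq : centerCheck = true := by decide +kernel

end

end FlatKlein

namespace FlatKlein

open PolyhedralComplex

/-! ### The complex -/

lemma check_of_all {p : ℕ → Bool} {n : ℕ} (h : (List.range n).all p = true) {k : ℕ} (hk : k < n) :
    p k = true :=
  List.all_eq_true.1 h k (List.mem_range.2 hk)

lemma three_le_length {k : ℕ} (hk : k < 510) : 3 ≤ (starCodes k).length := by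
  have h := check_of_all all_rangeCheck hk
  simp only [rangeCheck, Bool.and_eq_true, decide_eq_true_eq] at h
  exact h.1

lemma code_mem {k : ℕ} (hk : k < 510) (j : ℕ) : code k j ∈ starCodes k := by
  have h := Nat.mod_lt j (show 0 < (starCodes k).length by have := three_le_length hk; omega)
  rw [code, List.getD_eq_getElem _ _ h]
  exact List.getElem_mem h

lemma code_div_lt {k : ℕ} (hk : k < 510) (j : ℕ) : code k j / 9 < 510 := by
  have h := check_of_all all_rangeCheck hk
  simp only [rangeCheck, Bool.and_eq_true, List.all_eq_true, decide_eq_true_eq] at h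
  have := h.2 _ (code_mem hk j)
  split_ifs at this <;> omega

lemma code_face_div_lt {k : ℕ} (hk : k < 510) (hk' : 210 ≤ k) (j : ℕ) : code k j / 9 < 210 := by
  have h := check_of_all all_rangeCheck hk
  simp only [rangeCheck, Bool.and_eq_true, List.all_eq_true, decide_eq_true_eq] at h
  have := h.2 _ (code_mem hk j)
  split_ifs at this <;> omega

lemma code_div_ne {k : ℕ} (hk : k < 510) (j : ℕ) : code k j / 9 ≠ k := by
  have h := check_of_all all_nodupCheck hk
  simp only [nodupCheck, decide_eq_true_eq, List.nodup_cons] at h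
  exact fun he => h.1 (List.mem_map.2 ⟨_, code_mem hk j, he⟩)

lemma code_eq_of_div_eq {k : ℕ} (hk : k < 510) {i j : ℕ} (he : code k i / 9 = code k j / 9) :
    i % (starCodes k).length = j % (starCodes k).length := by
  have h := check_of_all all_nodupCheck hk
  simp only [nodupCheck, decide_eq_true_eq, List.nodup_cons] at h
  have h0 : 0 < (starCodes k).length := by have := three_le_length hk; omega
  have hi := Nat.mod_lt i h0
  have hj := Nat.mod_lt j h0
  rw [code, code, List.getD_eq_getElem _ _ hi, List.getD_eq_getElem _ _ hj] at he
  exact (List.Nodup.getElem_inj_iff h.2 (hi := by simpa using hi) (hj := by simpa using hj)).1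
    (by simpa using he)

/-- The polygonal complex with 210 vertices and 300 faces. -/
def bottle : PolyhedralComplex (Fin 210) (Fin 300) where
  size f := (starCodes (f + 210)).length
  three_le_size f := three_le_length (by omega)
  -- The reduction modulo `210` has no effect: by `rangeCheck` the neighbours of a face centre are
  -- below `210`.
  vert f i := Fin.ofNat 210 (code (f + 210) i / 9)
  vert_injective f i j h := by
    have hf : (f : ℕ) + 210 < 510 := by omega
    have h1 := congrArg Fin.val h
    simp only [Fin.val_ofNat] at h1
    rw [Nat.mod_eq_of_lt (code_face_div_lt hf (by omega) i),
      Nat.mod_eq_of_lt (code_face_div_lt hf (by omega) j)] at h1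
    have h2 := code_eq_of_div_eq hf h1
    rw [Nat.mod_eq_of_lt i.2, Nat.mod_eq_of_lt j.2] at h2
    exact Fin.ext h2

/-- The number of a vertex of the refined complex. -/
def index : Fin 210 ⊕ Fin 300 → ℕ := Sum.elim Fin.val fun f => f + 210

/-- The vertex of the refined complex with a given number. -/
def vertexOf (n : ℕ) : Fin 210 ⊕ Fin 300 :=
  if h : n < 210 then Sum.inl ⟨n, h⟩ else Sum.inr (Fin.ofNat 300 (n - 210))

lemma index_lt (w : Fin 210 ⊕ Fin 300) : index w < 510 := by
  rcases w with v | f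
  · exact v.2.trans (by norm_num)
  · change (f : ℕ) + 210 < 510; omega

lemma index_inr (f : Fin 300) : index (Sum.inr f) = (f : ℕ) + 210 := rfl

lemma index_vertexOf {n : ℕ} (h : n < 510) : index (vertexOf n) = n := by
  rcases lt_or_ge n 210 with h' | h'
  · exact congrArg index (dif_pos h')
  · obtain ⟨m, rfl⟩ := Nat.exists_eq_add_of_le' h'
    have h1 : m % 300 = m := Nat.mod_eq_of_lt (by omega)
    rw [vertexOf, dif_neg (not_lt.2 h'), index_inr, Nat.add_sub_cancel]
    exact congrArg (· + 210) h1

lemma vertexOf_index (w : Fin 210 ⊕ Fin 300) : vertexOf (index w) = w := by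
  rcases w with v | f
  · exact dif_pos v.2
  · have h : ¬ (f : ℕ) + 210 < 210 := by omega
    have h1 : (f + 210 - 210) % 300 = (f : ℕ) := by
      rw [Nat.add_sub_cancel, Nat.mod_eq_of_lt f.2]
    exact (dif_neg h).trans (congrArg Sum.inr (Fin.ext h1))

/-- The neighbours of a vertex of the refined complex, in their cyclic order. -/
def nbr (w : Fin 210 ⊕ Fin 300) (j : ℕ) : Fin 210 ⊕ Fin 300 := vertexOf (code (index w) j / 9)

/-- The number of triangles at a vertex of the refined complex. -/
def degree (w : Fin 210 ⊕ Fin 300) : ℕ := (starCodes (index w)).length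

/-- The positions in space of the vertices of the refined complex. -/
noncomputable def spacePoint (w : Fin 210 ⊕ Fin 300) : E3 := (point (index w)).toSpace

open Classical in
/-- The position of the vertex `e` in the chart of the vertex `w`. -/
noncomputable def chartPos (w e : Fin 210 ⊕ Fin 300) : ℂ :=
  if e = w then (point (index w)).toPlane
  else if h : ∃ j, nbr w j = e then (neighbor (code (index w) h.choose)).toPlane else 0

lemma index_nbr (w : Fin 210 ⊕ Fin 300) (j : ℕ) : index (nbr w j) = code (index w) j / 9 :=
  index_vertexOf (code_div_lt (index_lt w) j)

lemma chartPos_self (w : Fin 210 ⊕ Fin 300) : chartPos w w = (point (index w)).toPlane := if_pos rfl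

lemma chartPos_nbr (w : Fin 210 ⊕ Fin 300) (j : ℕ) :
    chartPos w (nbr w j) = (neighbor (code (index w) j)).toPlane := by
  have h1 : nbr w j ≠ w := fun h =>
    code_div_ne (index_lt w) j (by rw [← index_nbr, h])
  have h2 : ∃ i, nbr w i = nbr w j := ⟨j, rfl⟩
  rw [chartPos, if_neg h1, dif_pos h2]
  have h3 := congrArg index h2.choose_spec
  rw [index_nbr, index_nbr] at h3
  have h4 := code_eq_of_div_eq (index_lt w) h3
  rw [code, code, h4]

lemma toPlane_spoke (w : Fin 210 ⊕ Fin 300) (j : ℕ) :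
    (spoke (index w) (code (index w) j)).toPlane = chartPos w (nbr w j) - chartPos w w := by
  rw [spoke, IntPoint.toPlane_sub, chartPos_nbr, chartPos_self]

lemma toSpace_spoke (w : Fin 210 ⊕ Fin 300) (j : ℕ) :
    (spoke (index w) (code (index w) j)).toSpace = spacePoint (nbr w j) - spacePoint w := by
  rw [spoke, IntPoint.toSpace_sub, neighbor, IntPoint.toSpace_move, spacePoint, spacePoint,
    index_nbr]

/-- The circumference of the strip. -/
noncomputable abbrev period : ℝ := (width : ℤ)

/-- The length of the glide reflection. -/
noncomputable abbrev glideLength : ℝ := (height : ℤ)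

instance : Fact (0 < period) := ⟨by rw [period]; exact_mod_cast (by decide : 0 < width)⟩

instance : Fact (0 < glideLength) := ⟨by rw [glideLength]; exact_mod_cast (by decide : 0 < height)⟩

lemma toPlane_transported (c x : ℕ) : (transported c x).toPlane =
    glide period glideLength (codeShift c) (codeGlide c) (neighbor x).toPlane :=
  IntPoint.toPlane_move _ _ _ _ _

lemma toPlane_neighbor (c : ℕ) : (neighbor c).toPlane =
    glide period glideLength (codeShift c) (codeGlide c) (point (c / 9)).toPlane :=
  IntPoint.toPlane_move _ _ _ _ _

/-- The change of charts is the group element in the code of the `i`-th neighbour: `leadsBack`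
compares positions after transport by it. -/
lemma chart_of_rotateCheck {w : Fin 210 ⊕ Fin 300} {i j : ℕ}
    (h : rotateCheck (index w) (code (index w) i) (code (index w) j) = true) :
    IsTriangle nbr (nbr w i) w (nbr w j) ∧ ∃ m n : ℤ,
      chartPos w w = glide period glideLength m n (chartPos (nbr w i) w) ∧
      chartPos w (nbr w i) = glide period glideLength m n (chartPos (nbr w i) (nbr w i)) ∧
      chartPos w (nbr w j) = glide period glideLength m n (chartPos (nbr w i) (nbr w j)) := by
  obtain ⟨l, hl, hp⟩ := anyPair_getD h
  have ha := code_div_lt (index_lt w) i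
  have hlen := three_le_length ha
  rw [length_closedStar (by omega)] at hl
  rw [closedStar_getD (by omega) (by omega), closedStar_getD (by omega) (by omega),
    ← index_nbr] at hp
  have key : ∀ x y, leadsBack (index w) (code (index w) i) (code (index w) j)
      (code (index (nbr w i)) x) (code (index (nbr w i)) y) = true →
      nbr (nbr w i) x = w ∧ nbr (nbr w i) y = nbr w j ∧ ∃ m n : ℤ,
      chartPos w w = glide period glideLength m n (chartPos (nbr w i) w) ∧
      chartPos w (nbr w i) = glide period glideLength m n (chartPos (nbr w i) (nbr w i)) ∧
      chartPos w (nbr w j) = glide period glideLength m n (chartPos (nbr w i) (nbr w j)) := by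
    intro x y hxy
    simp only [leadsBack, Bool.and_eq_true, decide_eq_true_eq] at hxy
    obtain ⟨⟨⟨h1, h2⟩, h3⟩, h4⟩ := hxy
    have e1 : nbr (nbr w i) x = w := by rw [nbr, h1, vertexOf_index]
    have e2 : nbr (nbr w i) y = nbr w j := by rw [nbr, h2]; rfl
    refine ⟨e1, e2, codeShift (code (index w) i), codeGlide (code (index w) i), ?_, ?_, ?_⟩
    · have h5 := chartPos_nbr (nbr w i) x
      rw [e1] at h5
      rw [h5, ← toPlane_transported, IntPoint.toPlane_eq h3, chartPos_self]
    · rw [chartPos_nbr, toPlane_neighbor, chartPos_self, index_nbr]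
    · rw [← e2, chartPos_nbr (nbr w i), ← toPlane_transported, IntPoint.toPlane_eq h4, e2,
        chartPos_nbr]
  rw [Bool.or_eq_true] at hp
  rcases hp with hp | hp
  · obtain ⟨e1, e2, h⟩ := key _ _ hp
    exact ⟨⟨l, by rw [e1, e2]⟩, h⟩
  · obtain ⟨e1, e2, h⟩ := key _ _ hp
    exact ⟨⟨l, by rw [e1, e2]; exact Sym2.eq_swap⟩, h⟩

lemma chart_of_isTriangle {w a b : Fin 210 ⊕ Fin 300} (h : IsTriangle nbr w a b) :
    IsTriangle nbr a w b ∧ ∃ m n : ℤ,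
      chartPos w w = glide period glideLength m n (chartPos a w) ∧
      chartPos w a = glide period glideLength m n (chartPos a a) ∧
      chartPos w b = glide period glideLength m n (chartPos a b) := by
  obtain ⟨j, hj⟩ := h
  have h1 := allTriples_star (three_le_length (index_lt w))
    (check_of_all all_chartCheck (index_lt w)) j
  rw [Bool.and_eq_true] at h1
  rcases Sym2.eq_iff.1 hj with ⟨rfl, rfl⟩ | ⟨rfl, rfl⟩
  · exact chart_of_rotateCheck h1.1
  · exact chart_of_rotateCheck h1.2

lemma isFan_chartPos (w : Fin 210 ⊕ Fin 300) :
    IsFan (fun j => chartPos w (nbr w j) - chartPos w w) (degree w) := by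
  have hk := index_lt w
  have hlen := three_le_length hk
  have hfan := allTriples_star hlen (check_of_all all_fanCheck hk)
  simp only [Bool.and_eq_true, decide_eq_true_eq] at hfan
  have hsort := check_of_all all_sortedCheck hk
  simp only [sortedCheck, Bool.and_eq_true, decide_eq_true_eq] at hsort
  simp only [← toPlane_spoke]
  refine ⟨by rw [degree]; omega, ?_, fun j _ => ?_, fun j _ => ?_, ?_, ?_, fun j hj hpos => ?_⟩
  · have := code_periodic (index w) 0
    rw [zero_add] at this
    simp only [degree, this]
  · rw [IntPoint.cross_toPlane]
    exact_mod_cast (hfan j).1.1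
  · simp only [IntPoint.toPlane]
    exact_mod_cast (hfan j).1.2
  · simp only [IntPoint.toPlane]
    exact_mod_cast hsort.1.1
  · simp only [IntPoint.toPlane, degree]
    exact_mod_cast hsort.1.2
  · rw [degree] at hj
    have h1 := allTriples_getD hsort.2 j (by rw [length_closedStar (by omega)]; omega)
    rw [closedStar_getD (by omega) (by omega), closedStar_getD (by omega) (by omega)] at h1
    simp only [Bool.or_eq_true, decide_eq_true_eq] at h1
    simp only [IntPoint.toPlane] at hpos ⊢
    have hpos' : 0 < (spoke (index w) (code (index w) j)).v := by exact_mod_cast hpos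
    exact_mod_cast h1.resolve_left (by omega)

lemma separation_of_gapsSeparated {a b c d : IntPoint} (h : gapsSeparated a b c d = true) :
    ∃ f : E3 →ₗ[ℝ] ℝ,
      (0 < f a.toSpace ∧ 0 < f b.toSpace ∧ f c.toSpace ≤ 0 ∧ f d.toSpace ≤ 0) ∨
      (0 ≤ f a.toSpace ∧ 0 ≤ f b.toSpace ∧ f c.toSpace < 0 ∧ f d.toSpace < 0) := by
  obtain ⟨n, -, hn⟩ := List.any_eq_true.1 h
  simp only [IntPoint.separates, Bool.or_eq_true, Bool.and_eq_true, decide_eq_true_eq] at hn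
  refine ⟨n.functional, ?_⟩
  simp only [IntPoint.functional_toSpace]
  rcases hn with ⟨⟨⟨h1, h2⟩, h3⟩, h4⟩ | ⟨⟨⟨h1, h2⟩, h3⟩, h4⟩
  · left
    exact ⟨by exact_mod_cast h1, by exact_mod_cast h2, by exact_mod_cast h3, by exact_mod_cast h4⟩
  · right
    exact ⟨by exact_mod_cast h1, by exact_mod_cast h2, by exact_mod_cast h3, by exact_mod_cast h4⟩

/-- The closing gap is tested as the first of the pair, hence the alternative with exchanged roles;
a change of sign of the functional repairs it later. -/
lemma gapsSeparated_star {k : ℕ} (hk : k < 510) {j l : ℕ} (hl : l < (starCodes k).length)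
    (hjl : j + 1 < l) (hex : ¬(j = 0 ∧ l + 1 = (starCodes k).length)) :
    gapsSeparated (spoke k (code k j)) (spoke k (code k (j + 1))) (spoke k (code k l))
      (spoke k (code k (l + 1))) = true ∨
    gapsSeparated (spoke k (code k l)) (spoke k (code k (l + 1))) (spoke k (code k j))
      (spoke k (code k (j + 1))) = true := by
  have h := check_of_all all_starSeparated hk
  simp only [starSeparated, Bool.and_eq_true] at h
  have hget : ∀ i (hi : i < ((starCodes k).map (spoke k)).length),
      ((starCodes k).map (spoke k))[i] = spoke k (code k i) := by
    intro i hi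
    rw [List.length_map] at hi
    rw [List.getElem_map, code, Nat.mod_eq_of_lt hi, List.getD_eq_getElem _ _ hi]
  by_cases hlast : l + 1 < (starCodes k).length
  · left
    have h1 := allSeparated_getElem h.1 j l (by simpa using hlast) hjl
    rwa [hget, hget, hget, hget] at h1
  · right
    obtain ⟨j, rfl⟩ : ∃ j', j = j' + 1 := ⟨j - 1, by omega⟩
    have h1 := separatedFrom_getElem h.2 j (by simp; omega)
    simp only [List.getElem_dropLast, List.getElem_tail, hget] at h1
    have e1 : (starCodes k).length - 1 = l := by omega
    have e2 : code k (l + 1) = code k 0 := by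
      rw [show l + 1 = 0 + (starCodes k).length by omega, code_periodic]
    rwa [e1, ← e2] at h1

lemma isEmbeddedCone_spacePoint (w : Fin 210 ⊕ Fin 300) :
    IsEmbeddedCone (fun j => spacePoint (nbr w j) - spacePoint w) (degree w) := by
  have hk := index_lt w
  have hlen := three_le_length hk
  simp only [← toSpace_spoke]
  refine isEmbeddedCone_of_separation (fun j => ?_) (fun j _ => ?_) fun j hj l hl hjl hex => ?_
  · simp only [degree, code_periodic (index w) j]
  · have h := allTriples_star hlen (check_of_all all_bendCheck hk) j
    obtain ⟨n, -, hn⟩ := List.any_eq_true.1 h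
    simp only [Bool.and_eq_true, decide_eq_true_eq] at hn
    refine ⟨n.functional, ?_⟩
    simp only [IntPoint.functional_toSpace]
    exact ⟨by exact_mod_cast hn.1.1, by exact_mod_cast hn.1.2, by exact_mod_cast hn.2⟩
  · rcases gapsSeparated_star hk hl hjl hex with h | h
    · exact separation_of_gapsSeparated h
    · obtain ⟨f, hf⟩ := separation_of_gapsSeparated h
      refine ⟨-f, ?_⟩
      simp only [LinearMap.neg_apply, Left.neg_pos_iff, Left.nonneg_neg_iff, neg_lt_zero,
        neg_nonpos]
      tauto

set_option maxRecDepth 20000 in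
lemma nbr_face (f : Fin 300) (i : Fin (bottle.size f)) :
    nbr (Sum.inr f) i = Sum.inl (bottle.vert f i) := by
  have hf : (f : ℕ) + 210 < 510 := by omega
  have h := code_face_div_lt hf (by omega) i
  rw [nbr, index_inr, vertexOf, dif_pos h]
  exact congrArg Sum.inl (Fin.ext (Nat.mod_eq_of_lt h).symm)

set_option maxRecDepth 20000 in
lemma isDevelopment_bottle :
    IsDevelopment bottle spacePoint period glideLength degree nbr chartPos where
  periodic w j := by rw [nbr, nbr, degree, code_periodic]
  deg_face f := by rw [degree, index_inr]; rfl
  nb_face := nbr_face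
  rotate h := (chart_of_isTriangle h).1
  exists_face := by
    have hface : ∀ {n : ℕ}, 210 ≤ n → ∃ f, vertexOf n = Sum.inr f := fun h =>
      ⟨_, dif_neg (not_lt.2 h)⟩
    rintro w a b ⟨j, hj⟩
    have h := check_of_all all_faceCheck (index_lt w)
    simp only [faceCheck, Bool.or_eq_true, decide_eq_true_eq] at h
    rcases h with h | h
    · left
      rw [← vertexOf_index w]
      exact hface h
    · right
      have h1 := allTriples_star (three_le_length (index_lt w)) h j
      simp only [Bool.or_eq_true, decide_eq_true_eq] at h1
      have h2 : (∃ f, nbr w j = Sum.inr f) ∨ ∃ f, nbr w (j + 1) = Sum.inr f :=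
        h1.imp hface hface
      rcases Sym2.eq_iff.1 hj with ⟨rfl, rfl⟩ | ⟨rfl, rfl⟩
      · exact h2
      · exact h2.symm
  chart h := (chart_of_isTriangle h).2
  fan := isFan_chartPos
  norm_eq w j := by
    have h := allTriples_star (three_le_length (index_lt w))
      (check_of_all all_fanCheck (index_lt w)) j
    simp only [Bool.and_eq_true, decide_eq_true_eq] at h
    rw [← toSpace_spoke, ← toPlane_spoke]
    exact IntPoint.norm_toSpace_eq h.2
  cone := isEmbeddedCone_spacePoint

end FlatKlein

namespace FlatKlein

open PolyhedralComplex

/-! ### Counting faces, and a cochain that detects torsion -/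

/-- A cochain on the coarse edges that leave the fundamental domain through its vertical sides. -/
def crossing (u v : Fin 210) : ℤ :=
  -- The middle digit of a code is `1` exactly when the translational part is zero.
  if u < v ∧ ((starCodes u).any fun c => c / 9 == v && c / 3 % 3 != 1) = true then 1 else 0

-- The translational part modulo two is a homomorphism on the glide reflection group, because signs
-- do not matter, and the group elements along the boundary of a face compose to the identity.
set_option maxRecDepth 100000 in
lemma crossing_even : ∀ f, 2 ∣ faceValue bottle crossing f := by decide +kernel

-- The class detected in this way is that of the translation by `L`, which the glide reflection
-- conjugates to its inverse.
set_option maxRecDepth 100000 in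
lemma crossing_odd : ¬ 4 ∣ ∑ f, faceValue bottle crossing f := by decide +kernel

set_option maxRecDepth 100000 in
lemma card_size_bottle : (Finset.univ.filter fun f => bottle.size f = 3).card = 210 ∧
    (Finset.univ.filter fun f => bottle.size f = 4).card = 60 ∧
    (Finset.univ.filter fun f => bottle.size f = 5).card = 30 := by decide +kernel

set_option maxRecDepth 100000 in
lemma sum_size_bottle : ∑ f, bottle.size f = 1020 := by decide +kernel

lemma card_edges_bottle : bottle.edges.card = 510 := by
  have h := isDevelopment_bottle.two_mul_card_edges
  rw [sum_size_bottle] at h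
  omega

lemma eulerChar_bottle : bottle.eulerChar = 0 := by
  rw [eulerChar, card_edges_bottle, Fintype.card_fin, Fintype.card_fin]
  norm_num

/-! ### Planarity -/

/-- The coefficients are those of Cramer's rule in the chart; `IntPoint.inSpan` asserts that they
are also right in space. -/
lemma mem_span_of_inSpan {u v w : IntPoint} (h0 : u.crossPlane v ≠ 0) (h : u.inSpan v w = true) :
    w.toSpace ∈ Submodule.span ℝ {u.toSpace, v.toSpace} := by
  simp only [IntPoint.inSpan, Bool.and_eq_true, decide_eq_true_eq] at h
  obtain ⟨⟨h1, h2⟩, h3⟩ := h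
  have h1' : (u.crossPlane v : ℝ) * w.x = w.crossPlane v * u.x + u.crossPlane w * v.x := by
    exact_mod_cast h1
  have h2' : (u.crossPlane v : ℝ) * w.y = w.crossPlane v * u.y + u.crossPlane w * v.y := by
    exact_mod_cast h2
  have h3' : (u.crossPlane v : ℝ) * w.z = w.crossPlane v * u.z + u.crossPlane w * v.z := by
    exact_mod_cast h3
  have h0' : (u.crossPlane v : ℝ) ≠ 0 := by exact_mod_cast h0
  refine Submodule.mem_span_pair.2 ⟨w.crossPlane v / u.crossPlane v,
    u.crossPlane w / u.crossPlane v, ?_⟩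
  ext i
  fin_cases i <;> simp [IntPoint.toSpace] <;> field_simp <;> linarith

lemma fan_pos {k : ℕ} (hk : k < 510) (j : ℕ) :
    0 < (spoke k (code k j)).crossPlane (spoke k (code k (j + 1))) := by
  have h := allTriples_star (three_le_length hk) (check_of_all all_fanCheck hk) j
  simp only [Bool.and_eq_true, decide_eq_true_eq] at h
  exact h.1.1

lemma face_planar (f : Fin 300) : ∃ u v : E3, ∀ j,
    spacePoint (nbr (Sum.inr f) j) - spacePoint (Sum.inr f) ∈ Submodule.span ℝ {u, v} := by
  have hk := index_lt (Sum.inr f)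
  have h : planeCheck (index (Sum.inr f)) = true := check_of_all all_planeCheck f.2
  refine ⟨(spoke (index (Sum.inr f)) (code (index (Sum.inr f)) 0)).toSpace,
    (spoke (index (Sum.inr f)) (code (index (Sum.inr f)) 1)).toSpace, fun j => ?_⟩
  rw [← toSpace_spoke]
  exact mem_span_of_inSpan (fan_pos hk 0).ne' (List.all_eq_true.1 h _ (code_mem hk j))

/-! ### The centre of the first face -/

/-- The three cross products are the barycentric coordinates of `q`, multiplied by twice the area of
the triangle. -/
lemma cross_nonneg_of_mem_convexHull {a b c q : ℂ} (hD : 0 ≤ cross (b - a) (c - a))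
    (hq : q ∈ convexHull ℝ {a, b, c}) :
    0 ≤ cross (b - a) (q - a) ∧ 0 ≤ cross (c - b) (q - b) ∧ 0 ≤ cross (a - c) (q - c) := by
  obtain ⟨s, t, hs, ht, hst, rfl⟩ := mem_convexHull_triple.1 hq
  have h1 : cross (b - a) (a + s • (b - a) + t • (c - a) - a) = t * cross (b - a) (c - a) := by
    simp [cross]; ring
  have h2 : cross (c - b) (a + s • (b - a) + t • (c - a) - b) =
      (1 - s - t) * cross (b - a) (c - a) := by
    simp [cross]; ring
  have h3 : cross (a - c) (a + s • (b - a) + t • (c - a) - c) = s * cross (b - a) (c - a) := by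
    simp [cross]; ring
  rw [h1, h2, h3]
  exact ⟨mul_nonneg ht hD, mul_nonneg (by linarith) hD, mul_nonneg hs hD⟩

/-- The rectangle that meets the orbit of the centre of the first face only once. -/
def box : Set ℂ :=
  {z | -period < 3 * z.re} ∩ {z | 4 * z.re < 3 * period} ∩ {z | -glideLength < 2 * z.im} ∩
    {z | 4 * z.im < 5 * glideLength}

lemma convex_box : Convex ℝ box := by
  have hre : ∀ r : ℝ, IsLinearMap ℝ fun z : ℂ => r * z.re := fun r =>
    ⟨fun _ _ => by simp [mul_add], fun _ _ => by simp; ring⟩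
  have him : ∀ r : ℝ, IsLinearMap ℝ fun z : ℂ => r * z.im := fun r =>
    ⟨fun _ _ => by simp [mul_add], fun _ _ => by simp; ring⟩
  exact (((convex_halfSpace_gt (hre 3) _).inter (convex_halfSpace_lt (hre 4) _)).inter
    (convex_halfSpace_gt (him 2) _)).inter (convex_halfSpace_lt (him 4) _)

lemma toPlane_mem_box {a : IntPoint} (h : a.inBox = true) : a.toPlane ∈ box := by
  simp only [IntPoint.inBox, Bool.and_eq_true, decide_eq_true_eq] at h
  obtain ⟨⟨⟨h1, h2⟩, h3⟩, h4⟩ := h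
  exact ⟨⟨⟨show -(width : ℝ) < 3 * (a.u : ℝ) by exact_mod_cast h1,
    show 4 * (a.u : ℝ) < 3 * (width : ℝ) by exact_mod_cast h2⟩,
    show -(height : ℝ) < 2 * (a.v : ℝ) by exact_mod_cast h3⟩,
    show 4 * (a.v : ℝ) < 5 * (height : ℝ) by exact_mod_cast h4⟩

/-- In units of the periods, the centre lies in `[-1/4, 2/3] × [1/4, 1/2]` and the box is `(-1/3,
3/4) × (-1/2, 5/4)`, so a shift by one period just leaves the box. The vertical direction comes
first, since an odd `n` changes the sign of the real part. -/
lemma eq_zero_of_glide_mem_box {m n : ℤ}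
    (h : glide period glideLength m n (point 210).toPlane ∈ box) : m = 0 ∧ n = 0 := by
  have hc := centerCheck_eq
  simp only [centerCheck, Bool.and_eq_true, decide_eq_true_eq] at hc
  obtain ⟨⟨⟨h1, h2⟩, h3⟩, h4⟩ := hc
  have h1' : -period ≤ 4 * (point 210).toPlane.re := show -(width : ℝ) ≤ 4 * ((point 210).u : ℝ) by
    exact_mod_cast h1
  have h2' : 3 * (point 210).toPlane.re ≤ 2 * period :=
    show 3 * ((point 210).u : ℝ) ≤ 2 * (width : ℝ) by exact_mod_cast h2
  have h3' : 2 * (point 210).toPlane.im ≤ glideLength :=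
    show 2 * ((point 210).v : ℝ) ≤ (height : ℝ) by exact_mod_cast h3
  have h4' : glideLength ≤ 4 * (point 210).toPlane.im :=
    show (height : ℝ) ≤ 4 * ((point 210).v : ℝ) by exact_mod_cast h4
  have hL : 0 < period := Fact.out
  have hB : 0 < glideLength := Fact.out
  obtain ⟨⟨⟨g1, g2⟩, g3⟩, g4⟩ := h
  simp only [mem_ofPred_eq, glide_re, glide_im] at g1 g2 g3 g4
  have hn : n = 0 := by
    by_contra hne
    rcases lt_or_gt_of_ne hne with h | h
    · have : (n : ℝ) ≤ -1 := by exact_mod_cast Int.le_sub_one_of_lt h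
      nlinarith
    · have : (1 : ℝ) ≤ n := by exact_mod_cast h
      nlinarith
  subst hn
  refine ⟨?_, rfl⟩
  rw [if_pos Even.zero] at g1 g2
  by_contra hne
  rcases lt_or_gt_of_ne hne with h | h
  · have : (m : ℝ) ≤ -1 := by exact_mod_cast Int.le_sub_one_of_lt h
    nlinarith
  · have : (1 : ℝ) ≤ m := by exact_mod_cast h
    nlinarith

lemma not_mem_convexHull_of_outside {q a b c : IntPoint}
    (hD : 0 ≤ (b.sub a).crossPlane (c.sub a)) (h : q.outside a b c = true) :
    q.toPlane ∉ convexHull ℝ {a.toPlane, b.toPlane, c.toPlane} := by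
  intro hq
  have h1 := cross_nonneg_of_mem_convexHull (by
    rw [← IntPoint.toPlane_sub, ← IntPoint.toPlane_sub, IntPoint.cross_toPlane]
    exact_mod_cast hD) hq
  simp only [← IntPoint.toPlane_sub, IntPoint.cross_toPlane, Int.cast_nonneg_iff] at h1
  simp only [IntPoint.outside, Bool.or_eq_true, decide_eq_true_eq] at h
  omega

/-- All triangles at face centres lie in the convex set `box`, which contains no translate of the
centre but the centre itself. It remains to see that the centre is outside all triangles of the
other faces. -/
lemma center_covered_once (f : Fin 300) (a b : Fin 210 ⊕ Fin 300)
    (h : IsTriangle nbr (Sum.inr f) a b) (m n : ℤ)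
    (hq : glide period glideLength m n (chartPos (Sum.inr 0) (Sum.inr 0)) ∈ convexHull ℝ
      {chartPos (Sum.inr f) (Sum.inr f), chartPos (Sum.inr f) a, chartPos (Sum.inr f) b}) :
    f = 0 ∧ m = 0 ∧ n = 0 := by
  obtain ⟨j, hj⟩ := h
  wlog hab : nbr (Sum.inr f) j = a ∧ nbr (Sum.inr f) (j + 1) = b generalizing a b
  · refine this b a ?_ (hj.trans Sym2.eq_swap)
      ((Sym2.eq_iff.1 hj).resolve_left hab)
    rwa [pair_comm (chartPos (Sum.inr f) b)]
  obtain ⟨rfl, rfl⟩ := hab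
  have hk := index_lt (Sum.inr f)
  have hlen := three_le_length hk
  have hcheck : baseCheck (index (Sum.inr f)) = true := check_of_all all_baseCheck f.2
  rw [baseCheck, Bool.and_eq_true] at hcheck
  have h1 := allTriples_star hlen hcheck.2 j
  -- The check at one index tests only the first neighbour against the box; the next index supplies
  -- the other one.
  have h2 := allTriples_star hlen hcheck.2 (j + 1)
  simp only [Bool.and_eq_true, Bool.or_eq_true, decide_eq_true_eq] at h1 h2
  rw [chartPos_nbr, chartPos_nbr, chartPos_self, chartPos_self] at hq
  have hbox : convexHull ℝ {(point (index (Sum.inr f))).toPlane,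
      (neighbor (code (index (Sum.inr f)) j)).toPlane,
      (neighbor (code (index (Sum.inr f)) (j + 1))).toPlane} ⊆ box := by
    refine convexHull_min ?_ convex_box
    rintro z (rfl | rfl | rfl)
    · exact toPlane_mem_box hcheck.1
    · exact toPlane_mem_box h1.1
    · exact toPlane_mem_box h2.1
  obtain ⟨rfl, rfl⟩ := eq_zero_of_glide_mem_box (hbox hq)
  refine ⟨?_, rfl, rfl⟩
  have hid : ∀ z, glide period glideLength 0 0 z = z := fun z =>
    Complex.ext (by simp [glide_re]) (by simp [glide_im])
  rw [hid] at hq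
  rcases h1.2 with h3 | h3
  · exact Fin.ext (Nat.add_right_cancel h3)
  · exact absurd hq (not_mem_convexHull_of_outside (fan_pos hk j).le h3)

end FlatKlein

open FlatKlein PolyhedralComplex in
theorem mainTheorem1 :
    ∃ (K : PolyhedralComplex (Fin 210) (Fin 300)) (p : Fin 210 → E3) (c : Fin 300 → E3),
      -- the numbers of edges, triangles, quadrilaterals and pentagons
      (K.edges.card = 510 ∧
        (Finset.univ.filter fun f => K.size f = 3).card = 210 ∧
        (Finset.univ.filter fun f => K.size f = 4).card = 60 ∧
        (Finset.univ.filter fun f => K.size f = 5).card = 30) ∧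
      -- the topology of the complex
      (K.IsClosedSurface ∧ K.eulerChar = 0 ∧
        (∃ z : K.H₁, z ≠ 0 ∧ IsOfFinAddOrder z) ∧
        Nonempty (K.space ≃ₜ KleinBottle)) ∧
      -- planar faces, zero angle defects, embedded vertex figures
      (K.HasPlanarFaces p c ∧
        (∀ v, K.angleSum p c v = 2 * Real.pi) ∧
        (∀ v, K.HasEmbeddedVertexFigure p c v)) ∧
      -- the map is a local isometric embedding for a flat metric on the complex
      ∃ (M : Type) (_ : MetricSpace M) (h : K.space ≃ₜ M),
        IsFlatSurface M ∧
          IsLocalIsometricEmbedding fun m => PolyhedralComplex.plMap p c (h.symm m : _ → ℝ) := by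
  have h := isDevelopment_bottle
  obtain ⟨φ, hφ⟩ := h.exists_homeomorph 0 center_covered_once
  have hc : IsConnected bottle.space := by
    have := φ.symm.surjective.connectedSpace φ.symm.continuous
    exact isConnected_iff_connectedSpace.2 this
  have hs := h.isClosedSurface hc
  refine ⟨bottle, spacePoint ∘ Sum.inl, spacePoint ∘ Sum.inr, ⟨card_edges_bottle, card_size_bottle⟩,
    ⟨hs, eulerChar_bottle,
      exists_torsion bottle hs.edge_twice crossing crossing_even crossing_odd,
      ⟨φ.trans (kleinBottleHomeo period glideLength).symm⟩⟩,
    ⟨h.hasPlanarFaces face_planar, h.angleSum_eq, h.hasEmbeddedVertexFigure⟩,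
    FlatBottle period glideLength, inferInstance, φ, isFlatSurface_flatBottle, ?_⟩
  simp only [IsDevelopment.plMap_eq]
  exact h.isLocalIsometricEmbedding φ hφ
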